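/- Let $d\ge 1$, let $Q\subset\mathbb R^d$ be a rate one Poisson point process, and let $\alpha>1$. For $x\in\mathbb R^d$ let $q(x)$ be a point of $Q$ closest to $x$ in the Euclidean norm $\|\cdot\|$, ties being broken arbitrarily. For $a,b\in Q$ let \[ T(a,b)=\inf\sum_{i=1}^{m-1}\|r_i-r_{i+1}\|^{\alpha}, \] the infimum being over all finite sequences $r_1,\dots,r_m$ ($m\ge1$) of points of $Q$ with $r_1=a$ and $r_m=b$; for $x,y\in\mathbb R^d$ put $T(x,y)=T(q(x),q(y))$. Let $e_1$ be the first standard basis vector of $\mathbb R^d$ and $T_n=T(0,ne_1)$ for real $n\ge0$. Let $\psi:(0,\infty)\to(0,\infty)$ be a function that satisfies the following two assumptions. (1) There are constants $C_0,C_1,\kappa_1,\kappa_2>0$ such that \[ \mathbb P\bigl(|T_n-\mathbb E T_n|>\lambda\psi(n)\bigr)\le C_1\exp(-C_0\lambda^{\kappa_1}) \] for all integers $n\ge1$ and all real $0\le\lambda\le C_0n^{\kappa_2}$. (2) There are constants $n_0>0$, $D_0>1$ and $\kappa_3\in(0,1/2)$ such that $\psi$ is nondecreasing on $[n_0,\infty)$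 and \[ \frac{1}{c^{1-\kappa_3}}\,\psi(n)\le\psi(n/c)\le\frac{D_0}{c^{\kappa_3}}\,\psi(n) \] for all real $n\ge n_0$ and $1\le c\le n^{1/2}$. Then $\mathbb E T_n<\infty$ for all $n\ge0$, the time constant $\mu=\lim_{n\to\infty}\mathbb E T_n/n$ exists and is finite, and for every integer $k\ge1$ there is a constant $D=D(k)>0$, not depending on $n$, such that for all sufficiently large real $n$, \[ n\mu\le\mathbb E\,T(0,ne_1)\le n\mu+D\,\psi(n)\,\bigl(\log^{(k)}n\bigr)^{1/\kappa_1}, \] where $\log^{(k)}$ is the $k$-th iterate of the logarithm ($\log^{(1)}=\log$, $\log^{(k)}=\log\circ\log^{(k-1)}$). -/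

import Mathlib

open MeasureTheory ProbabilityTheory Filter Topology

namespace EuclideanFPP

/-- `Q` is a rate one Poisson point process on `ℝ^d`, realised as a random set of points on the
probability space `(Ω, P)`: the number of points in a Borel set is a random variable, it is Poisson
distributed with mean the Lebesgue measure of the set whenever this is finite, and the numbers of
points in pairwise disjoint Borel sets are independent. -/
structure IsPoissonProcess {Ω : Type*} [MeasurableSpace Ω] {d : ℕ} (P : Measure Ω)
    (Q : Ω → Set (EuclideanSpace ℝ (Fin d))) : Prop where
  measurable_count : ∀ B : Set (EuclideanSpace ℝ (Fin d)), MeasurableSet B →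
    Measurable fun ω => (Q ω ∩ B).encard
  law_count : ∀ B : Set (EuclideanSpace ℝ (Fin d)), MeasurableSet B → volume B ≠ ⊤ →
    P.map (fun ω => (Q ω ∩ B).encard) =
      (poissonMeasure (volume B).toNNReal).map (fun m : ℕ => (m : ℕ∞))
  indep_count : ∀ (m : ℕ) (B : Fin m → Set (EuclideanSpace ℝ (Fin d))),
    (∀ i, MeasurableSet (B i)) → (∀ i j, i ≠ j → Disjoint (B i) (B j)) →
      iIndepFun (fun i ω => (Q ω ∩ B i).encard) P

/-- The map `q` sends every point `x` of space to a point of the configuration `S` closest to `x`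
(ties being broken in an arbitrary way). -/
def IsClosestPointMap {d : ℕ} (S : Set (EuclideanSpace ℝ (Fin d)))
    (q : EuclideanSpace ℝ (Fin d) → EuclideanSpace ℝ (Fin d)) : Prop :=
  ∀ x, q x ∈ S ∧ ∀ z ∈ S, ‖x - q x‖ ≤ ‖x - z‖

/-- The passage time `∑ i, ‖r_i - r_{i+1}‖ ^ α` of a path `r = (r_0, …, r_m)`. -/
noncomputable def pathTime {d : ℕ} (α : ℝ) {m : ℕ}
    (r : Fin (m + 1) → EuclideanSpace ℝ (Fin d)) : ℝ :=
  ∑ i : Fin m, ‖r i.castSucc - r i.succ‖ ^ α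

/-- The passage time between two points `a`, `b` of the configuration `S`: the infimum of the
passage times of the finite sequences of points of `S` that start at `a` and end at `b`. -/
noncomputable def pointTime {d : ℕ} (α : ℝ) (S : Set (EuclideanSpace ℝ (Fin d)))
    (a b : EuclideanSpace ℝ (Fin d)) : ℝ :=
  sInf {t : ℝ | ∃ (m : ℕ) (r : Fin (m + 1) → EuclideanSpace ℝ (Fin d)),
    (∀ i, r i ∈ S) ∧ r 0 = a ∧ r (Fin.last m) = b ∧ pathTime α r = t}

/-- The passage time `T(x, y) = T(q(x), q(y))` between two points `x`, `y` of `ℝ^d`. -/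
noncomputable def passageTime {d : ℕ} (α : ℝ) (S : Set (EuclideanSpace ℝ (Fin d)))
    (q : EuclideanSpace ℝ (Fin d) → EuclideanSpace ℝ (Fin d))
    (x y : EuclideanSpace ℝ (Fin d)) : ℝ :=
  pointTime α S (q x) (q y)

/-- The random variable `T_s = T(0, s e₁)`, for real `s`. -/
noncomputable def axisTime {Ω : Type*} {d : ℕ} [NeZero d] (α : ℝ)
    (Q : Ω → Set (EuclideanSpace ℝ (Fin d)))
    (q : Ω → EuclideanSpace ℝ (Fin d) → EuclideanSpace ℝ (Fin d)) (s : ℝ) (ω : Ω) : ℝ :=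
  passageTime α (Q ω) (q ω) 0 (s • EuclideanSpace.single (0 : Fin d) (1 : ℝ))

/-- Concentration of the random variables `T n` around their means on the scale `ψ n`, with
stretched exponential tails. -/
def Concentration {Ω : Type*} [MeasurableSpace Ω] (P : Measure Ω) (T : ℝ → Ω → ℝ) (ψ : ℝ → ℝ)
    (C₀ C₁ κ₁ κ₂ : ℝ) : Prop :=
  ∀ n : ℕ, 1 ≤ n → ∀ l : ℝ, 0 ≤ l → l ≤ C₀ * (n : ℝ) ^ κ₂ →
    P.real {ω | l * ψ n < |T n ω - ∫ ω', T n ω' ∂P|} ≤ C₁ * Real.exp (-C₀ * l ^ κ₁)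

/-- Regular growth of the scale `ψ`, with exponent `κ₃`. -/
def RegularGrowth (ψ : ℝ → ℝ) (κ₃ : ℝ) : Prop :=
  ∃ n₀ > (0 : ℝ), MonotoneOn ψ (Set.Ici n₀) ∧ ∃ D > (1 : ℝ),
    ∀ n c : ℝ, n₀ ≤ n → 1 ≤ c → c ≤ n ^ (1 / 2 : ℝ) →
      1 / c ^ (1 - κ₃) * ψ n ≤ ψ (n / c) ∧ ψ (n / c) ≤ D / c ^ κ₃ * ψ n

end EuclideanFPP

/-! Write h(r) for the mean of T_r and γ(r) = h(r) - rμ. Passage times satisfy the triangle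
inequality, and their laws are invariant under isometries. So h is subadditive, μ exists and γ ≥ 0.
Only the upper bound on γ is hard.

The engine is a halving inequality γ(m) ≤ γ(m')/2 + f(m) with m' between 3m/2 and 2m. If f grows by
a factor at most 2θ < 2 when its argument at most doubles, then iterating and using γ(r)/r → 0 gives
γ ≤ f/(1 - θ) (`le_div_of_halving`). To obtain such an inequality, take an almost optimal path from
0 to 2n e₁. It passes near the sphere of radius n around each end, at points c and c'
(`eventually_exists_crossing`), and T(0,c) + T(c',2n e₁) ≤ h(2n) + O(ψ(n)). It remains to bound
T(0,c) below uniformly in c.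

A union bound over polynomially many lattice points costs (log n)^(1/κ₁), which gives the case k = 1
(`eventually_le_log`). This case also yields μ > 0 (`IsConcentratedModel.μ_pos`): if μ were 0, some
path over distance n would be too cheap for a Poisson configuration, in which clusters of points
joined by very short steps are small.

To gain one more logarithm, suppose γ(r) ≤ η^(-κ₃) ψ(r) for √n ≤ r ≤ 8n. Let u be the midpoint n e₁
and ℓ = √(η n ψ(n)). Extend the path from c outwards to a point z₀ of the lattice of mesh ℓ dilated
by 1 + η, along a chain z_J, ..., z₁, z₀. Here z_j belongs to the lattice of mesh ℓ/2^j dilated by 1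
+ η/2^j. A link at level j has length of order ηn/2^j. Its lateral displacement lengthens it by only
(ℓ/2^j)²/(ηn/2^j) = ψ(n)/2^j. Its nonrandom error is at most η^(-κ₃) ψ(ηn/2^j), of order 2^(-κ₃ j)
ψ(n), and its random error carries the same geometric factor. Hence T(z₀,c) is at most μ times the
difference of the distances, up to O(ψ(n) Y^(1/κ₁)), where Y = log((2 + ‖c - u‖/ℓ)/η) is the cost of
a union bound weighted by the distance from u (`IsConcentratedModel.chain_le`). Since the coarse
point z₀ is also typical, T(0,c) is bounded below with the same error
(`IsConcentratedModel.exists_chain_lower_bound`).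

The two lower bounds for T(0,c) and T(2n e₁,c), with μ > 0, force c to lie so close to u that Y is
of order log(1/η) (`IsConcentratedModel.sq_mul_le_of_hasChainBound`). This is a halving inequality
with f of order ψ log(1/η)^(1/κ₁) (`IsConcentratedModel.eventually_step`). The bound for k permits η
to be a negative power of log^(k) n, so log(1/η) is of order log^(k+1) n
(`IsConcentratedModel.eventually_le_iterate_log_succ`). -/

open MeasureTheory ProbabilityTheory Filter Topology

namespace EuclideanFPP

/-! ### Passage times in a fixed configuration. -/

section Deterministic

variable {d : ℕ} {α : ℝ} {S : Set (EuclideanSpace ℝ (Fin d))} {a b c : EuclideanSpace ℝ (Fin d)}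

lemma pathTime_nonneg {m : ℕ} (r : Fin (m + 1) → EuclideanSpace ℝ (Fin d)) :
    0 ≤ pathTime α r :=
  Finset.sum_nonneg fun _ _ => Real.rpow_nonneg (norm_nonneg _) _

lemma pathTime_succ {m : ℕ} (r : Fin (m + 2) → EuclideanSpace ℝ (Fin d)) :
    pathTime α r = ‖r 0 - r 1‖ ^ α + pathTime α (Fin.tail r) := by
  unfold pathTime
  rw [Fin.sum_univ_succ]
  rfl

lemma pathTime_zero (r : Fin 1 → EuclideanSpace ℝ (Fin d)) : pathTime α r = 0 := by
  simp [pathTime]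

lemma pathTime_cons {m : ℕ} (x : EuclideanSpace ℝ (Fin d))
    (r : Fin (m + 1) → EuclideanSpace ℝ (Fin d)) :
    pathTime α (Fin.cons x r : Fin (m + 2) → EuclideanSpace ℝ (Fin d)) =
      ‖x - r 0‖ ^ α + pathTime α r := by
  rw [pathTime_succ, Fin.tail_cons]
  rfl

lemma pointTime_nonneg : 0 ≤ pointTime α S a b := by
  apply Real.sInf_nonneg
  rintro t ⟨m, r, -, -, -, rfl⟩
  exact pathTime_nonneg r

lemma pointTime_le_pathTime {m : ℕ} {r : Fin (m + 1) → EuclideanSpace ℝ (Fin d)}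
    (hr : ∀ i, r i ∈ S) : pointTime α S (r 0) (r (Fin.last m)) ≤ pathTime α r := by
  apply csInf_le
  · refine ⟨0, ?_⟩
    rintro t ⟨m, r, -, -, -, rfl⟩
    exact pathTime_nonneg r
  · exact ⟨m, r, hr, rfl, rfl, rfl⟩

lemma pointTime_self_eq_zero (ha : a ∈ S) : pointTime α S a a = 0 := by
  refine le_antisymm ?_ pointTime_nonneg
  have := pointTime_le_pathTime (α := α) (S := S) (r := fun _ : Fin 1 => a) (fun _ => ha)
  simpa [pathTime_zero] using this

lemma exists_pathTime_lt {t : ℝ} (ha : a ∈ S) (hb : b ∈ S) (ht : pointTime α S a b < t) :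
    ∃ (m : ℕ) (r : Fin (m + 1) → EuclideanSpace ℝ (Fin d)),
      (∀ i, r i ∈ S) ∧ r 0 = a ∧ r (Fin.last m) = b ∧ pathTime α r < t := by
  obtain ⟨_, ⟨m, r, h1, h2, h3, rfl⟩, h⟩ := exists_lt_of_csInf_lt
    (by
      refine ⟨_, 1, ![a, b], ?_, rfl, rfl, rfl⟩
      intro i
      fin_cases i
      · exact ha
      · exact hb) ht
  exact ⟨m, r, h1, h2, h3, h⟩

lemma pointTime_le_edge_add (ha : a ∈ S) (hb : b ∈ S) (hc : c ∈ S) :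
    pointTime α S a c ≤ ‖a - b‖ ^ α + pointTime α S b c := by
  refine le_of_forall_pos_le_add fun ε hε => ?_
  obtain ⟨m, r, h1, h2, h3, h4⟩ := exists_pathTime_lt (α := α) (t := pointTime α S b c + ε) hb hc
    (by linarith)
  have h := pointTime_le_pathTime (α := α) (S := S)
    (r := (Fin.cons a r : Fin (m + 2) → EuclideanSpace ℝ (Fin d)))
    (fun i => by
      refine Fin.cases ?_ (fun j => ?_) i
      · simpa using ha
      · simpa using h1 j)
  rw [pathTime_cons, h2] at h
  have e : (Fin.cons a r : Fin (m + 2) → EuclideanSpace ℝ (Fin d)) (Fin.last (m + 1)) = c := by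
    rw [← Fin.succ_last, Fin.cons_succ, h3]
  rw [e, Fin.cons_zero] at h
  linarith

lemma pointTime_le_edge (ha : a ∈ S) (hb : b ∈ S) : pointTime α S a b ≤ ‖a - b‖ ^ α := by
  simpa [pointTime_self_eq_zero hb] using pointTime_le_edge_add (α := α) ha hb hb

lemma pointTime_le_pathTime_add (hb : b ∈ S) : ∀ (m : ℕ)
    (r : Fin (m + 1) → EuclideanSpace ℝ (Fin d)), (∀ i, r i ∈ S) →
    pointTime α S (r 0) b ≤ pathTime α r + pointTime α S (r (Fin.last m)) b
  | 0, r, _ => by simp [pathTime_zero]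
  | m + 1, r, hr => by
    have h1 := pointTime_le_pathTime_add hb m (Fin.tail r) (fun i => hr _)
    have h2 := pointTime_le_edge_add (α := α) (hr 0) (hr 1) hb
    rw [pathTime_succ]
    have e1 : Fin.tail r 0 = r 1 := rfl
    have e2 : Fin.tail r (Fin.last m) = r (Fin.last (m + 1)) := rfl
    rw [e1, e2] at h1
    linarith

lemma pointTime_triangle (ha : a ∈ S) (hb : b ∈ S) (hc : c ∈ S) :
    pointTime α S a c ≤ pointTime α S a b + pointTime α S b c := by
  refine le_of_forall_pos_le_add fun ε hε => ?_
  obtain ⟨m, r, h1, rfl, rfl, h4⟩ := exists_pathTime_lt (α := α) (t := pointTime α S a b + ε) ha hb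
    (by linarith)
  have := pointTime_le_pathTime_add (α := α) hc m r h1
  linarith

lemma pointTime_rev_le_pathTime : ∀ (m : ℕ)
    (r : Fin (m + 1) → EuclideanSpace ℝ (Fin d)), (∀ i, r i ∈ S) →
    pointTime α S (r (Fin.last m)) (r 0) ≤ pathTime α r
  | 0, r, hr => by simp [pathTime_zero, pointTime_self_eq_zero (hr 0)]
  | m + 1, r, hr => by
    have h1 := pointTime_rev_le_pathTime m (Fin.tail r) (fun i => hr _)
    have h2 := pointTime_triangle (α := α) (hr (Fin.last (m + 1))) (hr 1) (hr 0)
    have h3 := pointTime_le_edge (α := α) (hr 1) (hr 0)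
    rw [pathTime_succ]
    have e1 : Fin.tail r 0 = r 1 := rfl
    have e2 : Fin.tail r (Fin.last m) = r (Fin.last (m + 1)) := rfl
    rw [e1, e2] at h1
    rw [norm_sub_rev] at h3
    linarith

lemma pointTime_comm (ha : a ∈ S) (hb : b ∈ S) : pointTime α S a b = pointTime α S b a := by
  have key : ∀ {a b}, a ∈ S → b ∈ S → pointTime α S b a ≤ pointTime α S a b := by
    intro a b ha hb
    refine le_of_forall_pos_le_add fun ε hε => ?_
    obtain ⟨m, r, h1, rfl, rfl, h4⟩ := exists_pathTime_lt (α := α)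
      (t := pointTime α S a b + ε) ha hb (by linarith)
    exact (pointTime_rev_le_pathTime m r h1).trans h4.le
  exact le_antisymm (key hb ha) (key ha hb)

lemma pathTime_comp_isometry (g : EuclideanSpace ℝ (Fin d) ≃ᵢ EuclideanSpace ℝ (Fin d)) {m : ℕ}
    (r : Fin (m + 1) → EuclideanSpace ℝ (Fin d)) :
    pathTime α (fun i => g (r i)) = pathTime α r := by
  simp only [pathTime, ← dist_eq_norm, g.isometry.dist_eq]

lemma pointTime_image_isometry (g : EuclideanSpace ℝ (Fin d) ≃ᵢ EuclideanSpace ℝ (Fin d)) :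
    pointTime α (g '' S) (g a) (g b) = pointTime α S a b := by
  unfold pointTime
  congr 1
  ext t
  constructor
  · rintro ⟨m, r, h1, h2, h3, h4⟩
    refine ⟨m, fun i => g.symm (r i), fun i => ?_, by simp [h2], by simp [h3], ?_⟩
    · obtain ⟨x, hx, hxr⟩ := h1 i
      simp only [← hxr]
      simpa using hx
    · rw [pathTime_comp_isometry, h4]
  · rintro ⟨m, r, h1, h2, h3, h4⟩
    exact ⟨m, fun i => g (r i), fun i => ⟨_, h1 i, rfl⟩, by simp [h2], by simp [h3],
      by rw [pathTime_comp_isometry, h4]⟩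

lemma passageTime_image_isometry (g : EuclideanSpace ℝ (Fin d) ≃ᵢ EuclideanSpace ℝ (Fin d))
    (q : EuclideanSpace ℝ (Fin d) → EuclideanSpace ℝ (Fin d)) (x y : EuclideanSpace ℝ (Fin d)) :
    passageTime α (g '' S) (fun z => g (q (g.symm z))) (g x) (g y) = passageTime α S q x y := by
  simp only [passageTime, g.symm_apply_apply]
  exact pointTime_image_isometry g

lemma IsClosestPointMap.image_isometry {q : EuclideanSpace ℝ (Fin d) → EuclideanSpace ℝ (Fin d)}
    (hq : IsClosestPointMap S q)
    (g : EuclideanSpace ℝ (Fin d) ≃ᵢ EuclideanSpace ℝ (Fin d)) :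
    IsClosestPointMap (g '' S) (fun z => g (q (g.symm z))) := by
  intro x
  refine ⟨⟨_, (hq _).1, rfl⟩, ?_⟩
  rintro _ ⟨z, hz, rfl⟩
  have e : ∀ w, dist (g.symm x) w = dist x (g w) := fun w => by
    rw [← g.isometry.dist_eq, g.apply_symm_apply]
  simpa only [← dist_eq_norm, e] using (hq (g.symm x)).2 z hz

/-- Convexity of the power: `u + s` and `w + s` lie between `2 * s` and `u + w`, and the two pairs
have the same sum, so the more spread out pair has the larger sum of powers. -/
lemma rpow_add_rpow_le_of_ge {u w s : ℝ} (hα : 1 ≤ α) (hs : 0 ≤ s) (hu : s < u) (hw : s < w) :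
    (u + s) ^ α + (w + s) ^ α ≤ (2 * s) ^ α + (u + w) ^ α := by
  have hL : 0 < u + w - 2 * s := by linarith
  have hconv := convexOn_rpow hα
  have key : ∀ u w : ℝ, s < u → s < w → (u + s) ^ α ≤
      (w - s) / (u + w - 2 * s) * (2 * s) ^ α + (u - s) / (u + w - 2 * s) * (u + w) ^ α := by
    intro u w hu hw
    have hL : 0 < u + w - 2 * s := by linarith
    have := hconv.2 (show 2 * s ∈ Set.Ici (0 : ℝ) by simp [hs])
      (show u + w ∈ Set.Ici (0 : ℝ) by simp; linarith)
      (show 0 ≤ (w - s) / (u + w - 2 * s) from div_nonneg (by linarith) hL.le)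
      (show 0 ≤ (u - s) / (u + w - 2 * s) from div_nonneg (by linarith) hL.le)
      (by rw [← add_div, div_eq_one_iff_eq hL.ne']; ring)
    simp only [smul_eq_mul] at this
    have e : (w - s) / (u + w - 2 * s) * (2 * s) + (u - s) / (u + w - 2 * s) * (u + w) = u + s := by
      rw [div_mul_eq_mul_div, div_mul_eq_mul_div, ← add_div, div_eq_iff hL.ne']
      ring
    rwa [e] at this
  have h1 := key u w hu hw
  have h2 := key w u hw hu
  rw [add_comm w u] at h2
  have e : (w - s) / (u + w - 2 * s) + (u - s) / (u + w - 2 * s) = 1 := by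
    rw [← add_div, div_eq_one_iff_eq hL.ne']; ring
  have e2 : (u - s) / (u + w - 2 * s) = 1 - (w - s) / (u + w - 2 * s) := by linarith
  rw [e2] at h1 h2
  linarith

lemma exists_norm_sub_eq_of_segment {o : EuclideanSpace ℝ (Fin d)} {n : ℝ} (ha : ‖a - o‖ ≤ n)
    (hb : n ≤ ‖b - o‖) : ∃ x, ‖x - o‖ = n ∧ ‖a - x‖ + ‖x - b‖ = ‖a - b‖ := by
  have hc : ContinuousOn (fun t : ℝ => ‖AffineMap.lineMap a b t - o‖) (Set.Icc 0 1) := by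
    apply Continuous.continuousOn
    have : Continuous fun t : ℝ => AffineMap.lineMap a b t := AffineMap.lineMap_continuous
    fun_prop
  obtain ⟨t, ht, hx⟩ := intermediate_value_Icc (zero_le_one' ℝ) hc (show n ∈ _ by simp [ha, hb])
  refine ⟨AffineMap.lineMap a b t, hx, ?_⟩
  rw [← dist_eq_norm, ← dist_eq_norm, ← dist_eq_norm, dist_left_lineMap, dist_lineMap_right,
    Real.norm_of_nonneg ht.1, Real.norm_of_nonneg (by linarith [ht.2])]
  ring

/-- The edge meets the sphere at some x. A detour through a configuration point within `s` of x
lengthens each half by at most `s`, which by convexity costs no more than `(2 * s) ^ α`. -/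
lemma exists_crossing_edge {o : EuclideanSpace ℝ (Fin d)} {n s : ℝ} (hα : 1 ≤ α) (hs : 0 ≤ s)
    (hcov : ∀ x, ‖x - o‖ = n → ∃ z ∈ S, ‖x - z‖ ≤ s) (haS : a ∈ S) (hbS : b ∈ S)
    (ha : ‖a - o‖ ≤ n) (hb : n ≤ ‖b - o‖) :
    ∃ c ∈ S, |‖c - o‖ - n| ≤ s ∧ ‖a - c‖ ^ α + ‖c - b‖ ^ α ≤ ‖a - b‖ ^ α + (2 * s) ^ α := by
  obtain ⟨x, hx, hab⟩ := exists_norm_sub_eq_of_segment ha hb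
  have hnear : ∀ z, ‖x - z‖ ≤ s → |‖z - o‖ - n| ≤ s := by
    intro z hz
    rw [← hx]
    refine (abs_norm_sub_norm_le _ _).trans ?_
    rw [norm_sub_rev] at hz
    simpa using hz
  have h0 : (0 : ℝ) ^ α = 0 := Real.zero_rpow (by linarith)
  have h2s : 0 ≤ (2 * s) ^ α := Real.rpow_nonneg (by linarith) _
  -- If an endpoint is within `s` of the crossing point, that endpoint serves as `c`. This leaves
  -- only the case in which the convexity inequality applies.
  rcases le_or_gt ‖a - x‖ s with h1 | h1
  · exact ⟨a, haS, hnear a (by rwa [norm_sub_rev]), by simp [h0, h2s]⟩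
  rcases le_or_gt ‖x - b‖ s with h2 | h2
  · exact ⟨b, hbS, hnear b h2, by simp [h0, h2s]⟩
  obtain ⟨z, hz, hxz⟩ := hcov x hx
  refine ⟨z, hz, hnear z hxz, ?_⟩
  have e1 : ‖a - z‖ ≤ ‖a - x‖ + s := (norm_sub_le_norm_sub_add_norm_sub a x z).trans (by linarith)
  have e2 : ‖z - b‖ ≤ ‖x - b‖ + s := by
    refine (norm_sub_le_norm_sub_add_norm_sub z x b).trans ?_
    rw [norm_sub_rev z x]; linarith
  have := rpow_add_rpow_le_of_ge hα hs h1 h2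
  rw [← hab]
  have e3 := Real.rpow_le_rpow (norm_nonneg _) e1 (by linarith : 0 ≤ α)
  have e4 := Real.rpow_le_rpow (norm_nonneg _) e2 (by linarith : 0 ≤ α)
  linarith

/-- Induction along the path up to the first edge that leaves the ball; the detour is made on that
edge only. -/
lemma exists_crossing_path {o : EuclideanSpace ℝ (Fin d)} {n s : ℝ} (hα : 1 ≤ α) (hs : 0 ≤ s)
    (hcov : ∀ x, ‖x - o‖ = n → ∃ z ∈ S, ‖x - z‖ ≤ s) : ∀ (m : ℕ)
    (r : Fin (m + 1) → EuclideanSpace ℝ (Fin d)), (∀ i, r i ∈ S) → ‖r 0 - o‖ < n →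
    n ≤ ‖r (Fin.last m) - o‖ → ∃ c ∈ S, |‖c - o‖ - n| ≤ s ∧
      pointTime α S (r 0) c + pointTime α S c (r (Fin.last m)) ≤ pathTime α r + (2 * s) ^ α
  | 0, r, _, h0, h1 => absurd h1 (not_le.2 h0)
  | m + 1, r, hr, h0, h1 => by
    have e2 : Fin.tail r (Fin.last m) = r (Fin.last (m + 1)) := rfl
    rcases lt_or_ge ‖r 1 - o‖ n with h | h
    · obtain ⟨c, hc, hcn, hle⟩ := exists_crossing_path hα hs hcov m (Fin.tail r) (fun i => hr _) h h1
      refine ⟨c, hc, hcn, ?_⟩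
      have h2 := pointTime_le_edge_add (α := α) (hr 0) (hr 1) hc
      rw [pathTime_succ]
      have e1 : Fin.tail r 0 = r 1 := rfl
      rw [e1, e2] at hle
      linarith
    · obtain ⟨c, hc, hcn, hle⟩ := exists_crossing_edge hα hs hcov (hr 0) (hr 1) h0.le h
      refine ⟨c, hc, hcn, ?_⟩
      have h2 := pointTime_le_edge (α := α) (hr 0) hc
      have h3 := pointTime_le_edge_add (α := α) hc (hr 1) (hr (Fin.last (m + 1)))
      have h4 := pointTime_le_pathTime (α := α) (S := S) (r := Fin.tail r) (fun i => hr _)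
      rw [pathTime_succ]
      have e1 : Fin.tail r 0 = r 1 := rfl
      rw [e1, e2] at h4
      linarith

/-- The slack `η` is there because the infimum over paths need not be attained. -/
lemma exists_crossing {o : EuclideanSpace ℝ (Fin d)} {n s : ℝ} (hα : 1 ≤ α) (hs : 0 ≤ s)
    (hcov : ∀ x, ‖x - o‖ = n → ∃ z ∈ S, ‖x - z‖ ≤ s) (haS : a ∈ S) (hbS : b ∈ S)
    (ha : ‖a - o‖ < n) (hb : n ≤ ‖b - o‖) {η : ℝ} (hη : 0 < η) :
    ∃ c ∈ S, |‖c - o‖ - n| ≤ s ∧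
      pointTime α S a c + pointTime α S c b ≤ pointTime α S a b + (2 * s) ^ α + η := by
  obtain ⟨m, r, h1, rfl, rfl, h4⟩ := exists_pathTime_lt (α := α) (t := pointTime α S a b + η)
    haS hbS (by linarith)
  obtain ⟨c, hc, hcn, hle⟩ := exists_crossing_path hα hs hcov m r h1 ha hb
  exact ⟨c, hc, hcn, by linarith⟩

end Deterministic

end EuclideanFPP

namespace EuclideanFPP

/-! ### Uniqueness of the law of the Poisson process, isometry invariance and count estimates. -/

section PoissonLaw

variable {Ω : Type*} [MeasurableSpace Ω] {P : Measure Ω} {d : ℕ}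
  {Q Q' : Ω → Set (EuclideanSpace ℝ (Fin d))}

lemma IsPoissonProcess.indep_count_fintype (hQ : IsPoissonProcess P Q) {ι : Type*} [Fintype ι]
    (A : ι → Set (EuclideanSpace ℝ (Fin d))) (hA : ∀ i, MeasurableSet (A i))
    (hd : ∀ i j, i ≠ j → Disjoint (A i) (A j)) :
    iIndepFun (fun i ω => (Q ω ∩ A i).encard) P := by
  have h := hQ.indep_count (Fintype.card ι) (fun i => A ((Fintype.equivFin ι).symm i))
    (fun i => hA _) (fun i j hij => hd _ _ (by simpa using hij))
  have := h.precomp (g := Fintype.equivFin ι) (Fintype.equivFin ι).injective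
  simpa using this

lemma IsPoissonProcess.map_count_pi [IsProbabilityMeasure P] (hQ : IsPoissonProcess P Q) {ι : Type*} [Fintype ι]
    (A : ι → Set (EuclideanSpace ℝ (Fin d))) (hA : ∀ i, MeasurableSet (A i))
    (hv : ∀ i, volume (A i) ≠ ⊤) (hd : ∀ i j, i ≠ j → Disjoint (A i) (A j)) :
    P.map (fun ω i => (Q ω ∩ A i).encard) = Measure.pi fun i =>
      (poissonMeasure (volume (A i)).toNNReal).map (fun m : ℕ => (m : ℕ∞)) := by
  rw [(iIndepFun_iff_map_fun_eq_pi_map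
    fun i => (hQ.measurable_count _ (hA i)).aemeasurable).1 (hQ.indep_count_fintype A hA hd)]
  congr 1
  funext i
  exact hQ.law_count _ (hA i) (hv i)

/-- The Borel sets of finite volume. -/
abbrev FiniteVolumeSet (d : ℕ) : Type :=
  {B : Set (EuclideanSpace ℝ (Fin d)) // MeasurableSet B ∧ volume B ≠ ⊤}

/-- The numbers of points of a configuration in all Borel sets of finite volume. -/
noncomputable def counts (S : Set (EuclideanSpace ℝ (Fin d))) (B : FiniteVolumeSet d) : ℕ∞ :=
  (S ∩ B).encard

lemma IsPoissonProcess.measurable_counts (hQ : IsPoissonProcess P Q) :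
    Measurable fun ω => counts (Q ω) :=
  measurable_pi_lambda _ fun B => hQ.measurable_count _ B.2.1

/-- The atoms of the algebra generated by a finite family of sets. -/
def familyAtom (J : Finset (FiniteVolumeSet d)) (σ : J → Bool) :
    Set (EuclideanSpace ℝ (Fin d)) := {x | ∀ B : J, x ∈ (B : FiniteVolumeSet d).1 ↔ σ B = true}

lemma measurableSet_familyAtom (J : Finset (FiniteVolumeSet d)) (σ : J → Bool) :
    MeasurableSet (familyAtom J σ) := by
  have e : familyAtom J σ = ⋂ B : J, {x | x ∈ (B : FiniteVolumeSet d).1 ↔ σ B = true} := by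
    ext x
    simp [familyAtom]
  rw [e]
  refine MeasurableSet.iInter fun B => ?_
  by_cases h : σ B = true
  · simp only [h, iff_true]
    exact (B : FiniteVolumeSet d).2.1
  · simp only [h, Bool.false_eq_true, iff_false]
    exact (B : FiniteVolumeSet d).2.1.compl

lemma disjoint_familyAtom (J : Finset (FiniteVolumeSet d)) {σ τ : J → Bool} (h : σ ≠ τ) :
    Disjoint (familyAtom J σ) (familyAtom J τ) := by
  rw [Set.disjoint_left]
  intro x h1 h2
  apply h
  funext B
  have h3 := h1 B
  rw [h2 B] at h3
  exact (Bool.eq_iff_iff.2 h3).symm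

lemma eq_iUnion_familyAtom (J : Finset (FiniteVolumeSet d)) (B : J) :
    ((B : FiniteVolumeSet d) : Set (EuclideanSpace ℝ (Fin d))) =
      ⋃ σ : {σ : J → Bool // σ B = true}, familyAtom J σ := by
  classical
  ext x
  simp only [Set.mem_iUnion]
  constructor
  · intro hx
    exact ⟨⟨fun C => decide (x ∈ (C : FiniteVolumeSet d).1), by simpa using hx⟩, fun C => by simp⟩
  · rintro ⟨σ, hσ⟩
    exact (hσ B).2 σ.2

/-- The pattern that is false everywhere is left out of the index type: its atom lies outside all
sets of `J` and may have infinite volume, where the law of the count is not prescribed. -/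
lemma encard_inter_eq_sum_familyAtom (S : Set (EuclideanSpace ℝ (Fin d)))
    (J : Finset (FiniteVolumeSet d)) (B : J) :
    counts S B = ∑ σ : {σ : J → Bool // ∃ C, σ C = true},
      if σ.1 B = true then (S ∩ familyAtom J σ).encard else 0 := by
  unfold counts
  rw [eq_iUnion_familyAtom J B, Set.inter_iUnion, Set.encard_iUnion_of_finite, finsum_eq_sum_of_fintype]
  · rw [← Finset.sum_filter]
    refine Finset.sum_bij (fun σ _ => ⟨σ.1, B, σ.2⟩) ?_ ?_ ?_ ?_
    · intro σ _
      simpa using σ.2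
    · intro σ _ τ _ h
      exact Subtype.ext (by simpa using h)
    · intro σ hσ
      exact ⟨⟨σ.1, by simpa using hσ⟩, Finset.mem_univ _, rfl⟩
    · intro σ _
      rfl
  · intro σ τ h
    exact (disjoint_familyAtom J (fun e => h (Subtype.ext e))).mono Set.inter_subset_right
      Set.inter_subset_right

/-- The right-hand side does not mention `Q`. Overlapping sets are reduced to disjoint atoms, whose
counts are independent with known laws. -/
lemma IsPoissonProcess.map_counts_restrict [IsProbabilityMeasure P] (hQ : IsPoissonProcess P Q)
    (J : Finset (FiniteVolumeSet d)) :
    (P.map fun ω => counts (Q ω)).map J.restrict =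
      (Measure.pi fun σ : {σ : J → Bool // ∃ C, σ C = true} =>
        (poissonMeasure (volume (familyAtom J σ)).toNNReal).map (fun m : ℕ => (m : ℕ∞))).map
        (fun N B => ∑ σ : {σ : J → Bool // ∃ C, σ C = true}, if σ.1 B = true then N σ else 0) := by
  have hG : Measurable (fun (N : {σ : J → Bool // ∃ C, σ C = true} → ℕ∞) (B : J) =>
      ∑ σ : {σ : J → Bool // ∃ C, σ C = true}, if σ.1 B = true then N σ else 0) := by
    refine measurable_pi_lambda _ fun B => Finset.measurable_sum _ fun σ _ => ?_
    split_ifs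
    · exact measurable_pi_apply _
    · exact measurable_const
  rw [← hQ.map_count_pi (fun σ : {σ : J → Bool // ∃ C, σ C = true} => familyAtom J σ)
    (fun σ => measurableSet_familyAtom J σ), Measure.map_map hG, Measure.map_map]
  · congr 1
    funext ω B
    exact encard_inter_eq_sum_familyAtom (Q ω) J B
  · exact measurable_pi_lambda _ fun _ => measurable_pi_apply _
  · exact hQ.measurable_counts
  · exact measurable_pi_lambda _ fun σ => hQ.measurable_count _ (measurableSet_familyAtom J _)
  · rintro ⟨σ, B, hB⟩
    refine ne_top_of_le_ne_top (B : FiniteVolumeSet d).2.2 (measure_mono fun x hx => ?_)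
    exact (hx B).2 hB
  · intro σ τ h
    exact disjoint_familyAtom J (fun e => h (Subtype.ext e))

/-- The law of a rate one Poisson process is unique. -/
lemma IsPoissonProcess.map_counts_eq [IsProbabilityMeasure P] (hQ : IsPoissonProcess P Q) (hQ' : IsPoissonProcess P Q') :
    (P.map fun ω => counts (Q ω)) = P.map fun ω => counts (Q' ω) := by
  have : ∀ J : Finset (FiniteVolumeSet d), IsFiniteMeasure
      ((P.map fun ω => counts (Q ω)).map J.restrict) := fun J => inferInstance
  refine IsProjectiveLimit.unique (P := fun J => (P.map fun ω => counts (Q ω)).map J.restrict)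
    (fun J => rfl) fun J => ?_
  beta_reduce
  rw [hQ.map_counts_restrict, hQ'.map_counts_restrict]

lemma encard_image_inter (g : EuclideanSpace ℝ (Fin d) ≃ᵢ EuclideanSpace ℝ (Fin d))
    (S B : Set (EuclideanSpace ℝ (Fin d))) : ((g '' S) ∩ B).encard = (S ∩ g ⁻¹' B).encard := by
  rw [← Set.image_inter_preimage, g.injective.encard_image]

lemma IsPoissonProcess.image_isometry (hQ : IsPoissonProcess P Q)
    (g : EuclideanSpace ℝ (Fin d) ≃ᵢ EuclideanSpace ℝ (Fin d))
    (hg : MeasurePreserving g volume volume) : IsPoissonProcess P fun ω => g '' Q ω where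
  measurable_count B hB := by
    simp only [encard_image_inter]
    exact hQ.measurable_count _ (hg.measurable hB)
  law_count B hB hv := by
    have hvol := hg.measure_preimage hB.nullMeasurableSet
    simp only [encard_image_inter]
    rw [hQ.law_count _ (hg.measurable hB) (by rwa [hvol]), hvol]
  indep_count m B hB hd := by
    simp only [encard_image_inter]
    exact hQ.indep_count m _ (fun i => hg.measurable (hB i))
      fun i j hij => (hd i j hij).preimage _

lemma IsPoissonProcess.measure_count (hQ : IsPoissonProcess P Q)
    {B : Set (EuclideanSpace ℝ (Fin d))} (hB : MeasurableSet B) (hv : volume B ≠ ⊤)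
    (s : Set ℕ∞) : P {ω | (Q ω ∩ B).encard ∈ s} =
      poissonMeasure (volume B).toNNReal {m : ℕ | (m : ℕ∞) ∈ s} := by
  have h := congrArg (fun ν => ν s) (hQ.law_count B hB hv)
  beta_reduce at h
  rw [Measure.map_apply (hQ.measurable_count B hB) (MeasurableSet.of_discrete),
    Measure.map_apply (Measurable.of_discrete) (MeasurableSet.of_discrete)] at h
  exact h

lemma IsPoissonProcess.measure_count_eq_zero (hQ : IsPoissonProcess P Q)
    {B : Set (EuclideanSpace ℝ (Fin d))} (hB : MeasurableSet B) (hv : volume B ≠ ⊤) :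
    P {ω | (Q ω ∩ B).encard = 0} = ENNReal.ofReal (Real.exp (-(volume B).toReal)) := by
  have h := hQ.measure_count hB hv {0}
  simp only [Set.mem_singleton_iff, Nat.cast_eq_zero, Set.ofPred_eq_eq_singleton] at h
  rw [h, poissonMeasure_singleton]
  simp [ENNReal.coe_toNNReal_eq_toReal]

/-- Replacing (m + k)! by the smaller m! bounds the mass at m + k by r^k times the mass at m; the
masses at all m sum to one. -/
lemma poissonMeasure_ge_le (r : NNReal) (k : ℕ) : poissonMeasure r {m | k ≤ m} ≤ (r : ENNReal) ^ k := by
  have hsum : Summable fun m : ℕ => Real.exp (-r) * r ^ m / (m.factorial : ℝ) :=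
    (hasSum_one_poissonMeasure r).summable
  have h1 : poissonMeasure r {m | k ≤ m} ≤ ∑' m : ℕ, poissonMeasure r {m + k} := by
    have : {m | k ≤ m} = ⋃ m : ℕ, {m + k} := by
      ext m
      simp only [Set.mem_ofPred_eq, Set.mem_iUnion, Set.mem_singleton_iff]
      exact ⟨fun h => ⟨m - k, by omega⟩, fun ⟨i, hi⟩ => by omega⟩
    rw [this]
    exact measure_iUnion_le _
  refine h1.trans ?_
  have h2 : ∀ m : ℕ, poissonMeasure r {m + k} ≤ (r : ENNReal) ^ k * poissonMeasure r {m} := by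
    intro m
    rw [poissonMeasure_singleton, poissonMeasure_singleton, ← ENNReal.ofReal_coe_nnreal,
      ← ENNReal.ofReal_pow r.coe_nonneg, ← ENNReal.ofReal_mul (by positivity)]
    apply ENNReal.ofReal_le_ofReal
    rw [pow_add, ← mul_div_assoc]
    have : (m.factorial : ℝ) ≤ ((m + k).factorial : ℝ) := by
      exact_mod_cast Nat.factorial_le (by omega)
    calc Real.exp (-r) * (r ^ m * r ^ k) / ((m + k).factorial : ℝ)
        ≤ Real.exp (-r) * (r ^ m * r ^ k) / (m.factorial : ℝ) := by gcongr
      _ = _ := by ring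
  calc ∑' m : ℕ, poissonMeasure r {m + k} ≤ ∑' m : ℕ, (r : ENNReal) ^ k * poissonMeasure r {m} :=
        ENNReal.tsum_le_tsum h2
    _ = (r : ENNReal) ^ k * ∑' m : ℕ, poissonMeasure r {m} := ENNReal.tsum_mul_left
    _ = (r : ENNReal) ^ k * 1 := by
        congr 1
        rw [← measure_iUnion (fun i j h => by simpa using h) (fun _ => MeasurableSet.singleton _)]
        rw [show (⋃ m : ℕ, ({m} : Set ℕ)) = Set.univ from Set.iUnion_of_singleton ℕ, measure_univ]
    _ = _ := mul_one _

lemma IsPoissonProcess.measure_count_ge_le (hQ : IsPoissonProcess P Q)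
    {B : Set (EuclideanSpace ℝ (Fin d))} (hB : MeasurableSet B) (hv : volume B ≠ ⊤) (k : ℕ) :
    P {ω | (k : ℕ∞) ≤ (Q ω ∩ B).encard} ≤ volume B ^ k := by
  have h := hQ.measure_count hB hv {n | (k : ℕ∞) ≤ n}
  simp only [Set.mem_ofPred_eq, Nat.cast_le] at h
  rw [h]
  refine (poissonMeasure_ge_le _ _).trans ?_
  rw [ENNReal.coe_toNNReal hv]

end PoissonLaw

end EuclideanFPP

namespace EuclideanFPP

/-! ### Passage times as measurable functions of the counts. -/

section Measurability

variable {Ω : Type*} [MeasurableSpace Ω] {P : Measure Ω} {d : ℕ}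
  {Q Q' : Ω → Set (EuclideanSpace ℝ (Fin d))}

/-- The volume of the unit ball. -/
noncomputable def unitVolume (d : ℕ) : ℝ :=
  (volume (Metric.ball (0 : EuclideanSpace ℝ (Fin d)) 1)).toReal

lemma unitVolume_pos (d : ℕ) : 0 < unitVolume d :=
  ENNReal.toReal_pos (Metric.measure_ball_pos _ _ one_pos).ne' measure_ball_lt_top.ne

lemma volume_ball_eq [NeZero d] (x : EuclideanSpace ℝ (Fin d)) {r : ℝ} (hr : 0 ≤ r) :
    volume (Metric.ball x r) = ENNReal.ofReal (r ^ d * unitVolume d) := by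
  have : Nontrivial (EuclideanSpace ℝ (Fin d)) := by
    have : Nonempty (Fin d) := ⟨0⟩
    infer_instance
  rw [Measure.addHaar_ball _ _ hr, finrank_euclideanSpace_fin, ENNReal.ofReal_mul (by positivity),
    unitVolume, ENNReal.ofReal_toReal measure_ball_lt_top.ne]

/-- The radius of a ball whose volume is `t` times the volume of the unit ball. -/
noncomputable def volumeRadius (d : ℕ) (t : ℝ) : ℝ := t ^ (1 / (d : ℝ))

lemma volumeRadius_nonneg {t : ℝ} (ht : 0 ≤ t) : 0 ≤ volumeRadius d t := Real.rpow_nonneg ht _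

lemma volumeRadius_pow [NeZero d] {t : ℝ} (ht : 0 ≤ t) : volumeRadius d t ^ d = t := by
  rw [volumeRadius, ← Real.rpow_natCast, ← Real.rpow_mul ht,
    one_div_mul_cancel (by exact_mod_cast NeZero.ne d), Real.rpow_one]

lemma volume_ball_volumeRadius [NeZero d] (x : EuclideanSpace ℝ (Fin d)) {t : ℝ} (ht : 0 ≤ t) :
    volume (Metric.ball x (volumeRadius d t)) = ENNReal.ofReal (t * unitVolume d) := by
  rw [volume_ball_eq x (volumeRadius_nonneg ht), volumeRadius_pow ht]

lemma IsPoissonProcess.measure_ball_empty [NeZero d] (hQ : IsPoissonProcess P Q)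
    (x : EuclideanSpace ℝ (Fin d)) {r : ℝ} (hr : 0 ≤ r) :
    P {ω | (Q ω ∩ Metric.ball x r).encard = 0} =
      ENNReal.ofReal (Real.exp (-(r ^ d * unitVolume d))) := by
  rw [hQ.measure_count_eq_zero Metric.isOpen_ball.measurableSet measure_ball_lt_top.ne,
    volume_ball_eq x hr, ENNReal.toReal_ofReal (by have := unitVolume_pos d; positivity)]

/-- Among balls of equally spaced volumes, the first nonempty one has all its points in its
outermost shell, hence exactly one point. Parametrising by volume keeps the index `t` rational. -/
lemma exists_ball_encard_eq_one [NeZero d] {S : Set (EuclideanSpace ℝ (Fin d))}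
    {x : EuclideanSpace ℝ (Fin d)} {R M : ℕ} (hM : 0 < M)
    (h0 : (S ∩ Metric.ball x (volumeRadius d R)).encard ≠ 0)
    (h1 : ∀ i < M, ¬ ((2 : ℕ) : ℕ∞) ≤ (S ∩ (Metric.ball x (volumeRadius d (R * (i + 1 : ℕ) / M)) \
      Metric.ball x (volumeRadius d (R * i / M)))).encard) :
    ∃ t : ℚ, 0 ≤ t ∧ (S ∩ Metric.ball x (volumeRadius d t)).encard = 1 := by
  classical
  have hex : ∃ i : ℕ, (S ∩ Metric.ball x (volumeRadius d (R * i / M))).encard ≠ 0 :=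
    ⟨M, by rwa [mul_div_assoc, div_self (by positivity), mul_one]⟩
  have hfind := Nat.find_spec hex
  have hmin := fun j => Nat.find_min (m := j) hex
  have hle : Nat.find hex ≤ M :=
    Nat.find_min' hex (by rwa [mul_div_assoc, div_self (by positivity), mul_one])
  generalize Nat.find hex = i at *
  rcases i with _ | i
  · have hd : (d : ℝ)⁻¹ ≠ 0 := inv_ne_zero (by exact_mod_cast NeZero.ne d)
    simp [volumeRadius, Real.zero_rpow hd] at hfind
  · refine ⟨R * (i + 1 : ℕ) / M, by positivity, ?_⟩
    have h2 : (S ∩ Metric.ball x (volumeRadius d (R * i / M))) = ∅ := by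
      have := hmin i (by omega)
      rwa [not_not, Set.encard_eq_zero] at this
    have h3 := h1 i (by omega)
    have h4 : S ∩ (Metric.ball x (volumeRadius d (R * (i + 1 : ℕ) / M)) \
      Metric.ball x (volumeRadius d (R * i / M))) =
        S ∩ Metric.ball x (volumeRadius d (R * (i + 1 : ℕ) / M)) := by
      rw [← Set.inter_sdiff_assoc]
      refine sdiff_eq_left.2 (Set.disjoint_left.2 fun z hz hz' => ?_)
      have : z ∈ S ∩ Metric.ball x (volumeRadius d (R * i / M)) := ⟨hz.1, hz'⟩
      rwa [h2] at this
    rw [h4] at h3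
    have h5 : ((((R : ℚ) * (i + 1 : ℕ) / M : ℚ)) : ℝ) = (R : ℝ) * (i + 1 : ℕ) / M := by push_cast; rfl
    rw [h5]
    refine le_antisymm ?_ (Order.one_le_iff_ne_zero.2 hfind)
    exact Order.le_of_lt_add_one (by simpa [one_add_one_eq_two] using not_le.1 h3)

/-- This makes the closest point almost surely unique and detectable by countably many counts. With
M shells of equal volume, the probability that some shell has two points is O(1/M) for fixed `R`;
let M tend to infinity, then `R`. -/
lemma IsPoissonProcess.ae_exists_ball_encard_eq_one [NeZero d] (hQ : IsPoissonProcess P Q)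
    (x : EuclideanSpace ℝ (Fin d)) :
    ∀ᵐ ω ∂P, ∃ t : ℚ, 0 ≤ t ∧ (Q ω ∩ Metric.ball x (volumeRadius d t)).encard = 1 := by
  have hv := unitVolume_pos d
  rw [ae_iff]
  have key : ∀ R M : ℕ, P {ω | ¬ ∃ t : ℚ, 0 ≤ t ∧ (Q ω ∩ Metric.ball x (volumeRadius d t)).encard = 1}
      ≤ ENNReal.ofReal (Real.exp (-(R * unitVolume d)) +
        (R * unitVolume d) ^ 2 * ((M : ℝ) + 1)⁻¹) := by
    intro R M'
    obtain ⟨M, hM⟩ : ∃ M : ℕ, M = M' + 1 := ⟨_, rfl⟩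
    have hM0 : 0 < M := by omega
    have hMr : (M' : ℝ) + 1 = M := by rw [hM]; push_cast; rfl
    rw [hMr]
    set sh : ℕ → Set (EuclideanSpace ℝ (Fin d)) := fun i =>
      Metric.ball x (volumeRadius d (R * (i + 1 : ℕ) / M)) \
      Metric.ball x (volumeRadius d (R * i / M)) with hsh
    have hvol : ∀ i, volume (sh i) = ENNReal.ofReal (R * unitVolume d / M) := by
      intro i
      have hsub : Metric.ball x (volumeRadius d (R * i / M)) ⊆
          Metric.ball x (volumeRadius d (R * (i + 1 : ℕ) / M)) := by
        apply Metric.ball_subset_ball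
        apply Real.rpow_le_rpow (by positivity) _ (by positivity)
        gcongr
        omega
      rw [hsh]
      beta_reduce
      rw [measure_sdiff hsub Metric.isOpen_ball.measurableSet.nullMeasurableSet
        measure_ball_lt_top.ne, volume_ball_volumeRadius _ (by positivity),
        volume_ball_volumeRadius _ (by positivity), ← ENNReal.ofReal_sub _ (by positivity)]
      congr 1
      push_cast
      ring
    have hms : ∀ i, MeasurableSet (sh i) := fun i =>
      Metric.isOpen_ball.measurableSet.diff Metric.isOpen_ball.measurableSet
    have hsub : {ω | ¬ ∃ t : ℚ, 0 ≤ t ∧ (Q ω ∩ Metric.ball x (volumeRadius d t)).encard = 1} ⊆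
        {ω | (Q ω ∩ Metric.ball x (volumeRadius d R)).encard = 0} ∪
          ⋃ i ∈ Finset.range M, {ω | ((2 : ℕ) : ℕ∞) ≤ (Q ω ∩ sh i).encard} := by
      intro ω hω
      by_contra hcon
      simp only [Set.mem_union, Set.mem_iUnion, Finset.mem_range, not_or, not_exists] at hcon
      exact hω (exists_ball_encard_eq_one hM0 hcon.1 fun i hi => hcon.2 i hi)
    refine (measure_mono hsub).trans ((measure_union_le _ _).trans ?_)
    rw [hQ.measure_ball_empty _ (volumeRadius_nonneg (by positivity)), volumeRadius_pow (by positivity),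
      ENNReal.ofReal_add (by positivity) (by positivity)]
    gcongr
    refine (measure_biUnion_finset_le _ _).trans ?_
    have : ∀ i ∈ Finset.range M, P {ω | ((2 : ℕ) : ℕ∞) ≤ (Q ω ∩ sh i).encard} ≤
        ENNReal.ofReal ((R * unitVolume d / M) ^ 2) := by
      intro i _
      refine (hQ.measure_count_ge_le (hms i) (by rw [hvol]; exact ENNReal.ofReal_ne_top) 2).trans ?_
      rw [hvol, ENNReal.ofReal_pow (by positivity)]
    refine (Finset.sum_le_sum this).trans ?_
    rw [Finset.sum_const, Finset.card_range, nsmul_eq_mul, ← ENNReal.ofReal_natCast,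
      ← ENNReal.ofReal_mul (by positivity)]
    apply le_of_eq
    congr 1
    have : (M : ℝ) ≠ 0 := by positivity
    field_simp
  have h1 : ∀ R : ℕ, P {ω | ¬ ∃ t : ℚ, 0 ≤ t ∧ (Q ω ∩ Metric.ball x (volumeRadius d t)).encard = 1}
      ≤ ENNReal.ofReal (Real.exp (-(R * unitVolume d))) := by
    intro R
    have h : Tendsto (fun M : ℕ => ((M : ℝ) + 1)⁻¹) atTop (𝓝 0) :=
      tendsto_inv_atTop_zero.comp (tendsto_atTop_add_const_right _ _ tendsto_natCast_atTop_atTop)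
    have h2 := (h.const_mul ((R * unitVolume d) ^ 2)).const_add (Real.exp (-(R * unitVolume d)))
    rw [mul_zero, add_zero] at h2
    exact ge_of_tendsto' (ENNReal.tendsto_ofReal h2) (key R)
  have h2 : Tendsto (fun R : ℕ => ENNReal.ofReal (Real.exp (-(R * unitVolume d)))) atTop (𝓝 0) := by
    rw [← ENNReal.ofReal_zero]
    apply ENNReal.tendsto_ofReal
    exact Real.tendsto_exp_neg_atTop_nhds_zero.comp
      (tendsto_natCast_atTop_atTop.atTop_mul_const hv)
  exact le_antisymm (ge_of_tendsto' h2 h1) zero_le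

/-- A ball as a Borel set of finite volume. -/
noncomputable def ballSet (x : EuclideanSpace ℝ (Fin d)) (r : ℝ) : FiniteVolumeSet d :=
  ⟨Metric.ball x r, Metric.isOpen_ball.measurableSet, measure_ball_lt_top.ne⟩

/-- The intersection of two balls as a Borel set of finite volume. -/
noncomputable def interBallSet (x : EuclideanSpace ℝ (Fin d)) (r : ℝ)
    (y : EuclideanSpace ℝ (Fin d)) (s : ℝ) : FiniteVolumeSet d :=
  ⟨Metric.ball x r ∩ Metric.ball y s,
    Metric.isOpen_ball.measurableSet.inter Metric.isOpen_ball.measurableSet,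
    ne_top_of_le_ne_top measure_ball_lt_top.ne (measure_mono Set.inter_subset_left)⟩

/-- The event, in terms of the numbers of points in countably many sets, that there is a path of
passage time less than `t` from the point closest to `x` to the point closest to `y`. -/
def pathEvent (α : ℝ) (x y : EuclideanSpace ℝ (Fin d)) (t : ℝ) : Set (FiniteVolumeSet d → ℕ∞) :=
  ⋃ (m : ℕ) (β : Fin (m + 2) → ℕ × ℕ) (τ : ℚ) (σ : ℚ)
    (_ : ∀ p : Fin (m + 2) → EuclideanSpace ℝ (Fin d),
      (∀ i, p i ∈ Metric.ball (TopologicalSpace.denseSeq _ (β i).1) (1 / ((β i).2 + 1 : ℝ))) →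
        pathTime α p < t),
    {N | N (ballSet x (volumeRadius d τ)) = 1} ∩
    {N | N (interBallSet x (volumeRadius d τ) (TopologicalSpace.denseSeq _ (β 0).1)
      (1 / ((β 0).2 + 1 : ℝ))) = 1} ∩
    {N | N (ballSet y (volumeRadius d σ)) = 1} ∩
    {N | N (interBallSet y (volumeRadius d σ) (TopologicalSpace.denseSeq _ (β (Fin.last _)).1)
      (1 / ((β (Fin.last _)).2 + 1 : ℝ))) = 1} ∩
    ⋂ i, {N | N (ballSet (TopologicalSpace.denseSeq _ (β i).1) (1 / ((β i).2 + 1 : ℝ))) ≠ 0}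

lemma measurableSet_pathEvent (α : ℝ) (x y : EuclideanSpace ℝ (Fin d)) (t : ℝ) :
    MeasurableSet (pathEvent α x y t) := by
  have h : ∀ (B : FiniteVolumeSet d) (s : Set ℕ∞),
      MeasurableSet {N : FiniteVolumeSet d → ℕ∞ | N B ∈ s} := fun B s =>
    measurable_pi_apply B MeasurableSet.of_discrete
  refine MeasurableSet.iUnion fun m => MeasurableSet.iUnion fun β => MeasurableSet.iUnion fun τ =>
    MeasurableSet.iUnion fun σ => MeasurableSet.iUnion fun _ => ?_
  exact (((((h _ {1}).inter (h _ {1})).inter (h _ {1})).inter (h _ {1})).inter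
    (MeasurableSet.iInter fun i => h _ {0}ᶜ))

lemma continuous_pathTime {α : ℝ} (hα : 0 < α) (m : ℕ) :
    Continuous fun p : Fin (m + 1) → EuclideanSpace ℝ (Fin d) => pathTime α p := by
  unfold pathTime
  refine continuous_finsetSum _ fun i _ => ?_
  have h : Continuous fun p : Fin (m + 1) → EuclideanSpace ℝ (Fin d) => ‖p i.castSucc - p i.succ‖ := by
    fun_prop
  exact h.rpow_const fun _ => Or.inr hα.le

lemma IsClosestPointMap.inter_ball_eq {S : Set (EuclideanSpace ℝ (Fin d))}
    {q : EuclideanSpace ℝ (Fin d) → EuclideanSpace ℝ (Fin d)} (hq : IsClosestPointMap S q)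
    {x : EuclideanSpace ℝ (Fin d)} {r : ℝ} (h : (S ∩ Metric.ball x r).encard = 1) :
    S ∩ Metric.ball x r = {q x} := by
  obtain ⟨z, hz⟩ := Set.encard_eq_one.1 h
  have hzm : z ∈ S ∩ Metric.ball x r := by rw [hz]; rfl
  have hqm : q x ∈ S ∩ Metric.ball x r := by
    refine ⟨(hq x).1, ?_⟩
    have h1 := (hq x).2 z hzm.1
    have h2 := hzm.2
    rw [Metric.mem_ball, dist_comm, dist_eq_norm] at h2 ⊢
    linarith
  rw [hz] at hqm ⊢
  rw [Set.mem_singleton_iff.1 hqm]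

/-- Passage times are continuous in the vertices, so a strict inequality persists on a product of
small rational balls, and only the presence of points in these balls matters. The endpoints are
pinned down by isolating balls around `x` and `y`. -/
lemma passageTime_lt_iff_mem_pathEvent {α : ℝ} (hα : 0 < α) {S : Set (EuclideanSpace ℝ (Fin d))}
    {q : EuclideanSpace ℝ (Fin d) → EuclideanSpace ℝ (Fin d)} (hq : IsClosestPointMap S q)
    {x y : EuclideanSpace ℝ (Fin d)}
    (hx : ∃ t : ℚ, 0 ≤ t ∧ (S ∩ Metric.ball x (volumeRadius d t)).encard = 1)
    (hy : ∃ t : ℚ, 0 ≤ t ∧ (S ∩ Metric.ball y (volumeRadius d t)).encard = 1) (t : ℝ) :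
    passageTime α S q x y < t ↔ counts S ∈ pathEvent α x y t := by
  simp only [pathEvent, Set.mem_iUnion, Set.mem_inter_iff, Set.mem_iInter, Set.mem_ofPred_eq]
  constructor
  · intro h
    -- The starting point is repeated at zero cost so that the path has at least two vertices; the
    -- first and last indices are then distinct even when m = 0.
    obtain ⟨m, r, h1, h2, h3, h4⟩ := exists_pathTime_lt (hq x).1 (hq y).1 h
    obtain ⟨r', hr'⟩ : ∃ r' : Fin (m + 2) → EuclideanSpace ℝ (Fin d), r' = Fin.cons (q x) r :=
      ⟨_, rfl⟩
    have hr'S : ∀ i, r' i ∈ S := fun i => by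
      rw [hr']
      refine Fin.cases ?_ (fun j => ?_) i
      · simpa using (hq x).1
      · simpa using h1 j
    have hr'0 : r' 0 = q x := by simp [hr']
    have hr'l : r' (Fin.last _) = q y := by rw [hr', ← Fin.succ_last, Fin.cons_succ, h3]
    have hr't : pathTime α r' < t := by
      rw [hr', pathTime_cons, h2, sub_self, norm_zero, Real.zero_rpow hα.ne', zero_add]
      exact h4
    obtain ⟨δ, hδ, hball⟩ := Metric.eventually_nhds_iff.1
      ((continuous_pathTime (d := d) hα (m + 1)).continuousAt.eventually_lt
        (continuousAt_const (y := t)) hr't)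
    obtain ⟨n, hn⟩ := exists_nat_one_div_lt (half_pos hδ)
    have hk : ∀ i, ∃ k, dist (r' i) (TopologicalSpace.denseSeq _ k) < 1 / ((n : ℝ) + 1) := by
      intro i
      exact (TopologicalSpace.denseRange_denseSeq (EuclideanSpace ℝ (Fin d))).exists_dist_lt (r' i)
        (by positivity)
    choose k hk using hk
    obtain ⟨τ, -, hτ⟩ := hx
    obtain ⟨σ, -, hσ⟩ := hy
    refine ⟨m, fun i => (k i, n), τ, σ, ?_, ⟨⟨⟨⟨hτ, ?_⟩, hσ⟩, ?_⟩, ?_⟩⟩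
    · intro p hp
      apply hball
      rw [dist_pi_lt_iff hδ]
      intro i
      have h5 := hp i
      rw [Metric.mem_ball] at h5
      calc dist (p i) (r' i) ≤ dist (p i) (TopologicalSpace.denseSeq _ (k i)) +
            dist (r' i) (TopologicalSpace.denseSeq _ (k i)) := dist_triangle_right _ _ _
        _ < δ := by have := hk i; dsimp only at h5; linarith
    · change (S ∩ (Metric.ball _ _ ∩ Metric.ball _ _)).encard = 1
      rw [← Set.inter_assoc, hq.inter_ball_eq hτ, Set.inter_eq_left.2, Set.encard_singleton]
      rw [Set.singleton_subset_iff, ← hr'0]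
      exact hk 0
    · change (S ∩ (Metric.ball _ _ ∩ Metric.ball _ _)).encard = 1
      rw [← Set.inter_assoc, hq.inter_ball_eq hσ, Set.inter_eq_left.2, Set.encard_singleton]
      rw [Set.singleton_subset_iff, ← hr'l]
      exact hk _
    · intro i
      change (S ∩ Metric.ball _ _).encard ≠ 0
      rw [Set.encard_ne_zero]
      exact ⟨r' i, hr'S i, hk i⟩
  · rintro ⟨m, β, τ, σ, hp, ⟨⟨⟨h1, h2⟩, h3⟩, h4⟩, h5⟩
    change (S ∩ Metric.ball _ _).encard = 1 at h1 h3
    change (S ∩ (Metric.ball _ _ ∩ Metric.ball _ _)).encard = 1 at h2 h4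
    rw [← Set.inter_assoc, hq.inter_ball_eq h1] at h2
    rw [← Set.inter_assoc, hq.inter_ball_eq h3] at h4
    have h5' : ∀ i, ∃ z, z ∈ S ∧ z ∈ Metric.ball (TopologicalSpace.denseSeq _ (β i).1)
        (1 / ((β i).2 + 1 : ℝ)) := fun i => Set.encard_ne_zero.1 (h5 i)
    choose z hzS hzb using h5'
    have hmem : ∀ {w : EuclideanSpace ℝ (Fin d)} {B : Set _}, (({w} : Set _) ∩ B).encard = 1 →
        w ∈ B := by
      intro w B h
      obtain ⟨u, hu⟩ := Set.encard_eq_one.1 h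
      have : u ∈ ({w} : Set _) ∩ B := by rw [hu]; rfl
      rw [← Set.mem_singleton_iff.1 this.1]
      exact this.2
    classical
    let p : Fin (m + 2) → EuclideanSpace ℝ (Fin d) :=
      fun i => if i = 0 then q x else if i = Fin.last _ then q y else z i
    have hpb : pathTime α p < t := by
      apply hp
      intro i
      by_cases hi : i = 0
      · subst hi; simpa [p] using hmem h2
      by_cases hi' : i = Fin.last _
      · subst hi'; simpa [p, hi] using hmem h4
      · simpa [p, hi, hi'] using hzb i
    have hpS : ∀ i, p i ∈ S := by
      intro i
      simp only [p]
      split_ifs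
      exacts [(hq x).1, (hq y).1, hzS i]
    refine lt_of_le_of_lt ?_ hpb
    have h6 := pointTime_le_pathTime (α := α) hpS
    have h7 : p 0 = q x := by simp [p]
    have h8 : p (Fin.last _) = q y := by simp [p]
    rw [h7, h8] at h6
    exact h6

open Classical in
/-- The passage time as a measurable function of the numbers of points in the sets of finite
volume. -/
noncomputable def timeOfCounts (α : ℝ) (x y : EuclideanSpace ℝ (Fin d))
    (N : FiniteVolumeSet d → ℕ∞) : ℝ :=
  (⨅ t : ℚ, if N ∈ pathEvent α x y t then ((t : ℝ) : EReal) else ⊤).toReal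

lemma measurable_timeOfCounts (α : ℝ) (x y : EuclideanSpace ℝ (Fin d)) :
    Measurable (timeOfCounts α x y) := by
  classical
  unfold timeOfCounts
  exact measurable_ereal_toReal.comp (Measurable.iInf fun t =>
    Measurable.ite (measurableSet_pathEvent α x y t) measurable_const measurable_const)

lemma passageTime_eq_timeOfCounts {α : ℝ} (hα : 0 < α) {S : Set (EuclideanSpace ℝ (Fin d))}
    {q : EuclideanSpace ℝ (Fin d) → EuclideanSpace ℝ (Fin d)} (hq : IsClosestPointMap S q)
    {x y : EuclideanSpace ℝ (Fin d)}
    (hx : ∃ t : ℚ, 0 ≤ t ∧ (S ∩ Metric.ball x (volumeRadius d t)).encard = 1)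
    (hy : ∃ t : ℚ, 0 ≤ t ∧ (S ∩ Metric.ball y (volumeRadius d t)).encard = 1) :
    passageTime α S q x y = timeOfCounts α x y (counts S) := by
  classical
  unfold timeOfCounts
  simp only [← passageTime_lt_iff_mem_pathEvent hα hq hx hy]
  have : (⨅ t : ℚ, if passageTime α S q x y < t then ((t : ℝ) : EReal) else ⊤) =
      (passageTime α S q x y : EReal) := by
    apply le_antisymm
    · refine le_of_forall_gt_imp_ge_of_dense fun c hc => ?_
      obtain ⟨t, ht1, ht2⟩ := EReal.exists_rat_btwn_of_lt hc
      refine (iInf_le _ t).trans ?_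
      rw [if_pos (by exact_mod_cast ht1)]
      exact ht2.le
    · refine le_iInf fun t => ?_
      split_ifs with h
      · exact_mod_cast h.le
      · exact le_top
  rw [this, EReal.toReal_coe]

lemma IsPoissonProcess.ae_passageTime_eq [NeZero d] (hQ : IsPoissonProcess P Q) {α : ℝ}
    (hα : 0 < α) {q : Ω → EuclideanSpace ℝ (Fin d) → EuclideanSpace ℝ (Fin d)}
    (hq : ∀ᵐ ω ∂P, IsClosestPointMap (Q ω) (q ω)) (x y : EuclideanSpace ℝ (Fin d)) :
    ∀ᵐ ω ∂P, passageTime α (Q ω) (q ω) x y = timeOfCounts α x y (counts (Q ω)) := by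
  filter_upwards [hq, hQ.ae_exists_ball_encard_eq_one x, hQ.ae_exists_ball_encard_eq_one y]
    with ω h1 h2 h3 using passageTime_eq_timeOfCounts hα h1 h2 h3

lemma IsPoissonProcess.aemeasurable_passageTime [NeZero d] (hQ : IsPoissonProcess P Q) {α : ℝ}
    (hα : 0 < α) {q : Ω → EuclideanSpace ℝ (Fin d) → EuclideanSpace ℝ (Fin d)}
    (hq : ∀ᵐ ω ∂P, IsClosestPointMap (Q ω) (q ω)) (x y : EuclideanSpace ℝ (Fin d)) :
    AEMeasurable (fun ω => passageTime α (Q ω) (q ω) x y) P :=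
  ⟨_, (measurable_timeOfCounts α x y).comp hQ.measurable_counts, hQ.ae_passageTime_eq hα hq x y⟩

/-- Tie-breaking and the possible non-measurability of `q` disappear here: both passage times agree
almost surely with the same measurable function of the counts, and the law of the counts is unique.
-/
lemma IsPoissonProcess.identDistrib_passageTime [NeZero d] [IsProbabilityMeasure P]
    (hQ : IsPoissonProcess P Q) (hQ' : IsPoissonProcess P Q') {α : ℝ} (hα : 0 < α)
    {q q' : Ω → EuclideanSpace ℝ (Fin d) → EuclideanSpace ℝ (Fin d)}
    (hq : ∀ᵐ ω ∂P, IsClosestPointMap (Q ω) (q ω))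
    (hq' : ∀ᵐ ω ∂P, IsClosestPointMap (Q' ω) (q' ω)) (x y : EuclideanSpace ℝ (Fin d)) :
    IdentDistrib (fun ω => passageTime α (Q ω) (q ω) x y)
      (fun ω => passageTime α (Q' ω) (q' ω) x y) P P where
  aemeasurable_fst := hQ.aemeasurable_passageTime hα hq x y
  aemeasurable_snd := hQ'.aemeasurable_passageTime hα hq' x y
  map_eq := by
    rw [Measure.map_congr (hQ.ae_passageTime_eq hα hq x y),
      Measure.map_congr (hQ'.ae_passageTime_eq hα hq' x y)]
    have h := measurable_timeOfCounts α x y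
    have h1 := congrArg (Measure.map (timeOfCounts α x y)) (hQ.map_counts_eq hQ')
    rwa [Measure.map_map h hQ.measurable_counts, Measure.map_map h hQ'.measurable_counts] at h1

end Measurability

end EuclideanFPP

/-! ### Means of passage times and the time constant. -/

namespace EuclideanFPP

/-- Fekete's lemma along the integers, extended to real arguments by the coarse Lipschitz bound. The
lower bound by `r * μ` follows from subadditivity along the multiples of `r`. -/
lemma tendsto_div_of_subadditive_lipschitz {h : ℝ → ℝ} {H : ℝ} (hH : 0 ≤ H)
    (h0 : ∀ r, 0 ≤ r → 0 ≤ h r)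
    (hsub : ∀ r s, 0 ≤ r → 0 ≤ s → h (r + s) ≤ h r + h s)
    (hlip : ∀ r s, 0 ≤ r → 0 ≤ s → |h r - h s| ≤ H * (1 + |r - s|)) :
    ∃ μ : ℝ, Tendsto (fun r : ℝ => h r / r) atTop (𝓝 μ) ∧ 0 ≤ μ ∧ ∀ r, 0 ≤ r → r * μ ≤ h r := by
  have hs : Subadditive fun n : ℕ => h n := fun m n => by
    push_cast
    exact hsub _ _ (by positivity) (by positivity)
  have hlim := hs.tendsto_lim ⟨0, by
    rintro _ ⟨n, rfl⟩
    exact div_nonneg (h0 _ (by positivity)) (by positivity)⟩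
  generalize hs.lim = μ at hlim
  have h1 : Tendsto (fun r : ℝ => h ⌊r⌋₊ / (⌊r⌋₊ : ℝ) * ((⌊r⌋₊ : ℝ) / r)) atTop (𝓝 (μ * 1)) :=
    (hlim.comp tendsto_nat_floor_atTop).mul tendsto_nat_floor_div_atTop
  have h2 : Tendsto (fun r : ℝ => 2 * H / r) atTop (𝓝 0) := tendsto_const_nhds.div_atTop tendsto_id
  have h3 : Tendsto (fun r : ℝ => (h r - h ⌊r⌋₊) / r) atTop (𝓝 0) := by
    refine squeeze_zero_norm' ?_ h2
    filter_upwards [eventually_gt_atTop 0] with r hr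
    rw [norm_div, Real.norm_of_nonneg hr.le, Real.norm_eq_abs]
    gcongr
    refine (hlip _ _ hr.le (by positivity)).trans ?_
    have : |r - ⌊r⌋₊| ≤ 1 := by
      rw [abs_of_nonneg (sub_nonneg.2 (Nat.floor_le hr.le))]
      linarith [Nat.lt_floor_add_one r]
    nlinarith
  have h4 : Tendsto (fun r : ℝ => h r / r) atTop (𝓝 μ) := by
    have := h1.add h3
    rw [mul_one, add_zero] at this
    refine this.congr' ?_
    filter_upwards [eventually_ge_atTop 1] with r hr
    have : (0 : ℝ) < ⌊r⌋₊ := by exact_mod_cast Nat.floor_pos.2 hr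
    field_simp
    ring
  refine ⟨μ, h4, ge_of_tendsto h4 ?_, fun r hr => ?_⟩
  · filter_upwards [eventually_gt_atTop 0] with r hr using div_nonneg (h0 _ hr.le) hr.le
  rcases hr.eq_or_lt with rfl | hr
  · simpa using h0 0 le_rfl
  have h5 : ∀ k : ℕ, h ((k + 1 : ℕ) * r) ≤ (k + 1 : ℕ) * h r := by
    intro k
    induction k with
    | zero => simp
    | succ k ih =>
      have := hsub ((k + 1 : ℕ) * r) r (by positivity) hr.le
      push_cast at *
      calc h ((k + 1 + 1) * r) = h ((k + 1) * r + r) := by ring_nf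
        _ ≤ _ := by linarith
  have h6 : Tendsto (fun k : ℕ => h ((k + 1 : ℕ) * r) / ((k + 1 : ℕ) * r)) atTop (𝓝 μ) := by
    have : Tendsto (fun k : ℕ => ((k + 1 : ℕ) : ℝ) * r) atTop atTop :=
      (tendsto_natCast_atTop_atTop.comp (tendsto_add_atTop_nat 1)).atTop_mul_const hr
    exact h4.comp this
  have h7 : μ ≤ h r / r := by
    refine le_of_tendsto' h6 fun k => ?_
    rw [div_le_div_iff₀ (by positivity) hr]
    calc h ((k + 1 : ℕ) * r) * r ≤ (k + 1 : ℕ) * h r * r := by gcongr; exact h5 k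
      _ = _ := by ring
  rw [le_div_iff₀ hr] at h7
  linarith

section Mean

variable {Ω : Type*} [MeasurableSpace Ω] {P : Measure Ω} {d : ℕ} [NeZero d] {α : ℝ}
  {Q : Ω → Set (EuclideanSpace ℝ (Fin d))}
  {q : Ω → EuclideanSpace ℝ (Fin d) → EuclideanSpace ℝ (Fin d)}

/-- The mean of the passage time along the first axis. -/
noncomputable def meanTime (P : Measure Ω) (α : ℝ) (Q : Ω → Set (EuclideanSpace ℝ (Fin d)))
    (q : Ω → EuclideanSpace ℝ (Fin d) → EuclideanSpace ℝ (Fin d)) (r : ℝ) : ℝ :=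
  ∫ ω, axisTime α Q q r ω ∂P

/-- The first unit vector. -/
noncomputable def axisVector (d : ℕ) [NeZero d] : EuclideanSpace ℝ (Fin d) :=
  EuclideanSpace.single (0 : Fin d) (1 : ℝ)

lemma norm_axisVector : ‖axisVector d‖ = 1 := by simp [axisVector]

lemma norm_smul_axisVector {r : ℝ} (hr : 0 ≤ r) : ‖r • axisVector d‖ = r := by
  rw [norm_smul, norm_axisVector, mul_one, Real.norm_of_nonneg hr]

omit [MeasurableSpace Ω] in
lemma axisTime_eq (r : ℝ) (ω : Ω) :
    axisTime α Q q r ω = passageTime α (Q ω) (q ω) 0 (r • axisVector d) := rfl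

omit [NeZero d] in
lemma passageTime_nonneg {S : Set (EuclideanSpace ℝ (Fin d))}
    {q : EuclideanSpace ℝ (Fin d) → EuclideanSpace ℝ (Fin d)} {x y : EuclideanSpace ℝ (Fin d)} :
    0 ≤ passageTime α S q x y :=
  pointTime_nonneg

omit [NeZero d] in
lemma passageTime_le_rpow (hα : 0 ≤ α) {S : Set (EuclideanSpace ℝ (Fin d))}
    {q : EuclideanSpace ℝ (Fin d) → EuclideanSpace ℝ (Fin d)} (hq : IsClosestPointMap S q)
    (x y : EuclideanSpace ℝ (Fin d)) :
    passageTime α S q x y ≤ (‖x - y‖ + ‖x - q x‖ + ‖y - q y‖) ^ α := by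
  refine (pointTime_le_edge (hq x).1 (hq y).1).trans ?_
  apply Real.rpow_le_rpow (norm_nonneg _) _ hα
  have e : q x - q y = (x - y) - (x - q x) + (y - q y) := by abel
  rw [e]
  refine (norm_add_le _ _).trans ?_
  gcongr
  exact norm_sub_le _ _

omit [NeZero d] in
lemma passageTime_triangle {S : Set (EuclideanSpace ℝ (Fin d))}
    {q : EuclideanSpace ℝ (Fin d) → EuclideanSpace ℝ (Fin d)} (hq : IsClosestPointMap S q)
    (x y z : EuclideanSpace ℝ (Fin d)) :
    passageTime α S q x z ≤ passageTime α S q x y + passageTime α S q y z :=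
  pointTime_triangle (hq x).1 (hq y).1 (hq z).1

/-- A translation takes `x` to 0, and the reflection exchanging two vectors of equal norm then puts
the image of `y` on the first axis. -/
lemma exists_isometryEquiv (x y : EuclideanSpace ℝ (Fin d)) :
    ∃ g : EuclideanSpace ℝ (Fin d) ≃ᵢ EuclideanSpace ℝ (Fin d),
      MeasurePreserving g volume volume ∧ g x = 0 ∧ g y = ‖x - y‖ • axisVector d := by
  have h : ‖y - x‖ = ‖‖x - y‖ • axisVector d‖ := by
    rw [norm_smul_axisVector (norm_nonneg _), norm_sub_rev]
  obtain ⟨f, hf⟩ : ∃ f : EuclideanSpace ℝ (Fin d) ≃ₗᵢ[ℝ] EuclideanSpace ℝ (Fin d),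
      f (y - x) = ‖x - y‖ • axisVector d := ⟨_, Submodule.reflection_sub h⟩
  refine ⟨(IsometryEquiv.subRight x).trans f.toIsometryEquiv, ?_, ?_, ?_⟩
  · exact f.measurePreserving.comp (measurePreserving_sub_right volume x)
  · simp
  · simpa using hf

lemma IsPoissonProcess.identDistrib_axisTime [IsProbabilityMeasure P] (hQ : IsPoissonProcess P Q)
    (hα : 1 < α) (hq : ∀ᵐ ω ∂P, IsClosestPointMap (Q ω) (q ω)) (x y : EuclideanSpace ℝ (Fin d)) :
    IdentDistrib (fun ω => passageTime α (Q ω) (q ω) x y) (axisTime α Q q ‖x - y‖) P P := by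
  obtain ⟨g, hg, hx, hy⟩ := exists_isometryEquiv x y
  have h := (hQ.image_isometry g hg).identDistrib_passageTime hQ (q' := q)
    (q := fun ω z => g (q ω (g.symm z))) (by linarith : 0 < α)
    (hq.mono fun ω h => h.image_isometry g) hq (g x) (g y)
  simp only [passageTime_image_isometry] at h
  rw [hx, hy] at h
  exact h

lemma IsPoissonProcess.measure_dist_gt_le (hQ : IsPoissonProcess P Q) [IsProbabilityMeasure P]
    (hq : ∀ᵐ ω ∂P, IsClosestPointMap (Q ω) (q ω)) (x : EuclideanSpace ℝ (Fin d)) (t : ℝ) :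
    P {ω | t < ‖x - q ω x‖} ≤
      ENNReal.ofReal (Real.exp (unitVolume d) * Real.exp (-(unitVolume d * t))) := by
  have hv := unitVolume_pos d
  rcases lt_or_ge t 1 with ht | ht
  -- The prefactor exp(v), with v the volume of the unit ball, makes the bound trivial for t < 1;
  -- beyond that, t ≤ t^d turns the volume into a linear exponent.
  · refine prob_le_one.trans ?_
    rw [← Real.exp_add, ENNReal.one_le_ofReal, Real.one_le_exp_iff]
    nlinarith
  · calc P {ω | t < ‖x - q ω x‖} ≤ P {ω | (Q ω ∩ Metric.ball x t).encard = 0} := by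
          apply measure_mono_ae
          filter_upwards [hq] with ω hω h
          change t < ‖x - q ω x‖ at h
          change (Q ω ∩ Metric.ball x t).encard = 0
          rw [Set.encard_eq_zero, Set.eq_empty_iff_forall_notMem]
          rintro z ⟨hz, hzb⟩
          have := (hω x).2 z hz
          rw [Metric.mem_ball, dist_comm, dist_eq_norm] at hzb
          linarith
      _ = ENNReal.ofReal (Real.exp (-(t ^ d * unitVolume d))) :=
          hQ.measure_ball_empty x (by linarith)
      _ ≤ _ := by
          apply ENNReal.ofReal_le_ofReal
          rw [← Real.exp_add, Real.exp_le_exp]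
          have : t ≤ t ^ d := le_self_pow₀ ht (NeZero.ne d)
          nlinarith

/-- The direct edge between the two closest points already gives this: a large passage time forces
one of the two points to be far from its closest configuration point. -/
lemma IsPoissonProcess.measure_passageTime_gt_le (hQ : IsPoissonProcess P Q)
    [IsProbabilityMeasure P] (hα : 1 < α) (hq : ∀ᵐ ω ∂P, IsClosestPointMap (Q ω) (q ω))
    (x y : EuclideanSpace ℝ (Fin d)) {t : ℝ} (ht : 0 ≤ t) :
    P {ω | t < passageTime α (Q ω) (q ω) x y} ≤
      ENNReal.ofReal (2 * Real.exp (unitVolume d) *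
        Real.exp (-(unitVolume d * ((t ^ (1 / α) - ‖x - y‖) / 2)))) := by
  set s := (t ^ (1 / α) - ‖x - y‖) / 2 with hs
  calc P {ω | t < passageTime α (Q ω) (q ω) x y}
      ≤ P ({ω | s < ‖x - q ω x‖} ∪ {ω | s < ‖y - q ω y‖}) := by
        apply measure_mono_ae
        filter_upwards [hq] with ω hω h
        change t < passageTime α (Q ω) (q ω) x y at h
        change s < ‖x - q ω x‖ ∨ s < ‖y - q ω y‖
        by_contra! hcon
        have h1 := passageTime_le_rpow (by linarith : 0 ≤ α) hω x y
        have h2 : (‖x - y‖ + ‖x - q ω x‖ + ‖y - q ω y‖) ^ α ≤ (t ^ (1 / α)) ^ α := by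
          apply Real.rpow_le_rpow (by positivity) _ (by linarith)
          linarith [hcon.1, hcon.2]
        rw [← Real.rpow_mul ht, one_div_mul_cancel (by linarith), Real.rpow_one] at h2
        linarith
    _ ≤ _ := (measure_union_le _ _).trans (add_le_add (hQ.measure_dist_gt_le hq x s)
        (hQ.measure_dist_gt_le hq y s))
    _ = _ := by
        rw [← ENNReal.ofReal_add (by positivity) (by positivity)]
        congr 1
        ring

/-- An integral that bounds the mean of the passage time at unit distance. -/
noncomputable def tailIntegral (d : ℕ) (α : ℝ) : ℝ :=
  2 * Real.exp (unitVolume d) *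
    ∫ t in Set.Ioi (0 : ℝ), t ^ (0 : ℝ) * Real.exp (-(unitVolume d / 2) * t ^ (1 / α))

lemma tailIntegral_nonneg (d : ℕ) (α : ℝ) : 0 ≤ tailIntegral d α := by
  unfold tailIntegral
  have : 0 ≤ ∫ t in Set.Ioi (0 : ℝ), t ^ (0 : ℝ) * Real.exp (-(unitVolume d / 2) * t ^ (1 / α)) :=
    setIntegral_nonneg measurableSet_Ioi fun t ht =>
      mul_nonneg (Real.rpow_nonneg (le_of_lt ht) _) (Real.exp_pos _).le
  positivity

lemma IsPoissonProcess.lintegral_passageTime_le (hQ : IsPoissonProcess P Q)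
    [IsProbabilityMeasure P] (hα : 1 < α) (hq : ∀ᵐ ω ∂P, IsClosestPointMap (Q ω) (q ω))
    (x y : EuclideanSpace ℝ (Fin d)) :
    ∫⁻ ω, ENNReal.ofReal (passageTime α (Q ω) (q ω) x y) ∂P ≤
      ENNReal.ofReal (Real.exp (unitVolume d / 2 * ‖x - y‖) * tailIntegral d α) := by
  have hv := unitVolume_pos d
  have hint := integrableOn_rpow_mul_exp_neg_mul_rpow (p := 1 / α) (s := 0) (b := unitVolume d / 2)
    (by norm_num) (by positivity) (by positivity)
  rw [lintegral_eq_lintegral_meas_lt P (Eventually.of_forall fun ω => passageTime_nonneg)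
    (hQ.aemeasurable_passageTime (by linarith) hq x y), tailIntegral, ← mul_assoc,
    ← integral_const_mul,
    ofReal_integral_eq_lintegral_ofReal (Integrable.const_mul hint _)]
  · refine setLIntegral_mono' measurableSet_Ioi fun t ht => ?_
    refine (hQ.measure_passageTime_gt_le hα hq x y (le_of_lt ht)).trans
      (ENNReal.ofReal_le_ofReal (le_of_eq ?_))
    have e : Real.exp (-(unitVolume d * ((t ^ (1 / α) - ‖x - y‖) / 2))) =
        Real.exp (unitVolume d / 2 * ‖x - y‖) * Real.exp (-(unitVolume d / 2) * t ^ (1 / α)) := by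
      rw [← Real.exp_add]
      congr 1
      ring
    rw [Real.rpow_zero, one_mul, e]
    ring
  · filter_upwards [self_mem_ae_restrict measurableSet_Ioi] with t ht
    have : (0 : ℝ) ≤ t ^ (0 : ℝ) := Real.rpow_nonneg (le_of_lt ht) _
    simp only [Pi.zero_apply]
    positivity

lemma IsPoissonProcess.integrable_passageTime (hQ : IsPoissonProcess P Q)
    [IsProbabilityMeasure P] (hα : 1 < α) (hq : ∀ᵐ ω ∂P, IsClosestPointMap (Q ω) (q ω))
    (x y : EuclideanSpace ℝ (Fin d)) :
    Integrable (fun ω => passageTime α (Q ω) (q ω) x y) P :=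
  (lintegral_ofReal_ne_top_iff_integrable
    (hQ.aemeasurable_passageTime (by linarith) hq x y).aestronglyMeasurable
    (Eventually.of_forall fun _ => passageTime_nonneg)).1
    (ne_top_of_le_ne_top ENNReal.ofReal_ne_top (hQ.lintegral_passageTime_le hα hq x y))

lemma IsPoissonProcess.integral_passageTime (hQ : IsPoissonProcess P Q)
    [IsProbabilityMeasure P] (hα : 1 < α) (hq : ∀ᵐ ω ∂P, IsClosestPointMap (Q ω) (q ω))
    (x y : EuclideanSpace ℝ (Fin d)) :
    ∫ ω, passageTime α (Q ω) (q ω) x y ∂P = meanTime P α Q q ‖x - y‖ :=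
  (hQ.identDistrib_axisTime hα hq x y).integral_eq

lemma meanTime_nonneg (r : ℝ) : 0 ≤ meanTime P α Q q r :=
  integral_nonneg fun _ => pointTime_nonneg

lemma IsPoissonProcess.meanTime_le_tailIntegral (hQ : IsPoissonProcess P Q)
    [IsProbabilityMeasure P] (hα : 1 < α) (hq : ∀ᵐ ω ∂P, IsClosestPointMap (Q ω) (q ω))
    {r : ℝ} (hr : 0 ≤ r) (hr1 : r ≤ 1) :
    meanTime P α Q q r ≤ Real.exp (unitVolume d / 2) * tailIntegral d α := by
  have hT := tailIntegral_nonneg d α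
  have hv := unitVolume_pos d
  have h1 := hQ.lintegral_passageTime_le hα hq 0 (r • axisVector d)
  rw [← ofReal_integral_eq_lintegral_ofReal (hQ.integrable_passageTime hα hq _ _)
    (Eventually.of_forall fun _ => passageTime_nonneg),
    ENNReal.ofReal_le_ofReal_iff (by positivity), zero_sub, norm_neg,
    norm_smul_axisVector hr] at h1
  refine h1.trans ?_
  gcongr
  nlinarith

lemma IsPoissonProcess.meanTime_add_le (hQ : IsPoissonProcess P Q)
    [IsProbabilityMeasure P] (hα : 1 < α) (hq : ∀ᵐ ω ∂P, IsClosestPointMap (Q ω) (q ω))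
    (x y z : EuclideanSpace ℝ (Fin d)) :
    meanTime P α Q q ‖x - z‖ ≤ meanTime P α Q q ‖x - y‖ + meanTime P α Q q ‖y - z‖ := by
  rw [← hQ.integral_passageTime hα hq, ← hQ.integral_passageTime hα hq,
    ← hQ.integral_passageTime hα hq, ← integral_add (hQ.integrable_passageTime hα hq _ _)
    (hQ.integrable_passageTime hα hq _ _)]
  refine integral_mono_ae (hQ.integrable_passageTime hα hq _ _)
    ((hQ.integrable_passageTime hα hq _ _).add (hQ.integrable_passageTime hα hq _ _)) ?_
  filter_upwards [hq] with ω hω using passageTime_triangle hω x y z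

lemma norm_smul_axisVector_sub (r s : ℝ) : ‖r • axisVector d - s • axisVector d‖ = |r - s| := by
  rw [← sub_smul, norm_smul, norm_axisVector, mul_one, Real.norm_eq_abs]

lemma IsPoissonProcess.meanTime_subadditive (hQ : IsPoissonProcess P Q)
    [IsProbabilityMeasure P] (hα : 1 < α) (hq : ∀ᵐ ω ∂P, IsClosestPointMap (Q ω) (q ω))
    {r s : ℝ} (hr : 0 ≤ r) (hs : 0 ≤ s) :
    meanTime P α Q q (r + s) ≤ meanTime P α Q q r + meanTime P α Q q s := by
  have h := hQ.meanTime_add_le hα hq ((0 : ℝ) • axisVector d) (r • axisVector d)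
    ((r + s) • axisVector d)
  simp only [norm_smul_axisVector_sub] at h
  convert h using 2
  · rw [zero_sub, abs_neg, abs_of_nonneg (by positivity)]
  · congr 1
    rw [zero_sub, abs_neg, abs_of_nonneg hr]
  · congr 1
    rw [sub_add_cancel_left, abs_neg, abs_of_nonneg hs]

lemma IsPoissonProcess.abs_meanTime_sub_le (hQ : IsPoissonProcess P Q)
    [IsProbabilityMeasure P] (hα : 1 < α) (hq : ∀ᵐ ω ∂P, IsClosestPointMap (Q ω) (q ω))
    {r s : ℝ} (hr : 0 ≤ r) (hs : 0 ≤ s) :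
    |meanTime P α Q q r - meanTime P α Q q s| ≤ meanTime P α Q q |r - s| := by
  have key : ∀ {r s : ℝ}, 0 ≤ r → 0 ≤ s →
      meanTime P α Q q r ≤ meanTime P α Q q s + meanTime P α Q q |r - s| := by
    intro r s hr hs
    have h := hQ.meanTime_add_le hα hq ((0 : ℝ) • axisVector d) (s • axisVector d)
      (r • axisVector d)
    simp only [norm_smul_axisVector_sub, zero_sub, abs_neg, abs_of_nonneg hr, abs_of_nonneg hs] at h
    rwa [abs_sub_comm s r] at h
  have h1 := key hr hs
  have h2 := key hs hr
  rw [abs_sub_comm s r] at h2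
  rw [abs_le]
  constructor <;> linarith

/-- The interval is cut into pieces of length at most one, and subadditivity is applied. -/
lemma IsPoissonProcess.meanTime_le_mul (hQ : IsPoissonProcess P Q)
    [IsProbabilityMeasure P] (hα : 1 < α) (hq : ∀ᵐ ω ∂P, IsClosestPointMap (Q ω) (q ω))
    {r : ℝ} (hr : 0 ≤ r) :
    meanTime P α Q q r ≤ Real.exp (unitVolume d / 2) * tailIntegral d α * (1 + r) := by
  have h : ∀ n : ℕ, ∀ r : ℝ, 0 ≤ r → r ≤ n + 1 →
      meanTime P α Q q r ≤ Real.exp (unitVolume d / 2) * tailIntegral d α * (1 + n) := by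
    intro n
    induction n with
    | zero =>
      intro r hr hr1
      simpa using hQ.meanTime_le_tailIntegral hα hq hr (by simpa using hr1)
    | succ n ih =>
      intro r hr hr1
      have hT := mul_nonneg (Real.exp_pos (unitVolume d / 2)).le (tailIntegral_nonneg d α)
      push_cast at hr1 ⊢
      rcases le_or_gt r 1 with h1 | h1
      · refine (hQ.meanTime_le_tailIntegral hα hq hr h1).trans ?_
        apply le_mul_of_one_le_right hT
        linarith [(Nat.cast_nonneg n : (0 : ℝ) ≤ n)]
      · have h2 := hQ.meanTime_subadditive hα hq (r := r - 1) (s := 1) (by linarith) zero_le_one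
        rw [sub_add_cancel] at h2
        have h3 := ih (r - 1) (by linarith) (by linarith)
        have h4 := hQ.meanTime_le_tailIntegral hα hq zero_le_one le_rfl
        linarith
  refine (h ⌊r⌋₊ r hr (Nat.lt_floor_add_one r).le).trans ?_
  have hT := mul_nonneg (Real.exp_pos (unitVolume d / 2)).le (tailIntegral_nonneg d α)
  gcongr
  exact Nat.floor_le hr

end Mean

end EuclideanFPP

/-! ### Properties of the scale ψ and concentration for all pairs of points. -/

namespace EuclideanFPP

/-- A positive function that is monotone and varies regularly with exponent between `κ / 2` and
`1 - κ` beyond `r₀`. -/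
structure IsScale (ψ : ℝ → ℝ) (κ a A r₀ : ℝ) : Prop where
  pos : ∀ r, r₀ ≤ r → 0 < ψ r
  mono : ∀ r s, r₀ ≤ r → r ≤ s → ψ r ≤ ψ s
  double : ∀ r, r₀ ≤ r → ψ (2 * r) ≤ 2 ^ (1 - κ) * ψ r
  ratio : ∀ r s, r₀ ≤ s → s ^ (1 / 2 : ℝ) ≤ r → r ≤ s → ψ r ≤ A * (r / s) ^ κ * ψ s
  lower : ∀ r, r₀ ≤ r → a * r ^ (κ / 2) ≤ ψ r
  upper : ∀ r, r₀ ≤ r → ψ r ≤ A * r ^ (1 - κ)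

lemma IsScale.weaken {ψ : ℝ → ℝ} {κ a A r₀ a' A' r₀' : ℝ} (h : IsScale ψ κ a A r₀) (ha : a' ≤ a)
    (hA : A ≤ A') (hr : r₀ ≤ r₀') (h0 : 0 ≤ r₀') : IsScale ψ κ a' A' r₀' where
  pos r hr' := h.pos r (hr.trans hr')
  mono r s hr' hs := h.mono r s (hr.trans hr') hs
  double r hr' := h.double r (hr.trans hr')
  ratio r s hs h1 h2 := by
    refine (h.ratio r s (hr.trans hs) h1 h2).trans ?_
    have := (h.pos s (hr.trans hs)).le
    have h3 : 0 ≤ r := le_trans (Real.rpow_nonneg (h0.trans hs) _) h1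
    have h4 : 0 ≤ (r / s) ^ κ := Real.rpow_nonneg (div_nonneg h3 (h0.trans hs)) _
    gcongr
  lower r hr' := by
    refine le_trans ?_ (h.lower r (hr.trans hr'))
    have : 0 ≤ r ^ (κ / 2) := Real.rpow_nonneg (h0.trans hr') _
    gcongr
  upper r hr' := by
    refine (h.upper r (hr.trans hr')).trans ?_
    have : 0 ≤ r ^ (1 - κ) := Real.rpow_nonneg (h0.trans hr') _
    gcongr

lemma RegularGrowth.exists_isScale {ψ : ℝ → ℝ} (hψ : ∀ x : ℝ, 0 < x → 0 < ψ x) {κ : ℝ}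
    (hκ : 0 < κ) (hκ' : κ < 1 / 2) (hg : RegularGrowth ψ κ) :
    ∃ a A r₀ : ℝ, 0 < a ∧ IsScale ψ κ a A r₀ := by
  obtain ⟨n₀, hn₀, hmono, D, hD, hgr⟩ := hg
  -- The square ensures that square roots of arguments beyond `r₀` stay in the range where ψ is
  -- monotone.
  set r₀ := max (n₀ ^ 2) (max n₀ 2) with hr₀
  have h1 : n₀ ^ 2 ≤ r₀ := le_max_left _ _
  have h2 : n₀ ≤ r₀ := (le_max_left _ _).trans (le_max_right _ _)
  have h3 : 2 ≤ r₀ := (le_max_right _ _).trans (le_max_right _ _)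
  have hm : ∀ r s, n₀ ≤ r → r ≤ s → ψ r ≤ ψ s := fun r s hr hs => hmono hr (hr.trans hs) hs
  have hdouble : ∀ r, r₀ ≤ r → ψ (2 * r) ≤ 2 ^ (1 - κ) * ψ r := by
    intro r hr
    have h4 := (hgr (2 * r) 2 (by linarith) (by norm_num) (by
      rw [← Real.sqrt_eq_rpow]
      apply Real.le_sqrt_of_sq_le
      linarith)).1
    rw [mul_div_cancel_left₀ _ (two_ne_zero), one_div, inv_mul_le_iff₀ (by positivity)] at h4
    exact h4
  have hupper : ∀ k : ℕ, ∀ r, r₀ ≤ r → r ≤ r₀ * 2 ^ (k + 1) →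
      ψ r ≤ ψ (2 * r₀) * (r / r₀) ^ (1 - κ) := by
    have hbase : ∀ r, r₀ ≤ r → r ≤ 2 * r₀ → ψ r ≤ ψ (2 * r₀) * (r / r₀) ^ (1 - κ) := by
      intro r hr hr'
      refine (hm r (2 * r₀) (h2.trans hr) hr').trans ?_
      apply le_mul_of_one_le_right (hψ _ (by linarith)).le
      apply Real.one_le_rpow _ (by linarith)
      rwa [one_le_div (by linarith)]
    intro k
    induction k with
    | zero => exact fun r hr hr' => hbase r hr (by rw [zero_add, pow_one] at hr'; linarith)
    | succ k ih =>
      intro r hr hr'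
      rcases le_or_gt r (2 * r₀) with h | h
      · exact hbase r hr h
      · have h4 := ih (r / 2) (by linarith) (by rw [pow_succ] at hr'; linarith)
        have h5 := hdouble (r / 2) (by linarith)
        rw [mul_div_cancel₀ _ (two_ne_zero)] at h5
        calc ψ r ≤ 2 ^ (1 - κ) * (ψ (2 * r₀) * (r / 2 / r₀) ^ (1 - κ)) := by
              refine h5.trans ?_
              gcongr
          _ = ψ (2 * r₀) * (2 * (r / 2 / r₀)) ^ (1 - κ) := by
              have : 0 ≤ r / 2 / r₀ := div_nonneg (by linarith) (by linarith)
              rw [Real.mul_rpow (by norm_num) this]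
              ring
          _ = _ := by congr 2; ring
  refine ⟨ψ n₀ / D, max D (ψ (2 * r₀)), r₀, div_pos (hψ _ hn₀) (by linarith), ?_⟩
  constructor
  · exact fun r hr => hψ r (by linarith)
  · exact fun r s hr hs => hm r s (h2.trans hr) hs
  · exact hdouble
  · intro r s hs h4 h5
    have hs0 : 0 < s := by linarith
    have hr0 : 0 < r := lt_of_lt_of_le (Real.rpow_pos_of_pos hs0 _) h4
    have h6 : s / r ≤ s ^ (1 / 2 : ℝ) := by
      rw [div_le_iff₀ hr0]
      calc s = s ^ (1 / 2 : ℝ) * s ^ (1 / 2 : ℝ) := by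
            rw [← Real.rpow_add hs0]; norm_num
        _ ≤ _ := by gcongr
    have h7 := (hgr s (s / r) (h2.trans hs) (by rwa [one_le_div hr0]) h6).2
    rw [div_div_cancel₀ hs0.ne'] at h7
    refine h7.trans ?_
    have h8 : D / (s / r) ^ κ = D * (r / s) ^ κ := by
      rw [← inv_div s r, Real.inv_rpow (by positivity), div_eq_mul_inv]
    rw [h8]
    have := (hψ s hs0).le
    gcongr
    exact le_max_left _ _
  · intro r hr
    have hr0 : 0 < r := by linarith
    -- The largest dilation allowed, c = √r, compares ψ(√r) with ψ(r); since ψ(√r) ≥ ψ(n₀), this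
    -- gives polynomial growth with exponent κ/2.
    have h4 := (hgr r (r ^ (1 / 2 : ℝ)) (h2.trans hr) (Real.one_le_rpow (by linarith) (by norm_num))
      le_rfl).2
    have h5 : r / r ^ (1 / 2 : ℝ) = r ^ (1 / 2 : ℝ) := by
      rw [div_eq_iff (Real.rpow_pos_of_pos hr0 _).ne', ← Real.rpow_add hr0]
      norm_num
    have h6 : n₀ ≤ r ^ (1 / 2 : ℝ) := by
      rw [← Real.sqrt_eq_rpow]
      exact Real.le_sqrt_of_sq_le (h1.trans hr)
    rw [h5, ← Real.rpow_mul hr0.le, show 1 / 2 * κ = κ / 2 by ring] at h4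
    have h7 := (hm _ _ le_rfl h6).trans h4
    have h8 : 0 < r ^ (κ / 2) := Real.rpow_pos_of_pos hr0 _
    rw [div_mul_eq_mul_div, le_div_iff₀ h8] at h7
    rw [div_mul_eq_mul_div, div_le_iff₀ (by linarith)]
    linarith
  · intro r hr
    -- The upper growth bound comes from iterated doubling: k only has to be large enough for
    -- `hupper` to reach `r`.
    obtain ⟨k, hk⟩ := pow_unbounded_of_one_lt (r / r₀) (one_lt_two)
    have h4 : r ≤ r₀ * 2 ^ (k + 1) := by
      rw [div_lt_iff₀ (by linarith)] at hk
      rw [pow_succ]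
      nlinarith
    refine (hupper k r hr h4).trans ?_
    have h5 : r / r₀ ≤ r := div_le_self (by linarith) (by linarith)
    have h6 := hψ (2 * r₀) (by linarith)
    have h7 : 0 ≤ r / r₀ := div_nonneg (by linarith) (by linarith)
    calc ψ (2 * r₀) * (r / r₀) ^ (1 - κ) ≤ ψ (2 * r₀) * r ^ (1 - κ) := by
          gcongr
          linarith
      _ ≤ _ := by
        have : 0 ≤ r ^ (1 - κ) := Real.rpow_nonneg (by linarith) _
        gcongr
        exact le_max_right _ _

section Concentration

variable {Ω : Type*} [MeasurableSpace Ω] {P : Measure Ω} {d : ℕ} [NeZero d] {α : ℝ}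
  {Q : Ω → Set (EuclideanSpace ℝ (Fin d))}
  {q : Ω → EuclideanSpace ℝ (Fin d) → EuclideanSpace ℝ (Fin d)}

/-- The properties of first-passage times that enter the comparison of means: stationarity is
reflected in the fact that the concentration bound `conc` holds for all pairs of points. -/
structure IsConcentratedModel (P : Measure Ω) (α : ℝ) (Q : Ω → Set (EuclideanSpace ℝ (Fin d)))
    (q : Ω → EuclideanSpace ℝ (Fin d) → EuclideanSpace ℝ (Fin d)) (ψ h : ℝ → ℝ)
    (μ κ₁ κ₃ κ a A r₀ : ℝ) : Prop where
  one_lt_α : 1 < α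
  κ₁_pos : 0 < κ₁
  κ₃_pos : 0 < κ₃
  κ₃_lt : κ₃ < 1 / 2
  κ_pos : 0 < κ
  a_pos : 0 < a
  one_le_A : 1 ≤ A
  one_le_r₀ : 1 ≤ r₀
  μ_nonneg : 0 ≤ μ
  scale : IsScale ψ κ₃ a A r₀
  h_nonneg : ∀ r, 0 ≤ h r
  h_add_le : ∀ r s, 0 ≤ r → 0 ≤ s → h (r + s) ≤ h r + h s
  h_lip : ∀ r s, 0 ≤ r → 0 ≤ s → |h r - h s| ≤ A * (1 + |r - s|)
  h_ge : ∀ r, 0 ≤ r → r * μ ≤ h r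
  h_tendsto : Tendsto (fun r => h r / r) atTop (𝓝 μ)
  closest : ∀ᵐ ω ∂P, IsClosestPointMap (Q ω) (q ω)
  dist_tail : ∀ x t, P {ω | t < ‖x - q ω x‖} ≤ ENNReal.ofReal (A * Real.exp (-(a * t)))
  conc : ∀ x y l, r₀ ≤ ‖x - y‖ → 0 ≤ l → l ≤ ‖x - y‖ ^ κ →
    P {ω | l * ψ ‖x - y‖ < |passageTime α (Q ω) (q ω) x y - h ‖x - y‖|} ≤
      ENNReal.ofReal (A * Real.exp (-(a * l ^ κ₁)))

/-- Concentration is assumed only at integers. Replacing `r` by its ceiling changes T by a passage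
time over distance at most one, whose tail is the second term, and the mean by a bounded amount. -/
lemma IsPoissonProcess.measure_abs_axisTime_sub_gt_le [IsProbabilityMeasure P]
    (hQ : IsPoissonProcess P Q) (hα : 1 < α) (hq : ∀ᵐ ω ∂P, IsClosestPointMap (Q ω) (q ω))
    {ψ : ℝ → ℝ} {C₀ C₁ κ₁ κ₂ κ₃ a A r₀ : ℝ} (hC₁ : 0 < C₁)
    (hκ₃ : 0 < κ₃) (hr₀ : 1 ≤ r₀)
    (hconc : Concentration P (axisTime α Q q) ψ C₀ C₁ κ₁ κ₂)
    (hs : IsScale ψ κ₃ a A r₀) {r l : ℝ} (hr : r₀ ≤ r) (hl : 1 ≤ l)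
    (hlC : l / 4 ≤ C₀ * r ^ κ₂) (hC₀ : 0 < C₀) (hκ₂ : 0 < κ₂)
    (hψr : 8 * (Real.exp (unitVolume d / 2) * tailIntegral d α) ≤ ψ r) :
    P {ω | l * ψ r < |axisTime α Q q r ω - meanTime P α Q q r|} ≤
      ENNReal.ofReal (C₁ * Real.exp (-C₀ * (l / 4) ^ κ₁)) +
      ENNReal.ofReal (2 * Real.exp (unitVolume d) *
        Real.exp (-(unitVolume d * (((ψ r / 4) ^ (1 / α) - 1) / 2)))) := by
  have hr1 : 1 ≤ r := hr₀.trans hr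
  have hv := unitVolume_pos d
  have hψ0 := hs.pos r hr
  obtain ⟨n, hn⟩ : ∃ n : ℕ, n = ⌈r⌉₊ := ⟨_, rfl⟩
  have hrn : r ≤ n := hn ▸ Nat.le_ceil r
  have hnr : (n : ℝ) < r + 1 := hn ▸ Nat.ceil_lt_add_one (by linarith)
  have hψn : ψ n ≤ 2 * ψ r := by
    refine (hs.mono n (2 * r) (hr.trans hrn) (by linarith)).trans ((hs.double r hr).trans ?_)
    gcongr
    calc (2 : ℝ) ^ (1 - κ₃) ≤ 2 ^ (1 : ℝ) :=
          Real.rpow_le_rpow_of_exponent_le (by norm_num) (by linarith)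
      _ = 2 := Real.rpow_one 2
  set H := Real.exp (unitVolume d / 2) * tailIntegral d α
  have hH : 0 ≤ H := mul_nonneg (Real.exp_pos _).le (tailIntegral_nonneg d α)
  have hh : |meanTime P α Q q r - meanTime P α Q q n| ≤ 2 * H := by
    refine (hQ.abs_meanTime_sub_le hα hq (by linarith) (by positivity)).trans
      ((hQ.meanTime_le_mul hα hq (abs_nonneg _)).trans ?_)
    have : |r - n| ≤ 1 := by rw [abs_le]; constructor <;> linarith
    nlinarith
  have hsub : P {ω | l * ψ r < |axisTime α Q q r ω - meanTime P α Q q r|} ≤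
      P ({ω | (l / 4) * ψ n < |axisTime α Q q n ω - meanTime P α Q q n|} ∪
        {ω | ψ r / 4 < passageTime α (Q ω) (q ω) (r • axisVector d) ((n : ℝ) • axisVector d)}) := by
    apply measure_mono_ae
    filter_upwards [hq] with ω hω h
    change l * ψ r < |axisTime α Q q r ω - meanTime P α Q q r| at h
    change (l / 4) * ψ n < |axisTime α Q q n ω - meanTime P α Q q n| ∨
      ψ r / 4 < passageTime α (Q ω) (q ω) (r • axisVector d) ((n : ℝ) • axisVector d)
    by_contra! hcon
    obtain ⟨hc1, hc2⟩ := hcon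
    have ht1 := passageTime_triangle (α := α) hω 0 (r • axisVector d) ((n : ℝ) • axisVector d)
    have ht2 := passageTime_triangle (α := α) hω 0 ((n : ℝ) • axisVector d) (r • axisVector d)
    have ht3 : passageTime α (Q ω) (q ω) ((n : ℝ) • axisVector d) (r • axisVector d) =
      passageTime α (Q ω) (q ω) (r • axisVector d) ((n : ℝ) • axisVector d) :=
        pointTime_comm (hω _).1 (hω _).1
    simp only [axisTime_eq] at h hc1
    rw [ht3] at ht2
    have h1 : |passageTime α (Q ω) (q ω) 0 (r • axisVector d) -
        passageTime α (Q ω) (q ω) 0 ((n : ℝ) • axisVector d)| ≤ ψ r / 4 := by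
      rw [abs_le]; constructor <;> linarith
    -- Half of the deviation pays for the fluctuation at the integer; a quarter of ψ(r) each pays
    -- for the short passage time and for the change of the mean.
    have h2 : (l / 4) * ψ n ≤ l * ψ r / 2 := by nlinarith
    have h3 : ψ r ≤ l * ψ r := le_mul_of_one_le_left hψ0.le hl
    rw [abs_le] at h1 hh hc1
    refine absurd h (not_lt.2 ?_)
    rw [abs_le]
    constructor <;> linarith [h1.1, h1.2, hh.1, hh.2, hc1.1, hc1.2]
  refine hsub.trans ((measure_union_le _ _).trans (add_le_add ?_ ?_))
  · have hn1 : 1 ≤ n := by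
      have : (1 : ℝ) ≤ n := hr1.trans hrn
      exact_mod_cast this
    have h1 := hconc n hn1 (l / 4) (by linarith) (hlC.trans (by gcongr))
    exact (ENNReal.le_ofReal_iff_toReal_le (measure_ne_top _ _) (by positivity)).2 h1
  · refine (hQ.measure_passageTime_gt_le hα hq _ _ (by positivity)).trans
      (ENNReal.ofReal_le_ofReal ?_)
    have : ‖r • axisVector d - (n : ℝ) • axisVector d‖ ≤ 1 := by
      rw [norm_smul_axisVector_sub, abs_le]; constructor <;> linarith
    gcongr

/-- For `l ≤ r ^ κ` the power l^κ₁ is at most a power of `r` dominated by ψ(r)^(1/α), so the tail of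
the short passage time is absorbed into the concentration tail. -/
lemma tail_add_tail_le {α κ₁ κ₃ κ C₀ C₁ a a' v A r l z : ℝ} (hκ₁ : 0 < κ₁) (hα : 0 < α)
    (hC₁ : 0 ≤ C₁) (ha3 : a ≤ C₀ * (1 / 4) ^ κ₁) (ha4 : a ≤ v / 2 * (a' / 4) ^ (1 / α))
    (ha' : 0 ≤ a') (hv : 0 ≤ v) (hr : 1 ≤ r) (hl : 1 ≤ l) (hlκ : l ≤ r ^ κ)
    (hκ : κ ≤ κ₃ / (2 * α * κ₁)) (hz : a' * r ^ (κ₃ / 2) ≤ z)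
    (hA : C₁ + 2 * Real.exp v * Real.exp (v / 2) ≤ A) :
    C₁ * Real.exp (-C₀ * (l / 4) ^ κ₁) +
      2 * Real.exp v * Real.exp (-(v * (((z / 4) ^ (1 / α) - 1) / 2))) ≤
      A * Real.exp (-(a * l ^ κ₁)) := by
  have hr0 : 0 < r := by linarith
  have hl0 : 0 < l := by linarith
  have e1 : C₁ * Real.exp (-C₀ * (l / 4) ^ κ₁) ≤ C₁ * Real.exp (-(a * l ^ κ₁)) := by
    have : (l / 4) ^ κ₁ = (1 / 4) ^ κ₁ * l ^ κ₁ := by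
      rw [← Real.mul_rpow (by norm_num) hl0.le]; ring_nf
    rw [this]
    have h5 : 0 ≤ l ^ κ₁ := Real.rpow_nonneg hl0.le _
    gcongr
    nlinarith
  have e2 : a * l ^ κ₁ ≤ v / 2 * (z / 4) ^ (1 / α) := by
    have h1 : l ^ κ₁ ≤ r ^ (κ₃ / (2 * α)) := by
      calc l ^ κ₁ ≤ (r ^ κ) ^ κ₁ := by gcongr
        _ = r ^ (κ * κ₁) := by rw [← Real.rpow_mul hr0.le]
        _ ≤ r ^ (κ₃ / (2 * α * κ₁) * κ₁) :=
          Real.rpow_le_rpow_of_exponent_le hr (by gcongr)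
        _ = _ := by congr 1; field_simp
    have h2 : (a' / 4) ^ (1 / α) * r ^ (κ₃ / (2 * α)) ≤ (z / 4) ^ (1 / α) := by
      have h3 : r ^ (κ₃ / (2 * α)) = (r ^ (κ₃ / 2)) ^ (1 / α) := by
        rw [← Real.rpow_mul hr0.le]
        congr 1
        field_simp
      rw [h3, ← Real.mul_rpow (by positivity) (by positivity)]
      apply Real.rpow_le_rpow (by positivity) _ (by positivity)
      linarith
    have h4 : 0 ≤ r ^ (κ₃ / (2 * α)) := Real.rpow_nonneg hr0.le _
    calc a * l ^ κ₁ ≤ v / 2 * (a' / 4) ^ (1 / α) * r ^ (κ₃ / (2 * α)) := by gcongr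
      _ ≤ _ := by rw [mul_assoc]; gcongr
  have e3 : Real.exp (-(v * (((z / 4) ^ (1 / α) - 1) / 2))) ≤
      Real.exp (v / 2) * Real.exp (-(a * l ^ κ₁)) := by
    rw [← Real.exp_add]
    apply Real.exp_le_exp.2
    linarith
  have hpe := Real.exp_pos (-(a * l ^ κ₁))
  calc _ ≤ C₁ * Real.exp (-(a * l ^ κ₁)) +
        2 * Real.exp v * (Real.exp (v / 2) * Real.exp (-(a * l ^ κ₁))) := by gcongr
    _ = (C₁ + 2 * Real.exp v * Real.exp (v / 2)) * Real.exp (-(a * l ^ κ₁)) := by ring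
    _ ≤ _ := by gcongr

lemma IsPoissonProcess.exists_isConcentratedModel [IsProbabilityMeasure P]
    (hQ : IsPoissonProcess P Q) (hα : 1 < α) (hq : ∀ᵐ ω ∂P, IsClosestPointMap (Q ω) (q ω))
    {ψ : ℝ → ℝ} (hψ : ∀ x : ℝ, 0 < x → 0 < ψ x) {C₀ C₁ κ₁ κ₂ κ₃ : ℝ} (hC₀ : 0 < C₀) (hC₁ : 0 < C₁)
    (hκ₁ : 0 < κ₁) (hκ₂ : 0 < κ₂) (hκ₃ : 0 < κ₃) (hκ₃' : κ₃ < 1 / 2)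
    (hconc : Concentration P (axisTime α Q q) ψ C₀ C₁ κ₁ κ₂) (hgrowth : RegularGrowth ψ κ₃) :
    ∃ μ κ a A r₀, IsConcentratedModel P α Q q ψ (meanTime P α Q q) μ κ₁ κ₃ κ a A r₀ := by
  obtain ⟨a', A', r', ha', hs'⟩ := hgrowth.exists_isScale hψ hκ₃ hκ₃'
  have hv := unitVolume_pos d
  set H := Real.exp (unitVolume d / 2) * tailIntegral d α with hHdef
  have hH : 0 ≤ H := mul_nonneg (Real.exp_pos _).le (tailIntegral_nonneg d α)
  have hlip : ∀ r s, 0 ≤ r → 0 ≤ s →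
      |meanTime P α Q q r - meanTime P α Q q s| ≤ H * (1 + |r - s|) := fun r s hr hs =>
    (hQ.abs_meanTime_sub_le hα hq hr hs).trans (hQ.meanTime_le_mul hα hq (abs_nonneg _))
  obtain ⟨μ, hμ1, hμ0, hμ2⟩ := tendsto_div_of_subadditive_lipschitz hH
    (fun r _ => meanTime_nonneg (P := P) (α := α) (Q := Q) (q := q) r)
    (fun r s hr hs => hQ.meanTime_subadditive hα hq hr hs) hlip
  -- The first entry keeps `l / 4` in the range of the concentration hypothesis; the second is what
  -- the absorption of the short passage time's tail requires.
  set κ := min (κ₂ / 2) (κ₃ / (2 * α * κ₁)) with hκdef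
  have hκ : 0 < κ := lt_min (by positivity) (by positivity)
  set c := (a' / 4) ^ (1 / α) with hc
  have hc0 : 0 < c := by positivity
  set a := min a' (min (unitVolume d) (min (C₀ * (1 / 4) ^ κ₁) (unitVolume d / 2 * c))) with ha
  have ha0 : 0 < a := by
    refine lt_min ha' (lt_min hv (lt_min (by positivity) (by positivity)))
  have ha1 : a ≤ a' := min_le_left _ _
  have ha2 : a ≤ unitVolume d := (min_le_right _ _).trans (min_le_left _ _)
  have ha3 : a ≤ C₀ * (1 / 4) ^ κ₁ :=
    (min_le_right _ _).trans ((min_le_right _ _).trans (min_le_left _ _))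
  have ha4 : a ≤ unitVolume d / 2 * c :=
    (min_le_right _ _).trans ((min_le_right _ _).trans (min_le_right _ _))
  obtain ⟨N, hN⟩ := eventually_atTop.1
    (((tendsto_rpow_atTop (by positivity : 0 < κ₂ / 2)).const_mul_atTop
        (by positivity : 0 < 4 * C₀)).eventually_ge_atTop 1 |>.and
      (((tendsto_rpow_atTop (by positivity : 0 < κ₃ / 2)).const_mul_atTop ha').eventually_ge_atTop
        (8 * H)))
  set r₀ := max r' (max 1 N) with hr₀
  have hr1 : r' ≤ r₀ := le_max_left _ _
  have hr2 : 1 ≤ r₀ := (le_max_left _ _).trans (le_max_right _ _)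
  have hr3 : N ≤ r₀ := (le_max_right _ _).trans (le_max_right _ _)
  set v := unitVolume d with hvdef
  set A := max A' (1 + H + Real.exp v + Real.exp a + (C₁ + 2 * Real.exp v * Real.exp (v / 2))) with hA
  have hAsum : 1 + H + Real.exp v + Real.exp a + (C₁ + 2 * Real.exp v * Real.exp (v / 2)) ≤ A :=
    le_max_right _ _
  have hp1 := Real.exp_pos v
  have hp2 := Real.exp_pos a
  have hp3 : 0 < 2 * Real.exp v * Real.exp (v / 2) := by positivity
  have hA1 : 1 ≤ A := by linarith
  have hs := hs'.weaken (a' := a') (A' := A) le_rfl (le_max_left _ _) hr1 (by linarith)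
  refine ⟨μ, κ, a, A, r₀, hα, hκ₁, hκ₃, hκ₃', hκ, ha0, hA1, hr2, hμ0,
    hs.weaken ha1 le_rfl le_rfl (by linarith), meanTime_nonneg,
    fun r s hr hs => hQ.meanTime_subadditive hα hq hr hs, fun r s hr hs => ?_, hμ2, hμ1, hq, ?_, ?_⟩
  · refine (hlip r s hr hs).trans ?_
    gcongr
    linarith
  · intro x t
    rcases lt_or_ge t 0 with ht | ht
    · refine prob_le_one.trans ?_
      rw [ENNReal.one_le_ofReal]
      have : 1 ≤ Real.exp (-(a * t)) := Real.one_le_exp_iff.2 (by nlinarith)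
      nlinarith
    refine (hQ.measure_dist_gt_le hq x t).trans (ENNReal.ofReal_le_ofReal ?_)
    gcongr
    linarith
  · intro x y l hr hl hlκ
    have hid := (hQ.identDistrib_axisTime hα hq x y).measure_mem_eq
      (s := {t | l * ψ ‖x - y‖ < |t - meanTime P α Q q ‖x - y‖|})
      (measurableSet_lt measurable_const (measurable_id.sub_const _).abs)
    change P {ω | _} = P {ω | _} at hid
    simp only [Set.mem_ofPred_eq] at hid
    rw [hid]
    generalize ‖x - y‖ = r at *
    -- For l ≤ 1 the bound is at least one, because exp(a) is part of the constant `A`.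
    rcases le_or_gt l 1 with hl1 | hl1
    · refine prob_le_one.trans ?_
      rw [ENNReal.one_le_ofReal]
      have h1 : l ^ κ₁ ≤ 1 := Real.rpow_le_one hl hl1 hκ₁.le
      have h2 : Real.exp (-a) ≤ Real.exp (-(a * l ^ κ₁)) := Real.exp_le_exp.2 (by nlinarith)
      calc (1 : ℝ) = Real.exp a * Real.exp (-a) := by rw [← Real.exp_add]; simp
        _ ≤ A * Real.exp (-(a * l ^ κ₁)) := by
          gcongr
          linarith
    have hrr : 1 ≤ r := hr2.trans hr
    have hr0 : 0 < r := by linarith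
    obtain ⟨hN1, hN2⟩ := hN r (hr3.trans hr)
    have hlC : l / 4 ≤ C₀ * r ^ κ₂ := by
      have h1 : r ^ κ ≤ r ^ (κ₂ / 2) := Real.rpow_le_rpow_of_exponent_le hrr (min_le_left _ _)
      have h2 : r ^ κ₂ = r ^ (κ₂ / 2) * r ^ (κ₂ / 2) := by
        rw [← Real.rpow_add hr0]; ring_nf
      rw [h2]
      have h3 : 0 < r ^ (κ₂ / 2) := Real.rpow_pos_of_pos hr0 _
      nlinarith
    have hψr : 8 * H ≤ ψ r := hN2.trans (hs.lower r hr)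
    refine (hQ.measure_abs_axisTime_sub_gt_le hα hq hC₁ hκ₃ hr2 hconc hs hr hl1.le hlC hC₀ hκ₂
      hψr).trans ?_
    rw [← ENNReal.ofReal_add (by positivity) (by positivity)]
    apply ENNReal.ofReal_le_ofReal
    exact tail_add_tail_le hκ₁ (by linarith) hC₁.le ha3 ha4 ha'.le hv.le hrr hl1.le hlκ
      (min_le_right _ _) (hs.lower r hr) (by linarith)

end Concentration

end EuclideanFPP

namespace EuclideanFPP

/-! ### Lattices with summable logarithmic weights, and weighted union bounds. -/

section Lattice

variable {d : ℕ} [NeZero d]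

/-- The points of a cubic lattice of which every point of space is at distance at most `ε`. -/
noncomputable def latticePoint (ε : ℝ) (v : Fin d → ℤ) : EuclideanSpace ℝ (Fin d) :=
  (ε / d) • WithLp.toLp 2 fun i => (v i : ℝ)

/-- With spacing ε/d, rounding down moves each coordinate by at most ε/d, hence the point by at most
ε/√d ≤ ε. -/
lemma exists_latticePoint_near {ε : ℝ} (hε : 0 < ε) (x : EuclideanSpace ℝ (Fin d)) :
    ∃ v, ‖x - latticePoint ε v‖ ≤ ε := by
  have hd : (0 : ℝ) < d := by exact_mod_cast Nat.pos_of_ne_zero (NeZero.ne d)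
  have hd1 : (1 : ℝ) ≤ d := by exact_mod_cast Nat.one_le_iff_ne_zero.2 (NeZero.ne d)
  refine ⟨fun i => ⌊x i / (ε / d)⌋, ?_⟩
  rw [EuclideanSpace.norm_eq]
  apply Real.sqrt_le_iff.2 ⟨hε.le, ?_⟩
  have h : ∀ i, ‖(x - latticePoint ε fun i => ⌊x i / (ε / d)⌋) i‖ ^ 2 ≤ (ε / d) ^ 2 := by
    intro i
    have e : (x - latticePoint ε fun i => ⌊x i / (ε / d)⌋) i =
        x i - (ε / d) * (⌊x i / (ε / d)⌋ : ℝ) := by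
      simp [latticePoint]
    have h1 := Int.floor_le (x i / (ε / d))
    have h2 := Int.lt_floor_add_one (x i / (ε / d))
    have h3 : 0 < ε / d := by positivity
    rw [le_div_iff₀ h3] at h1
    rw [div_lt_iff₀ h3] at h2
    rw [e, Real.norm_eq_abs, abs_of_nonneg (by linarith)]
    apply pow_le_pow_left₀ (by linarith)
    linarith
  refine (Finset.sum_le_sum fun i _ => h i).trans ?_
  rw [Finset.sum_const, Finset.card_univ, Fintype.card_fin, nsmul_eq_mul]
  have : (d : ℝ) * (ε / d) ^ 2 = ε ^ 2 / d := by field_simp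
  rw [this]
  exact div_le_self (by positivity) hd1

lemma norm_le_norm_latticePoint {ε : ℝ} (hε : 0 < ε) (v : Fin d → ℤ) :
    ‖v‖ ≤ d / ε * ‖latticePoint ε v‖ := by
  have hd : (0 : ℝ) < d := by exact_mod_cast Nat.pos_of_ne_zero (NeZero.ne d)
  rw [pi_norm_le_iff_of_nonneg (by positivity)]
  intro i
  have h := PiLp.norm_apply_le (latticePoint ε v) i
  have e : (latticePoint ε v) i = ε / d * (v i : ℝ) := by simp [latticePoint]
  rw [e, norm_mul, Real.norm_of_nonneg (by positivity : 0 ≤ ε / d)] at h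
  rw [Int.norm_eq_abs, ← Real.norm_eq_abs]
  calc ‖(v i : ℝ)‖ = d / ε * (ε / d * ‖(v i : ℝ)‖) := by field_simp
    _ ≤ _ := by gcongr

/-- A logarithmic weight on lattice indices. -/
noncomputable def latticeWeight (v : Fin d → ℤ) : ℝ := 2 * d * Real.log (2 + ‖v‖)

omit [NeZero d] in
lemma latticeWeight_nonneg (v : Fin d → ℤ) : 0 ≤ latticeWeight v := by
  have : 0 ≤ Real.log (2 + ‖v‖) := Real.log_nonneg (by linarith [norm_nonneg v])
  unfold latticeWeight
  positivity

omit [NeZero d] in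
-- The exponential is (2 + ‖v‖)^(-2d) for the sup norm, at most the product over the coordinates of
-- (2 + |vᵢ|)^(-2).
lemma summable_exp_neg_latticeWeight : Summable fun v : Fin d → ℤ => Real.exp (-latticeWeight v) := by
  have h1 : Summable fun k : ℤ => ((2 + |(k : ℝ)|) ^ 2)⁻¹ := by
    have h : Summable fun k : ℤ => |(k : ℝ)| ^ (-(2 : ℝ)) :=
      Real.summable_abs_int_rpow (by norm_num : (1 : ℝ) < 2)
    refine Summable.of_norm_bounded_eventually h ?_
    filter_upwards [(Set.finite_singleton (0 : ℤ)).compl_mem_cofinite] with k hk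
    have hk' : 0 < |(k : ℝ)| := by
      rw [abs_pos]
      exact_mod_cast hk
    rw [Real.norm_of_nonneg (by positivity), Real.rpow_neg hk'.le]
    gcongr
    norm_cast
    gcongr
    linarith [abs_nonneg k]
  have h2 : ∀ v : Fin d → ℤ, Real.exp (-latticeWeight v) ≤ ∏ i, ((2 + |(v i : ℝ)|) ^ 2)⁻¹ := by
    intro v
    have hpos : 0 < 2 + ‖v‖ := by linarith [norm_nonneg v]
    have e : Real.exp (-latticeWeight v) = ∏ _i : Fin d, ((2 + ‖v‖) ^ 2)⁻¹ := by
      rw [Finset.prod_const, Finset.card_univ, Fintype.card_fin, inv_pow, ← pow_mul, Real.exp_neg,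
        latticeWeight, ← Real.exp_log (pow_pos hpos (2 * d)), Real.log_pow]
      push_cast
      rfl
    rw [e]
    apply Finset.prod_le_prod
    · intro i _
      positivity
    · intro i _
      have := norm_le_pi_norm v i
      rw [Int.norm_eq_abs] at this
      gcongr
  refine summable_of_sum_le (c := ∏ _i : Fin d, ∑' k : ℤ, ((2 + |(k : ℝ)|) ^ 2)⁻¹)
    (fun v => (Real.exp_pos _).le) fun s => ?_
  classical
  calc ∑ v ∈ s, Real.exp (-latticeWeight v) ≤ ∑ v ∈ s, ∏ i, ((2 + |(v i : ℝ)|) ^ 2)⁻¹ :=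
        Finset.sum_le_sum fun v _ => h2 v
    _ ≤ ∑ v ∈ Fintype.piFinset fun i => (s.image fun v : Fin d → ℤ => v i : Finset ℤ),
          ∏ i, ((2 + |(v i : ℝ)|) ^ 2)⁻¹ := by
        apply Finset.sum_le_sum_of_subset_of_nonneg
        · intro v hv
          rw [Fintype.mem_piFinset]
          exact fun i => Finset.mem_image_of_mem (fun v : Fin d → ℤ => v i) hv
        · intro v _ _
          positivity
    _ = ∏ i, ∑ k ∈ (s.image fun v : Fin d → ℤ => v i : Finset ℤ), ((2 + |(k : ℝ)|) ^ 2)⁻¹ :=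
        (Finset.prod_univ_sum (fun i => s.image fun v => v i)
          fun _ (k : ℤ) => ((2 + |(k : ℝ)|) ^ 2)⁻¹).symm
    _ ≤ _ := by
        apply Finset.prod_le_prod
        · intro i _
          positivity
        · intro i _
          exact h1.sum_le_tsum _ fun k _ => by positivity

lemma latticeWeight_le_log {ε R : ℝ} (hε : 0 < ε) (hR : 0 ≤ R) {v : Fin d → ℤ}
    (hv : ‖latticePoint ε v‖ ≤ ε * R) :
    latticeWeight v ≤ 2 * d * (Real.log (2 + d) + Real.log (2 + R)) := by
  have hd : (0 : ℝ) < d := by exact_mod_cast Nat.pos_of_ne_zero (NeZero.ne d)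
  unfold latticeWeight
  rw [← Real.log_mul (by positivity) (by positivity)]
  have h : ‖v‖ ≤ d * R := by
    refine (norm_le_norm_latticePoint hε v).trans ?_
    calc d / ε * ‖latticePoint ε v‖ ≤ d / ε * (ε * R) := by gcongr
      _ = d * R := by field_simp
  gcongr
  nlinarith

/-- The sum of the weights `exp (-latticeWeight v)`. -/
noncomputable def latticeSum (d : ℕ) : ℝ := ∑' v : Fin d → ℤ, Real.exp (-latticeWeight v)

end Lattice

section Union

variable {Ω : Type*} [MeasurableSpace Ω] {P : Measure Ω} {d : ℕ} [NeZero d] {α : ℝ}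
  {Q : Ω → Set (EuclideanSpace ℝ (Fin d))}
  {q : Ω → EuclideanSpace ℝ (Fin d) → EuclideanSpace ℝ (Fin d)} {ψ h : ℝ → ℝ}
  {μ κ₁ κ₃ κ a A r₀ : ℝ}

omit [NeZero d] in
lemma measure_exists_le_tsum {ι : Type*} [Countable ι] {p : ι → Ω → Prop} {b : ι → ℝ}
    (hb : ∀ i, 0 ≤ b i) (hs : Summable b) (h : ∀ i, P {ω | p i ω} ≤ ENNReal.ofReal (b i)) :
    P {ω | ∃ i, p i ω} ≤ ENNReal.ofReal (∑' i, b i) := by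
  have e : {ω | ∃ i, p i ω} = ⋃ i, {ω | p i ω} := by
    ext ω
    simp
  rw [e, ENNReal.ofReal_tsum_of_nonneg hb hs]
  exact (measure_iUnion_le _).trans (ENNReal.tsum_le_tsum h)

/-- The deviation that is exceeded with probability of order `exp (-b)`. -/
noncomputable def deviation (a κ₁ b : ℝ) : ℝ := (b / a) ^ (1 / κ₁)

omit [NeZero d] in
-- A union bound with prices: a larger deviation is tolerated at indices of larger weight, so
-- infinitely many pairs can be controlled at once, at a cost depending only on the weight of the
-- pair in question.
lemma IsConcentratedModel.measure_exists_deviation_le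
    (M : IsConcentratedModel P α Q q ψ h μ κ₁ κ₃ κ a A r₀) {ι : Type*} [Countable ι]
    (x y : ι → EuclideanSpace ℝ (Fin d)) {Θ : ι → ℝ} (hΘ : ∀ i, 0 ≤ Θ i)
    (hsum : Summable fun i => Real.exp (-Θ i)) {β : ℝ} (hβ : 0 ≤ β) :
    P {ω | ∃ i, r₀ ≤ ‖x i - y i‖ ∧ deviation a κ₁ (β + Θ i) ≤ ‖x i - y i‖ ^ κ ∧
      deviation a κ₁ (β + Θ i) * ψ ‖x i - y i‖ <
        |passageTime α (Q ω) (q ω) (x i) (y i) - h ‖x i - y i‖|} ≤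
      ENNReal.ofReal (A * Real.exp (-β) * ∑' i, Real.exp (-Θ i)) := by
  have hA := M.one_le_A
  have ha := M.a_pos
  rw [← tsum_mul_left]
  apply measure_exists_le_tsum (fun i => by positivity) (hsum.mul_left _)
  intro i
  by_cases h1 : r₀ ≤ ‖x i - y i‖ ∧ deviation a κ₁ (β + Θ i) ≤ ‖x i - y i‖ ^ κ
  · have h0 : 0 ≤ (β + Θ i) / a := div_nonneg (add_nonneg hβ (hΘ i)) ha.le
    have h2 := M.conc (x i) (y i) (deviation a κ₁ (β + Θ i)) h1.1
      (Real.rpow_nonneg h0 _) h1.2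
    have e : a * deviation a κ₁ (β + Θ i) ^ κ₁ = β + Θ i := by
      rw [deviation, ← Real.rpow_mul h0, one_div_mul_cancel M.κ₁_pos.ne', Real.rpow_one]
      field_simp
    rw [e] at h2
    simp only [h1, true_and]
    refine h2.trans (le_of_eq ?_)
    rw [neg_add, Real.exp_add, mul_assoc]
  · have : {ω | r₀ ≤ ‖x i - y i‖ ∧ deviation a κ₁ (β + Θ i) ≤ ‖x i - y i‖ ^ κ ∧
      deviation a κ₁ (β + Θ i) * ψ ‖x i - y i‖ <
        |passageTime α (Q ω) (q ω) (x i) (y i) - h ‖x i - y i‖|} = ∅ := by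
      ext ω
      simp only [Set.mem_ofPred_eq, Set.mem_empty_iff_false, iff_false]
      exact fun h2 => h1 ⟨h2.1, h2.2.1⟩
    rw [this, measure_empty]
    exact zero_le

omit [NeZero d] in
lemma IsConcentratedModel.measure_exists_hole_le
    (M : IsConcentratedModel P α Q q ψ h μ κ₁ κ₃ κ a A r₀) (t : ℝ) :
    P {ω | ∃ v : Fin d → ℤ, t + latticeWeight v / a < ‖latticePoint 1 v - q ω (latticePoint 1 v)‖} ≤
      ENNReal.ofReal (A * Real.exp (-(a * t)) * latticeSum d) := by
  have hA := M.one_le_A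
  have ha := M.a_pos
  rw [latticeSum, ← tsum_mul_left]
  apply measure_exists_le_tsum (fun i => by positivity) (summable_exp_neg_latticeWeight.mul_left _)
  intro v
  refine (M.dist_tail _ _).trans (le_of_eq ?_)
  rw [mul_assoc A, ← Real.exp_add]
  congr 3
  field_simp
  ring

end Union

end EuclideanFPP

namespace EuclideanFPP

/-! ### Comparison of powers and logarithms for large arguments. -/

section Asymptotics

lemma eventually_mul_rpow_le {a b : ℝ} (hab : a < b) (C : ℝ) {c : ℝ} (hc : 0 < c) :
    ∀ᶠ n : ℝ in atTop, C * n ^ a ≤ c * n ^ b := by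
  have h : Tendsto (fun n : ℝ => n ^ (b - a)) atTop atTop := tendsto_rpow_atTop (by linarith)
  filter_upwards [h.eventually_ge_atTop (C / c), eventually_gt_atTop 0] with n hn h0
  have e : n ^ b = n ^ (b - a) * n ^ a := by rw [← Real.rpow_add h0]; ring_nf
  rw [e]
  have h1 : 0 < n ^ a := Real.rpow_pos_of_pos h0 _
  rw [div_le_iff₀ hc] at hn
  nlinarith

lemma eventually_const_le_rpow {b : ℝ} (hb : 0 < b) (C : ℝ) {c : ℝ} (hc : 0 < c) :
    ∀ᶠ n : ℝ in atTop, C ≤ c * n ^ b := by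
  filter_upwards [eventually_mul_rpow_le hb C hc] with n hn
  simpa using hn

lemma eventually_mul_log_rpow_le {b : ℝ} (hb : 0 < b) (p C : ℝ) {c : ℝ} (hc : 0 < c) :
    ∀ᶠ n : ℝ in atTop, C * Real.log n ^ p ≤ c * n ^ b := by
  have h := (isLittleO_log_rpow_rpow_atTop p hb).bound (c := c / (|C| + 1)) (by positivity)
  filter_upwards [h, eventually_ge_atTop 1] with n hn h1
  have h2 : 0 ≤ Real.log n := Real.log_nonneg h1
  rw [Real.norm_of_nonneg (Real.rpow_nonneg h2 _),
    Real.norm_of_nonneg (Real.rpow_nonneg (by linarith) _)] at hn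
  have h3 : 0 ≤ n ^ b := Real.rpow_nonneg (by linarith) _
  have h4 : 0 ≤ Real.log n ^ p := Real.rpow_nonneg h2 _
  calc C * Real.log n ^ p ≤ (|C| + 1) * Real.log n ^ p := by
        gcongr
        linarith [le_abs_self C]
    _ ≤ (|C| + 1) * (c / (|C| + 1) * n ^ b) := by gcongr
    _ = _ := by field_simp

lemma eventually_mul_log_le {b : ℝ} (hb : 0 < b) (C : ℝ) {c : ℝ} (hc : 0 < c) :
    ∀ᶠ n : ℝ in atTop, C * Real.log n ≤ c * n ^ b := by
  simpa using eventually_mul_log_rpow_le hb 1 C hc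

lemma eventually_log_add_mul_le (c k : ℝ) (hk : 0 < k) :
    ∀ᶠ n : ℝ in atTop, Real.log (c + k * n) ≤ 2 * Real.log n := by
  filter_upwards [eventually_ge_atTop (k + 1), eventually_ge_atTop (c + 0), eventually_gt_atTop 1,
    eventually_ge_atTop (-c / k + 1)]
    with n h1 h2 h3 h4
  have h5 : 0 < c + k * n := by
    have : -c / k < n := by linarith
    rw [div_lt_iff₀ hk] at this
    linarith
  rw [← Real.log_rpow (by linarith)]
  apply Real.log_le_log h5
  norm_cast
  nlinarith

end Asymptotics

/-! ### Splitting an almost optimal path at two spheres. -/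

section Crossing

variable {Ω : Type*} [MeasurableSpace Ω] {P : Measure Ω} {d : ℕ} [NeZero d] {α : ℝ}
  {Q : Ω → Set (EuclideanSpace ℝ (Fin d))}
  {q : Ω → EuclideanSpace ℝ (Fin d) → EuclideanSpace ℝ (Fin d)} {ψ h : ℝ → ℝ}
  {μ κ₁ κ₃ κ a A r₀ : ℝ}

/-- A bound for the distance to the configuration at all points of a ball of radius `4 * n`. -/
noncomputable def holeRadius (κ₃ α n : ℝ) : ℝ := n ^ (κ₃ / (4 * α))

omit [NeZero d] in
lemma IsConcentratedModel.holeExponent_pos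
    (M : IsConcentratedModel P α Q q ψ h μ κ₁ κ₃ κ a A r₀) : 0 < κ₃ / (4 * α) := by
  have h1 := M.one_lt_α
  have h2 := M.κ₃_pos
  positivity

omit [NeZero d] in
lemma IsConcentratedModel.eventually_holeRadius
    (M : IsConcentratedModel P α Q q ψ h μ κ₁ κ₃ κ a A r₀) (C : ℝ) : ∀ᶠ n : ℝ in atTop,
      1 ≤ holeRadius κ₃ α n ∧ C * holeRadius κ₃ α n ≤ n ∧ C * holeRadius κ₃ α n ≤ ψ n ∧
      (2 * holeRadius κ₃ α n) ^ α ≤ ψ n := by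
  have h1 := M.one_lt_α
  have h2 := M.κ₃_pos
  have h3 := M.κ₃_lt
  have h4 : κ₃ / (4 * α) < κ₃ / 2 := by
    apply div_lt_div_of_pos_left h2 (by norm_num)
    linarith
  have h5 : κ₃ / 4 < κ₃ / 2 := by linarith
  filter_upwards [eventually_const_le_rpow M.holeExponent_pos 1 one_pos,
    eventually_mul_rpow_le (by linarith : κ₃ / (4 * α) < 1) C one_pos,
    eventually_mul_rpow_le h4 C M.a_pos, eventually_mul_rpow_le h5 (2 ^ α) M.a_pos,
    eventually_ge_atTop r₀, eventually_gt_atTop 0] with n e1 e2 e3 e4 e5 e6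
  have hl := M.scale.lower n e5
  refine ⟨by simpa [holeRadius] using e1, by simpa [holeRadius] using e2, e3.trans hl, ?_⟩
  rw [holeRadius, Real.mul_rpow (by norm_num) (by positivity), ← Real.rpow_mul e6.le]
  have : κ₃ / (4 * α) * α = κ₃ / 4 := by field_simp
  rw [this]
  exact e4.trans hl

/-- The configuration has no large holes in the ball of radius `4 * n`. -/
def NoHole (κ₃ α : ℝ) (S : Set (EuclideanSpace ℝ (Fin d)))
    (q : EuclideanSpace ℝ (Fin d) → EuclideanSpace ℝ (Fin d)) (n : ℝ) : Prop :=
  IsClosestPointMap S q ∧ ∀ x, ‖x‖ ≤ 4 * n → ‖x - q x‖ ≤ holeRadius κ₃ α n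

/-- The distance to the configuration is controlled on the unit lattice. One half of the radius
makes the probability small; the other half pays for the logarithmic weights and for passing from a
lattice point to a nearby point. -/
lemma IsConcentratedModel.eventually_noHole
    (M : IsConcentratedModel P α Q q ψ h μ κ₁ κ₃ κ a A r₀) : ∀ᶠ n : ℝ in atTop,
      P {ω | ¬ NoHole κ₃ α (Q ω) (q ω) n} ≤ ENNReal.ofReal (1 / 8) := by
  have ha := M.a_pos
  have hA := M.one_le_A
  have hd : (0 : ℝ) < d := by exact_mod_cast Nat.pos_of_ne_zero (NeZero.ne d)
  have hε := M.holeExponent_pos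
  have hlim : Tendsto (fun n : ℝ => A * Real.exp (-(a / 2 * n ^ (κ₃ / (4 * α)))) * latticeSum d)
      atTop (𝓝 (A * 0 * latticeSum d)) := by
    refine Tendsto.mul_const _ (Tendsto.const_mul _ ?_)
    exact Real.tendsto_exp_neg_atTop_nhds_zero.comp
      ((tendsto_rpow_atTop hε).const_mul_atTop (by positivity))
  rw [mul_zero, zero_mul] at hlim
  filter_upwards [hlim.eventually_le_const (by norm_num : (0 : ℝ) < 1 / 8),
    eventually_mul_log_le hε (2 * d / a * 2) (by norm_num : (0 : ℝ) < 1 / 4),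
    eventually_const_le_rpow hε (1 + 2 * d / a * Real.log (2 + d)) (by norm_num : (0 : ℝ) < 1 / 4),
    eventually_log_add_mul_le 3 4 (by norm_num), eventually_ge_atTop 0] with n e1 e2 e3 e4 e5
  refine le_trans ?_ (ENNReal.ofReal_le_ofReal e1)
  have e : a / 2 * n ^ (κ₃ / (4 * α)) = a * (n ^ (κ₃ / (4 * α)) / 2) := by ring
  rw [e]
  refine le_trans (measure_mono_ae ?_) (M.measure_exists_hole_le _)
  filter_upwards [M.closest] with ω hω hnot
  change ¬ NoHole κ₃ α (Q ω) (q ω) n at hnot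
  change ∃ v : Fin d → ℤ, _
  by_contra! hcon
  refine hnot ⟨hω, fun x hx => ?_⟩
  obtain ⟨v, hv⟩ := exists_latticePoint_near one_pos x
  have h1 := hcon v
  have h2 : ‖latticePoint 1 v‖ ≤ 1 * (1 + 4 * n) := by
    have := norm_le_insert' (latticePoint 1 v) x
    rw [norm_sub_rev] at this
    linarith
  have h3 := latticeWeight_le_log one_pos (by linarith) h2
  have h4 : Real.log (2 + (1 + 4 * n)) ≤ 2 * Real.log n := by
    convert e4 using 2; ring
  have h5 : ‖x - q ω x‖ ≤ ‖x - q ω (latticePoint 1 v)‖ := (hω x).2 _ (hω _).1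
  have h6 := norm_sub_le_norm_sub_add_norm_sub x (latticePoint 1 v) (q ω (latticePoint 1 v))
  have h7 : latticeWeight v / a ≤ 2 * d / a * (Real.log (2 + d) + 2 * Real.log n) := by
    rw [div_mul_eq_mul_div]
    gcongr
    refine h3.trans ?_
    gcongr
  unfold holeRadius
  linarith

omit [NeZero d] in
-- The second sphere is crossed by the reversed path from `y` back to `c`. If `c` already lies
-- inside the second ball, it is near both spheres, because the centres are at least 2n apart, and
-- `c' = c` works.
lemma exists_two_crossings {S : Set (EuclideanSpace ℝ (Fin d))} (hα : 1 ≤ α)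
    {x y o₁ o₂ : EuclideanSpace ℝ (Fin d)} {n s : ℝ} (hs : 0 ≤ s)
    (hcov₁ : ∀ z, ‖z - o₁‖ = n → ∃ w ∈ S, ‖z - w‖ ≤ s)
    (hcov₂ : ∀ z, ‖z - o₂‖ = n → ∃ w ∈ S, ‖z - w‖ ≤ s) (hx : x ∈ S) (hy : y ∈ S)
    (hx1 : ‖x - o₁‖ < n) (hy1 : n ≤ ‖y - o₁‖) (hy2 : ‖y - o₂‖ < n) (ho : 2 * n ≤ ‖o₁ - o₂‖)
    {η : ℝ} (hη : 0 < η) :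
    ∃ c ∈ S, ∃ c' ∈ S, |‖c - o₁‖ - n| ≤ s ∧ |‖c' - o₂‖ - n| ≤ s ∧
      pointTime α S x c + pointTime α S c c' + pointTime α S c' y ≤
        pointTime α S x y + 2 * (2 * s) ^ α + 2 * η := by
  have h2s : 0 ≤ (2 * s) ^ α := Real.rpow_nonneg (by linarith) _
  obtain ⟨c, hc, hcn, hle⟩ := exists_crossing hα hs hcov₁ hx hy hx1 hy1 hη
  rcases lt_or_ge ‖c - o₂‖ n with h | h
  · refine ⟨c, hc, c, hc, hcn, ?_, ?_⟩
    · have h1 := norm_sub_le_norm_sub_add_norm_sub o₁ c o₂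
      rw [norm_sub_rev o₁ c] at h1
      rw [abs_le] at hcn ⊢
      constructor <;> linarith [hcn.1, hcn.2]
    · rw [pointTime_self_eq_zero hc]
      linarith
  · obtain ⟨c', hc', hcn', hle'⟩ := exists_crossing hα hs hcov₂ hy hc hy2 h hη
    refine ⟨c, hc, c', hc', hcn, hcn', ?_⟩
    rw [pointTime_comm hy hc', pointTime_comm hc' hc, pointTime_comm hy hc] at hle'
    linarith

/-- The exceptional set `B` is left free, so that the failure of any lower bound on passage times
with probability at most one half can be excluded by the same ω. -/
lemma IsConcentratedModel.eventually_exists_crossing [IsProbabilityMeasure P]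
    (M : IsConcentratedModel P α Q q ψ h μ κ₁ κ₃ κ a A r₀) : ∃ C : ℝ, 0 ≤ C ∧ ∀ᶠ n : ℝ in atTop,
      ∀ B : Set Ω, P B ≤ ENNReal.ofReal (1 / 2) → ∃ ω, ω ∉ B ∧ NoHole κ₃ α (Q ω) (q ω) n ∧
        ∃ c ∈ Q ω, ∃ c' ∈ Q ω, |‖c - 0‖ - n| ≤ holeRadius κ₃ α n ∧
          |‖c' - (2 * n) • axisVector d‖ - n| ≤ holeRadius κ₃ α n ∧
          pointTime α (Q ω) (q ω 0) c + pointTime α (Q ω) c c' +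
            pointTime α (Q ω) c' (q ω ((2 * n) • axisVector d)) ≤ h (2 * n) + C * ψ n := by
  have ha := M.a_pos
  have hA := M.one_le_A
  have hκ₁ := M.κ₁_pos
  have hκ₃ := M.κ₃_pos
  obtain ⟨l, hl0, hl⟩ : ∃ l : ℝ, 0 ≤ l ∧ A * Real.exp (-(a * l ^ κ₁)) ≤ 1 / 4 := by
    have hlim : Tendsto (fun l : ℝ => A * Real.exp (-(a * l ^ κ₁))) atTop (𝓝 (A * 0)) :=
      Tendsto.const_mul _ (Real.tendsto_exp_neg_atTop_nhds_zero.comp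
        ((tendsto_rpow_atTop hκ₁).const_mul_atTop ha))
    rw [mul_zero] at hlim
    obtain ⟨l, h1, h2⟩ := ((hlim.eventually_le_const (by norm_num : (0 : ℝ) < 1 / 4)).and
      (eventually_ge_atTop 0)).exists
    exact ⟨l, h2, h1⟩
  -- The deviation `l * ψ (2 * n)` contributes 2l; the two detours and the two slacks, each at most
  -- ψ(n), contribute 4.
  refine ⟨2 * l + 4, by positivity, ?_⟩
  filter_upwards [M.eventually_noHole, M.eventually_holeRadius 4, eventually_ge_atTop r₀,
    eventually_const_le_rpow M.κ_pos l one_pos] with n hhole hrad hn hnl B hB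
  obtain ⟨hs1, hs2, hs3, hs4⟩ := hrad
  have hr₀ := M.one_le_r₀
  have hn0 : 0 < n := by linarith
  have hdist : ‖(0 : EuclideanSpace ℝ (Fin d)) - (2 * n) • axisVector d‖ = 2 * n := by
    rw [zero_sub, norm_neg, norm_smul_axisVector (by linarith)]
  have hconc := M.conc 0 ((2 * n) • axisVector d) l (by rw [hdist]; linarith) hl0 (by
    rw [hdist]
    refine (by simpa using hnl : l ≤ n ^ κ).trans ?_
    apply Real.rpow_le_rpow hn0.le (by linarith) M.κ_pos.le)
  rw [hdist] at hconc
  obtain ⟨ω, hω⟩ : ∃ ω, ω ∉ B ∪ {ω | l * ψ (2 * n) <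
      |passageTime α (Q ω) (q ω) 0 ((2 * n) • axisVector d) - h (2 * n)|} ∪
      {ω | ¬ NoHole κ₃ α (Q ω) (q ω) n} := by
    -- The three bad events have total probability at most 1/2 + 1/4 + 1/8 < 1.
    by_contra! hcon
    have h1 := measure_union_le (μ := P) (B ∪ {ω | l * ψ (2 * n) <
      |passageTime α (Q ω) (q ω) 0 ((2 * n) • axisVector d) - h (2 * n)|})
      {ω | ¬ NoHole κ₃ α (Q ω) (q ω) n}
    rw [Set.eq_univ_of_forall hcon, measure_univ] at h1
    have h2 := h1.trans (add_le_add ((measure_union_le _ _).trans (add_le_add hB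
      (hconc.trans (ENNReal.ofReal_le_ofReal hl)))) hhole)
    rw [← ENNReal.ofReal_add (by norm_num) (by norm_num),
      ← ENNReal.ofReal_add (by norm_num) (by norm_num), ENNReal.one_le_ofReal] at h2
    norm_num at h2
  simp only [Set.mem_union, not_or, Set.mem_ofPred_eq, not_lt, not_not] at hω
  obtain ⟨⟨hωB, hωT⟩, hωc, hωh⟩ := hω
  refine ⟨ω, hωB, ⟨hωc, hωh⟩, ?_⟩
  have hnorm2 : ‖(2 * n) • axisVector d‖ = 2 * n := norm_smul_axisVector (by linarith)
  have hx := hωh 0 (by simp; linarith)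
  have hy := hωh ((2 * n) • axisVector d) (by rw [hnorm2]; linarith)
  have hy' : n ≤ ‖q ω ((2 * n) • axisVector d) - 0‖ := by
    rw [sub_zero]
    have := norm_le_insert' ((2 * n) • axisVector d) (q ω ((2 * n) • axisVector d))
    linarith
  obtain ⟨c, hc, c', hc', h1, h2, h3⟩ := exists_two_crossings M.one_lt_α.le
    (S := Q ω) (x := q ω 0) (y := q ω ((2 * n) • axisVector d)) (o₁ := 0)
    (o₂ := (2 * n) • axisVector d) (n := n) (s := holeRadius κ₃ α n) (by linarith)
    (fun z hz => ⟨q ω z, (hωc z).1, hωh z (by rw [sub_zero] at hz; linarith)⟩)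
    (fun z hz => ⟨q ω z, (hωc z).1, hωh z (by
      have := norm_le_insert' z ((2 * n) • axisVector d)
      linarith)⟩) (hωc _).1 (hωc _).1
    (by rw [sub_zero]; rw [zero_sub, norm_neg] at hx; linarith) hy'
    (by rw [norm_sub_rev]; linarith) hdist.ge (M.scale.pos n hn)
  refine ⟨c, hc, c', hc', h1, h2, h3.trans ?_⟩
  have h4 : ψ (2 * n) ≤ 2 * ψ n := by
    refine (M.scale.double n hn).trans ?_
    have := (M.scale.pos n hn).le
    gcongr
    calc (2 : ℝ) ^ (1 - κ₃) ≤ 2 ^ (1 : ℝ) :=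
          Real.rpow_le_rpow_of_exponent_le (by norm_num) (by linarith)
      _ = 2 := Real.rpow_one 2
  have h5 := (abs_le.1 hωT).2
  have h6 : l * ψ (2 * n) ≤ l * (2 * ψ n) := by gcongr
  change pointTime α (Q ω) (q ω 0) (q ω ((2 * n) • axisVector d)) - h (2 * n) ≤ _ at h5
  linarith

end Crossing

end EuclideanFPP

namespace EuclideanFPP

/-! ### The halving argument and slow variation of iterated logarithms. -/

section Iteration

lemma exists_iterate_halving {γ f : ℝ → ℝ} {N θ : ℝ} (hN : 0 < N)
    (hstep : ∀ m, N ≤ m → ∃ m', 3 / 2 * m ≤ m' ∧ m' ≤ 2 * m ∧ γ m ≤ γ m' / 2 + f m)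
    (hf : ∀ m m', N ≤ m → m ≤ m' → m' ≤ 2 * m → f m' ≤ 2 * θ * f m) (hθ : 0 ≤ θ) {m : ℝ}
    (hm : N ≤ m) (k : ℕ) : ∃ m', (3 / 2) ^ k * m ≤ m' ∧ m' ≤ 2 ^ k * m ∧
      f m' ≤ (2 * θ) ^ k * f m ∧ γ m ≤ γ m' / 2 ^ k + (∑ i ∈ Finset.range k, θ ^ i) * f m := by
  induction k with
  | zero => exact ⟨m, by simp⟩
  | succ k ih =>
    obtain ⟨m', h1, h2, h3, h4⟩ := ih
    have hm' : N ≤ m' := by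
      have : (1 : ℝ) ≤ (3 / 2) ^ k := one_le_pow₀ (by norm_num)
      nlinarith
    obtain ⟨m'', h5, h6, h7⟩ := hstep m' hm'
    have h8 := hf m' m'' hm' (by linarith) h6
    refine ⟨m'', ?_, ?_, ?_, ?_⟩
    · rw [pow_succ]; linarith
    · rw [pow_succ]; linarith
    · calc f m'' ≤ 2 * θ * f m' := h8
        _ ≤ 2 * θ * ((2 * θ) ^ k * f m) := by gcongr
        _ = _ := by ring
    · have h9 : γ m' / 2 ^ k ≤ (γ m'' / 2 + (2 * θ) ^ k * f m) / 2 ^ k := by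
        gcongr
        linarith
      have e : (γ m'' / 2 + (2 * θ) ^ k * f m) / 2 ^ k = γ m'' / 2 ^ (k + 1) + θ ^ k * f m := by
        rw [mul_pow, pow_succ]
        field_simp
      rw [Finset.sum_range_succ, add_mul]
      linarith

/-- After k steps the remaining term is γ(m')/2^k with m' ≤ 2^k m, at most m γ(m')/m', which tends
to zero because m' tends to infinity. The accumulated errors are a geometric series of ratio `θ`. -/
lemma le_div_of_halving {γ f : ℝ → ℝ} {N θ : ℝ} (hN : 0 < N) (hθ : 0 ≤ θ) (hθ1 : θ < 1)
    (hγ : Tendsto (fun r => γ r / r) atTop (𝓝 0)) (hf0 : ∀ m, N ≤ m → 0 ≤ f m)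
    (hstep : ∀ m, N ≤ m → ∃ m', 3 / 2 * m ≤ m' ∧ m' ≤ 2 * m ∧ γ m ≤ γ m' / 2 + f m)
    (hf : ∀ m m', N ≤ m → m ≤ m' → m' ≤ 2 * m → f m' ≤ 2 * θ * f m) {m : ℝ} (hm : N ≤ m) :
    γ m ≤ f m / (1 - θ) := by
  have hm0 : 0 < m := by linarith
  refine le_of_forall_pos_le_add fun η hη => ?_
  obtain ⟨R, hR⟩ := eventually_atTop.1
    ((hγ.eventually_lt_const (by positivity : 0 < η / m)).and (eventually_gt_atTop 0))
  obtain ⟨k, hk⟩ := pow_unbounded_of_one_lt (R / m) (by norm_num : (1 : ℝ) < 3 / 2)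
  obtain ⟨m', h1, h2, -, h4⟩ := exists_iterate_halving hN hstep hf hθ hm k
  rw [div_lt_iff₀ hm0] at hk
  obtain ⟨h5, h6⟩ := hR m' (by linarith)
  rw [div_lt_iff₀ h6] at h5
  have h7 : γ m' / 2 ^ k ≤ η := by
    rw [div_le_iff₀ (by positivity)]
    calc γ m' ≤ η / m * m' := h5.le
      _ ≤ η / m * (2 ^ k * m) := by gcongr
      _ = _ := by field_simp
  have h8 : ∑ i ∈ Finset.range k, θ ^ i ≤ (1 - θ)⁻¹ := by
    rw [← tsum_geometric_of_lt_one hθ hθ1]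
    exact (summable_geometric_of_lt_one hθ hθ1).sum_le_tsum _ fun i _ => by positivity
  have h9 := mul_le_mul_of_nonneg_right h8 (hf0 m hm)
  rw [div_eq_inv_mul]
  linarith

lemma tendsto_iterate_log (k : ℕ) : Tendsto (Real.log^[k]) atTop atTop :=
  Real.tendsto_log_atTop.iterate k

lemma eventually_iterate_log_two (k : ℕ) : ∀ᶠ m : ℝ in atTop, ∀ m', m ≤ m' → m' ≤ 2 * m →
    Real.log^[k] m ≤ Real.log^[k] m' ∧ Real.log^[k] m' ≤ 2 * Real.log^[k] m := by
  induction k with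
  | zero => exact Eventually.of_forall fun m m' h1 h2 => ⟨h1, h2⟩
  | succ k ih =>
    filter_upwards [ih, (tendsto_iterate_log k).eventually_ge_atTop 2] with m hm h2 m' h3 h4
    obtain ⟨h5, h6⟩ := hm m' h3 h4
    simp only [Function.iterate_succ_apply']
    refine ⟨Real.log_le_log (by linarith) h5, (Real.log_le_log (by linarith) h6).trans ?_⟩
    rw [Real.log_mul (by norm_num) (by linarith)]
    linarith [Real.log_le_log (by norm_num) h2]

lemma eventually_iterate_log_le {k : ℕ} (hk : 1 ≤ k) {δ : ℝ} (hδ : 1 < δ) :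
    ∀ᶠ m : ℝ in atTop, ∀ m', m ≤ m' → m' ≤ 2 * m → Real.log^[k] m' ≤ δ * Real.log^[k] m := by
  obtain ⟨k, rfl⟩ : ∃ j, k = j + 1 := ⟨k - 1, by omega⟩
  filter_upwards [eventually_iterate_log_two k, (tendsto_iterate_log k).eventually_ge_atTop 1,
    (tendsto_iterate_log (k + 1)).eventually_ge_atTop (Real.log 2 / (δ - 1))] with m hm h2 h7 m' h3 h4
  obtain ⟨h5, h6⟩ := hm m' h3 h4
  simp only [Function.iterate_succ_apply'] at h7 ⊢
  refine (Real.log_le_log (by linarith) h6).trans ?_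
  rw [Real.log_mul (by norm_num) (by linarith)]
  rw [div_le_iff₀ (by linarith)] at h7
  linarith

end Iteration

/-! ### The bound with a single logarithm. -/

section Base

variable {Ω : Type*} [MeasurableSpace Ω] {P : Measure Ω} {d : ℕ} [NeZero d] {α : ℝ}
  {Q : Ω → Set (EuclideanSpace ℝ (Fin d))}
  {q : Ω → EuclideanSpace ℝ (Fin d) → EuclideanSpace ℝ (Fin d)} {ψ h : ℝ → ℝ}
  {μ κ₁ κ₃ κ a A r₀ : ℝ}

omit [NeZero d] in
lemma IsConcentratedModel.scale_two_mul_le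
    (M : IsConcentratedModel P α Q q ψ h μ κ₁ κ₃ κ a A r₀) {r s : ℝ} (hr : r₀ ≤ r) (hs : r₀ ≤ s)
    (hsr : s ≤ 2 * r) : ψ s ≤ 2 * ψ r := by
  refine (M.scale.mono s (2 * r) hs hsr).trans ((M.scale.double r hr).trans ?_)
  have := (M.scale.pos r hr).le
  gcongr
  calc (2 : ℝ) ^ (1 - κ₃) ≤ 2 ^ (1 : ℝ) :=
        Real.rpow_le_rpow_of_exponent_le (by norm_num) (by linarith [M.κ₃_pos])
    _ = 2 := Real.rpow_one 2

omit [NeZero d] in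
-- Doubling multiplies ψ by at most 2^(1-κ₃), while an iterated logarithm grows by a factor as close
-- to one as desired. This leaves room for θ = 2^(-κ₃/2) < 1.
lemma IsConcentratedModel.eventually_le_of_halving
    (M : IsConcentratedModel P α Q q ψ h μ κ₁ κ₃ κ a A r₀) {k : ℕ} (hk : 1 ≤ k) {C : ℝ} (hC : 0 ≤ C)
    (hstep : ∀ᶠ m : ℝ in atTop, ∃ m', 3 / 2 * m ≤ m' ∧ m' ≤ 2 * m ∧
      h m - m * μ ≤ (h m' - m' * μ) / 2 + C * ψ m * Real.log^[k] m ^ (1 / κ₁)) :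
    ∃ D : ℝ, 0 < D ∧ ∀ᶠ m : ℝ in atTop,
      h m - m * μ ≤ D * ψ m * Real.log^[k] m ^ (1 / κ₁) := by
  have hκ₁ := M.κ₁_pos
  have hκ₃ := M.κ₃_pos
  -- Chosen so that δ^(1/κ₁) = 2^(κ₃/2), which uses up half of the gain 2^(-κ₃) in the doubling of
  -- ψ.
  have hδ : (1 : ℝ) < 2 ^ (κ₃ * κ₁ / 2) := Real.one_lt_rpow (by norm_num) (by positivity)
  have hθ : (2 : ℝ) ^ (-(κ₃ / 2)) < 1 := Real.rpow_lt_one_of_one_lt_of_neg (by norm_num) (by linarith)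
  obtain ⟨N, hN⟩ := eventually_atTop.1 (hstep.and ((eventually_iterate_log_le hk hδ).and
    ((eventually_iterate_log_two k).and
      (((tendsto_iterate_log k).eventually_ge_atTop 0).and
        ((eventually_ge_atTop r₀).and (eventually_gt_atTop 0))))))
  have hγ : Tendsto (fun r => (h r - r * μ) / r) atTop (𝓝 0) := by
    have := M.h_tendsto.sub_const μ
    rw [sub_self] at this
    refine this.congr' ?_
    filter_upwards [eventually_gt_atTop 0] with r hr
    field_simp
  have hθ0 : (0 : ℝ) < 2 ^ (-(κ₃ / 2)) := by positivity
  refine ⟨(C + 1) / (1 - 2 ^ (-(κ₃ / 2))), div_pos (by linarith) (by linarith), ?_⟩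
  filter_upwards [eventually_ge_atTop (max N 1)] with m hm
  have hmain := le_div_of_halving (γ := fun r => h r - r * μ)
    (f := fun m => C * ψ m * Real.log^[k] m ^ (1 / κ₁)) (N := max N 1) (θ := 2 ^ (-(κ₃ / 2)))
    (by positivity) hθ0.le hθ hγ
    (fun m hm => by
      obtain ⟨-, -, -, h3, h4, h5⟩ := hN m ((le_max_left _ _).trans hm)
      have := (M.scale.pos m h4).le
      positivity)
    (fun m hm => (hN m ((le_max_left _ _).trans hm)).1)
    (fun m m' hm h1 h2 => by
      obtain ⟨-, h6, h7, h3, h4, h5⟩ := hN m ((le_max_left _ _).trans hm)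
      have h8 := M.scale.double m h4
      have h9 := M.scale.mono m' (2 * m) (h4.trans h1) h2
      have h10 := M.scale.pos m h4
      have h11 := M.scale.pos m' (h4.trans h1)
      have h12 := h6 m' h1 h2
      have h13 : 0 ≤ Real.log^[k] m' := h3.trans (h7 m' h1 h2).1
      have e1 : ((2 : ℝ) ^ (κ₃ * κ₁ / 2)) ^ (1 / κ₁) = 2 ^ (κ₃ / 2) := by
        rw [← Real.rpow_mul (by norm_num)]
        congr 1
        field_simp
      have e2 : (2 : ℝ) ^ (1 - κ₃) * 2 ^ (κ₃ / 2) = 2 * 2 ^ (-(κ₃ / 2)) := by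
        rw [← Real.rpow_add (by norm_num), ← Real.rpow_one_add' (by norm_num)
          (by linarith [M.κ₃_lt])]
        congr 1
        ring
      calc C * ψ m' * Real.log^[k] m' ^ (1 / κ₁)
          ≤ C * (2 ^ (1 - κ₃) * ψ m) * (2 ^ (κ₃ * κ₁ / 2) * Real.log^[k] m) ^ (1 / κ₁) := by
            gcongr
            linarith
        _ = (2 ^ (1 - κ₃) * 2 ^ (κ₃ / 2)) * (C * ψ m * Real.log^[k] m ^ (1 / κ₁)) := by
            rw [Real.mul_rpow (by positivity) h3, e1]
            ring
        _ = _ := by rw [e2])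
    hm
  refine hmain.trans ?_
  obtain ⟨-, -, -, h3, h4, h5⟩ := hN m ((le_max_left _ _).trans hm)
  have h10 := (M.scale.pos m h4).le
  have h11 : 0 ≤ 1 - (2 : ℝ) ^ (-(κ₃ / 2)) := by linarith
  have e : (C + 1) / (1 - (2 : ℝ) ^ (-(κ₃ / 2))) * ψ m * Real.log^[k] m ^ (1 / κ₁) =
    ((C + 1) * ψ m * Real.log^[k] m ^ (1 / κ₁)) / (1 - 2 ^ (-(κ₃ / 2))) := by ring
  rw [e]
  gcongr
  linarith

omit [NeZero d] in
lemma pointTime_le_add_of_near {S : Set (EuclideanSpace ℝ (Fin d))}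
    {q : EuclideanSpace ℝ (Fin d) → EuclideanSpace ℝ (Fin d)} (hα : 0 ≤ α)
    (hq : IsClosestPointMap S q) {c w : EuclideanSpace ℝ (Fin d)} (hc : c ∈ S)
    (hw : ‖c - w‖ ≤ 1) : pointTime α S c (q w) ≤ 2 ^ α := by
  refine (pointTime_le_edge hc (hq w).1).trans (Real.rpow_le_rpow (norm_nonneg _) ?_ hα)
  have h1 := (hq w).2 c hc
  have h2 := norm_sub_le_norm_sub_add_norm_sub c w (q w)
  rw [norm_sub_rev w c] at h1
  linarith

lemma deviation_le {κ₁ a b c : ℝ} (ha : 0 < a) (hκ₁ : 0 < κ₁) (hb : 0 ≤ b) (hbc : b ≤ c) :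
    deviation a κ₁ b ≤ deviation a κ₁ c := by
  unfold deviation
  gcongr

lemma deviation_mul {κ₁ a b c : ℝ} (ha : 0 < a) (hb : 0 ≤ b) (hc : 0 ≤ c) :
    deviation a κ₁ (b * c) = deviation a κ₁ b * c ^ (1 / κ₁) := by
  unfold deviation
  rw [← Real.mul_rpow (by positivity) hc]
  congr 1
  ring

lemma deviation_nonneg {κ₁ a b : ℝ} (ha : 0 < a) (hb : 0 ≤ b) : 0 ≤ deviation a κ₁ b := by
  unfold deviation
  positivity

lemma exists_mul_exp_neg_mul_le (A S : ℝ) {ε : ℝ} (hε : 0 < ε) :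
    ∃ β : ℝ, 0 ≤ β ∧ A * Real.exp (-β) * S ≤ ε := by
  have hlim : Tendsto (fun β : ℝ => A * Real.exp (-β) * S) atTop (𝓝 (A * 0 * S)) :=
    Tendsto.mul_const _ (Tendsto.const_mul _ Real.tendsto_exp_neg_atTop_nhds_zero)
  rw [mul_zero, zero_mul] at hlim
  obtain ⟨β, h1, h2⟩ := ((hlim.eventually_le_const hε).and (eventually_ge_atTop 0)).exists
  exact ⟨β, h2, h1⟩

/-- The point `c` is replaced by a unit lattice point at bounded cost. The relevant lattice points
have weight O(log n), so a deviation of order ψ(n)(log n)^(1/κ₁) is allowed for all of them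
together. -/
lemma IsConcentratedModel.eventually_lower_bound_log
    (M : IsConcentratedModel P α Q q ψ h μ κ₁ κ₃ κ a A r₀) : ∃ C : ℝ, 0 ≤ C ∧ ∀ᶠ n : ℝ in atTop,
      ∀ o : EuclideanSpace ℝ (Fin d), ‖o‖ ≤ 2 * n →
        P {ω | IsClosestPointMap (Q ω) (q ω) ∧ ∃ c ∈ Q ω, |‖c - o‖ - n| ≤ holeRadius κ₃ α n ∧
          pointTime α (Q ω) (q ω o) c < h n - C * ψ n * Real.log n ^ (1 / κ₁)} ≤
        ENNReal.ofReal (1 / 4) := by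
  have ha := M.a_pos
  have hA := M.one_le_A
  have hκ₁ := M.κ₁_pos
  have hd : (0 : ℝ) < d := by exact_mod_cast Nat.pos_of_ne_zero (NeZero.ne d)
  obtain ⟨β, hβ0, hβ⟩ := exists_mul_exp_neg_mul_le A (latticeSum d) (by norm_num : (0 : ℝ) < 1 / 4)
  have hlogd : 0 ≤ Real.log (2 + d) := Real.log_nonneg (by linarith)
  set C₃ := β + 2 * d * (Real.log (2 + d) + 2) with hC₃
  have hC₃0 : 0 ≤ C₃ := by positivity
  have hdev := deviation_nonneg (κ₁ := κ₁) ha hC₃0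
  refine ⟨2 + 2 * deviation a κ₁ C₃, by positivity, ?_⟩
  filter_upwards [M.eventually_holeRadius (3 * A), eventually_ge_atTop (8 * r₀),
    eventually_log_add_mul_le 2 4 (by norm_num),
    eventually_mul_log_rpow_le M.κ_pos (1 / κ₁) (deviation a κ₁ C₃)
      (by positivity : (0 : ℝ) < (1 / 2) ^ κ),
    Real.tendsto_log_atTop.eventually_ge_atTop 1] with n hrad hnr hlog hdl hlog1 o ho
  obtain ⟨hs1, hs2, hs3, hs4⟩ := hrad
  refine le_trans (measure_mono ?_) ((M.measure_exists_deviation_le (fun _ : Fin d → ℤ => o)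
    (fun v => latticePoint 1 v) latticeWeight_nonneg summable_exp_neg_latticeWeight hβ0).trans
    (ENNReal.ofReal_le_ofReal hβ))
  rintro ω ⟨hω, c, hc, hcn, hlt⟩
  have hr₀ := M.one_le_r₀
  set s := holeRadius κ₃ α n with hs
  obtain ⟨v, hv⟩ := exists_latticePoint_near one_pos c
  set w := latticePoint 1 v with hw
  have hsn : s ≤ n / 3 := by nlinarith
  have hr1 : |‖o - w‖ - n| ≤ s + 1 := by
    have h1 := norm_sub_le_norm_sub_add_norm_sub o c w
    have h2 := norm_sub_le_norm_sub_add_norm_sub c w o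
    rw [norm_sub_rev o c] at h1
    rw [norm_sub_rev w o] at h2
    rw [abs_le] at hcn ⊢
    constructor <;> linarith [hcn.1, hcn.2]
  have hr2 : n / 2 ≤ ‖o - w‖ := by linarith [(abs_le.1 hr1).1]
  have hr3 : ‖o - w‖ ≤ 2 * n := by linarith [(abs_le.1 hr1).2]
  have hwn : ‖w‖ ≤ 1 * (4 * n) := by
    have h1 := norm_le_insert' w o
    rw [norm_sub_rev] at h1
    linarith
  have hweight : β + latticeWeight v ≤ C₃ * Real.log n := by
    have h1 := latticeWeight_le_log one_pos (by linarith) hwn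
    have h2 : Real.log (2 + d) + Real.log (2 + 4 * n) ≤ (Real.log (2 + d) + 2) * Real.log n := by
      nlinarith
    have h3 : latticeWeight v ≤ 2 * d * ((Real.log (2 + d) + 2) * Real.log n) :=
      h1.trans (by gcongr)
    rw [hC₃]
    nlinarith
  have hdevle : deviation a κ₁ (β + latticeWeight v) ≤
      deviation a κ₁ C₃ * Real.log n ^ (1 / κ₁) := by
    rw [← deviation_mul ha hC₃0 (by linarith)]
    exact deviation_le ha hκ₁ (add_nonneg hβ0 (latticeWeight_nonneg v)) hweight
  have hn0 : 0 < n := by linarith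
  refine ⟨v, by linarith, ?_, ?_⟩
  · refine hdevle.trans (hdl.trans ?_)
    rw [← Real.mul_rpow (by norm_num) hn0.le]
    apply Real.rpow_le_rpow (by positivity) (by linarith) M.κ_pos.le
  · by_contra! hcon
    have h1 := (abs_le.1 hcon).1
    have h2 : pointTime α (Q ω) (q ω o) (q ω w) ≤
        pointTime α (Q ω) (q ω o) c + pointTime α (Q ω) c (q ω w) :=
      pointTime_triangle (hω o).1 hc (hω w).1
    have h3 := pointTime_le_add_of_near (α := α) (by linarith [M.one_lt_α]) hω hc hv
    have h4 := (abs_le.1 ((M.h_lip ‖o - w‖ n (norm_nonneg _) hn0.le).trans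
      (mul_le_mul_of_nonneg_left (add_le_add_right hr1 1) (by linarith)))).1
    have h5 : ψ ‖o - w‖ ≤ 2 * ψ n := M.scale_two_mul_le (by linarith) (by linarith) hr3
    have hψ := M.scale.pos n (by linarith)
    have h6 : (2 : ℝ) ^ α ≤ ψ n := by
      refine le_trans ?_ hs4
      apply Real.rpow_le_rpow (by norm_num) (by linarith) (by linarith [M.one_lt_α])
    have h7 : A * (1 + (s + 1)) ≤ ψ n := by
      refine le_trans ?_ hs3
      nlinarith
    have h8 : deviation a κ₁ (β + latticeWeight v) * ψ ‖o - w‖ ≤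
        deviation a κ₁ C₃ * Real.log n ^ (1 / κ₁) * (2 * ψ n) := by
      have h9 := (M.scale.pos ‖o - w‖ (by linarith)).le
      have h10 : 0 ≤ Real.log n ^ (1 / κ₁) := by positivity
      gcongr
    have h11 : 1 ≤ Real.log n ^ (1 / κ₁) := Real.one_le_rpow hlog1 (by positivity)
    have h12 : ψ n ≤ ψ n * Real.log n ^ (1 / κ₁) := le_mul_of_one_le_right hψ.le h11
    change -_ ≤ pointTime α (Q ω) (q ω o) (q ω w) - _ at h1
    linarith

/-- Both crossing points obey the lower bound, so 2h(n) is at most h(2n) plus the error; this is a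
halving inequality with m' = 2n. -/
lemma IsConcentratedModel.eventually_le_log [IsProbabilityMeasure P]
    (M : IsConcentratedModel P α Q q ψ h μ κ₁ κ₃ κ a A r₀) :
    ∃ D : ℝ, 0 < D ∧ ∀ᶠ m : ℝ in atTop,
      h m - m * μ ≤ D * ψ m * Real.log m ^ (1 / κ₁) := by
  obtain ⟨C₁, hC₁, h1⟩ := M.eventually_lower_bound_log
  obtain ⟨C₂, hC₂, h2⟩ := M.eventually_exists_crossing
  have hκ₁ := M.κ₁_pos
  refine M.eventually_le_of_halving (k := 1) le_rfl (C := C₁ + C₂) (by positivity) ?_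
  filter_upwards [h1, h2, eventually_ge_atTop r₀,
    Real.tendsto_log_atTop.eventually_ge_atTop 1] with n h1 h2 hn hlog
  have hr₀ := M.one_le_r₀
  have hn0 : 0 < n := by linarith
  obtain ⟨ω, hωB, ⟨hω, -⟩, c, hc, c', hc', hcn, hcn', hle⟩ := h2 _ ((measure_union_le _ _).trans
    ((add_le_add (h1 0 (by simp; linarith)) (h1 ((2 * n) • axisVector d)
      (by rw [norm_smul_axisVector (by linarith)]))).trans (by
        rw [← ENNReal.ofReal_add (by norm_num) (by norm_num)]
        norm_num)))
  simp only [Set.mem_union, not_or, Set.mem_ofPred_eq, not_and, not_exists, not_lt] at hωB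
  have h3 := hωB.1 hω c hc hcn
  have h4 := hωB.2 hω c' hc' hcn'
  rw [pointTime_comm (hω _).1 hc'] at h4
  have h5 : 0 ≤ pointTime α (Q ω) c c' := pointTime_nonneg
  refine ⟨2 * n, by linarith, le_rfl, ?_⟩
  have hψ := M.scale.pos n hn
  have h11 : 1 ≤ Real.log n ^ (1 / κ₁) := Real.one_le_rpow hlog (by positivity)
  have h12 : ψ n ≤ ψ n * Real.log n ^ (1 / κ₁) := le_mul_of_one_le_right hψ.le h11
  simp only [Function.iterate_one]
  nlinarith

end Base

end EuclideanFPP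

namespace EuclideanFPP

/-! ### Paths with short steps in configurations without dense clusters. -/

section ShortSteps

variable {d : ℕ} {α : ℝ} {S : Set (EuclideanSpace ℝ (Fin d))}

/-- Two points of the configuration are joined by a step of length less than `δ`. -/
def ShortStep (S : Set (EuclideanSpace ℝ (Fin d))) (δ : ℝ) (x y : EuclideanSpace ℝ (Fin d)) : Prop :=
  y ∈ S ∧ ‖x - y‖ < δ

lemma exists_mem_annulus {δ : ℝ} {a b : EuclideanSpace ℝ (Fin d)} (ha : a ∈ S) (hδ : 0 < δ)
    (h : Relation.ReflTransGen (ShortStep S δ) a b) (k : ℕ) (hk : k * δ ≤ ‖b - a‖) :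
    ∃ z ∈ S, k * δ ≤ ‖z - a‖ ∧ ‖z - a‖ < (k + 1) * δ := by
  induction h with
  | refl =>
    rw [sub_self, norm_zero] at hk
    refine ⟨a, ha, ?_⟩
    rw [sub_self, norm_zero]
    exact ⟨hk, by positivity⟩
  | @tail b c _ hbc ih =>
    rcases le_or_gt (k * δ) ‖b - a‖ with h1 | h1
    · exact ih h1
    · refine ⟨c, hbc.1, hk, ?_⟩
      have h2 := norm_sub_le_norm_sub_add_norm_sub c b a
      rw [norm_sub_rev c b] at h2
      linarith [hbc.2]

/-- Short steps cannot jump over an annulus of width `δ`. Reaching distance Kδ would therefore give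
K + 1 distinct points, one in each of K + 1 annuli, against the bound on the count. -/
lemma norm_sub_lt_of_shortSteps {δ : ℝ} {K : ℕ} {a b : EuclideanSpace ℝ (Fin d)} (ha : a ∈ S)
    (hδ : 0 < δ) (hK : (S ∩ Metric.ball a ((K + 1) * δ)).encard ≤ K)
    (h : Relation.ReflTransGen (ShortStep S δ) a b) : ‖b - a‖ < K * δ := by
  by_contra! hcon
  have hz : ∀ k : Fin (K + 1), ∃ z ∈ S, (k : ℕ) * δ ≤ ‖z - a‖ ∧ ‖z - a‖ < ((k : ℕ) + 1) * δ := by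
    intro k
    refine exists_mem_annulus ha hδ h k (le_trans ?_ hcon)
    have : ((k : ℕ) : ℝ) ≤ K := by exact_mod_cast Nat.lt_succ_iff.1 k.2
    gcongr
  choose z hzS hz1 hz2 using hz
  have hinj : Function.Injective z := by
    intro i j hij
    have h1 := hz1 i
    have h2 := hz2 i
    rw [hij] at h1 h2
    have h3 : ((i : ℕ) : ℝ) < (j : ℕ) + 1 := lt_of_mul_lt_mul_right (h1.trans_lt (hz2 j)) hδ.le
    have h4 : ((j : ℕ) : ℝ) < (i : ℕ) + 1 := lt_of_mul_lt_mul_right ((hz1 j).trans_lt h2) hδ.le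
    norm_cast at h3 h4
    apply Fin.ext
    omega
  have hsub : Set.range z ⊆ S ∩ Metric.ball a ((K + 1) * δ) := by
    rintro _ ⟨k, rfl⟩
    refine ⟨hzS k, ?_⟩
    rw [Metric.mem_ball, dist_eq_norm]
    refine (hz2 k).trans_le ?_
    have : ((k : ℕ) : ℝ) ≤ K := by exact_mod_cast Nat.lt_succ_iff.1 k.2
    gcongr
  have hcard : (Set.range z).encard = (K + 1 : ℕ) := by
    rw [← Set.image_univ, hinj.encard_image, Set.encard_univ]
    simp
  have := (Set.encard_le_encard hsub).trans hK
  rw [hcard] at this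
  norm_cast at this
  omega

lemma pathTime_init {m : ℕ} (r : Fin (m + 2) → EuclideanSpace ℝ (Fin d)) :
    pathTime α r = pathTime α (Fin.init r) +
      ‖r (Fin.last m).castSucc - r (Fin.last (m + 1))‖ ^ α := by
  unfold pathTime
  rw [Fin.sum_univ_castSucc]
  rfl

/-- The anchor z is the start of the current run of short steps. It moves only when a step of length
l ≥ δ is made, and then by at most Kδ + l ≤ (K + 1) l ≤ (K + 1) δ^(1-α) l^α, which is charged to
that step. -/
lemma exists_anchor (hα : 1 < α) {δ L : ℝ} {K : ℕ} (hδ : 0 < δ) : ∀ (m : ℕ)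
    (r : Fin (m + 1) → EuclideanSpace ℝ (Fin d)), (∀ i, r i ∈ S) →
    (∀ z ∈ S, ‖z - r 0‖ ≤ L → (S ∩ Metric.ball z ((K + 1) * δ)).encard ≤ K) →
    (K + 1) * δ ^ (1 - α) * pathTime α r ≤ L →
    ∃ z ∈ S, Relation.ReflTransGen (ShortStep S δ) z (r (Fin.last m)) ∧
      ‖z - r 0‖ ≤ (K + 1) * δ ^ (1 - α) * pathTime α r
  | 0, r, hr, _, _ => ⟨r 0, hr 0, Relation.ReflTransGen.refl, by simp [pathTime_zero]⟩
  | m + 1, r, hr, hpack, hL => by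
    have hδα : 0 < δ ^ (1 - α) := Real.rpow_pos_of_pos hδ _
    set G := (K + 1) * δ ^ (1 - α) with hG
    have hG0 : 0 < G := by positivity
    set l := ‖r (Fin.last m).castSucc - r (Fin.last (m + 1))‖ with hl
    have hlα : 0 ≤ l ^ α := Real.rpow_nonneg (norm_nonneg _) _
    have hpt := pathTime_init (α := α) r
    rw [← hl] at hpt
    have hle : G * pathTime α (Fin.init r) ≤ G * pathTime α r := by
      rw [hpt]
      gcongr
      linarith
    obtain ⟨z, hz, hzr, hzn⟩ := exists_anchor hα hδ m (Fin.init r) (fun i => hr _) hpack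
      (hle.trans hL)
    have e0 : Fin.init r 0 = r 0 := rfl
    have e1 : Fin.init r (Fin.last m) = r (Fin.last m).castSucc := rfl
    rw [e1] at hzr
    rw [e0] at hzn
    rcases lt_or_ge l δ with h | h
    · exact ⟨z, hz, hzr.tail ⟨hr _, h⟩, hzn.trans hle⟩
    · refine ⟨r (Fin.last (m + 1)), hr _, Relation.ReflTransGen.refl, ?_⟩
      have h1 := norm_sub_lt_of_shortSteps hz hδ (hpack z hz (hzn.trans (hle.trans hL))) hzr
      have h2 := norm_sub_le_norm_sub_add_norm_sub (r (Fin.last (m + 1)))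
        (r (Fin.last m).castSucc) (r 0)
      have h3 := norm_sub_le_norm_sub_add_norm_sub (r (Fin.last m).castSucc) z (r 0)
      rw [norm_sub_rev (r (Fin.last (m + 1))) (r (Fin.last m).castSucc), ← hl] at h2
      have hl0 : 0 < l := by linarith
      have h4 : l ≤ δ ^ (1 - α) * l ^ α := by
        calc l = l ^ (1 - α) * l ^ α := by rw [← Real.rpow_add hl0]; simp
          _ ≤ δ ^ (1 - α) * l ^ α := mul_le_mul_of_nonneg_right
            (Real.rpow_le_rpow_of_nonpos hδ h (by linarith)) hlα
      have h5 : (K : ℝ) * δ ≤ K * l := by gcongr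
      have h6 : (K + 1) * l ≤ G * l ^ α := by
        rw [hG, mul_assoc]
        gcongr
      rw [hpt, mul_add]
      linarith

lemma le_pointTime_of_packing (hα : 1 < α) {δ L : ℝ} {K : ℕ} (hδ : 0 < δ)
    {a b : EuclideanSpace ℝ (Fin d)} (ha : a ∈ S) (hb : b ∈ S)
    (hpack : ∀ z ∈ S, ‖z - a‖ ≤ L → (S ∩ Metric.ball z ((K + 1) * δ)).encard ≤ K) :
    min L (‖b - a‖ - K * δ) ≤ (K + 1) * δ ^ (1 - α) * (pointTime α S a b + 1) := by
  obtain ⟨m, r, h1, rfl, rfl, h4⟩ := exists_pathTime_lt (α := α)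
    (t := pointTime α S a b + 1) ha hb (by linarith)
  have hδα : 0 < δ ^ (1 - α) := Real.rpow_pos_of_pos hδ _
  have h5 : (K + 1) * δ ^ (1 - α) * pathTime α r ≤
      (K + 1) * δ ^ (1 - α) * (pointTime α S (r 0) (r (Fin.last m)) + 1) := by gcongr
  rcases le_or_gt ((K + 1) * δ ^ (1 - α) * pathTime α r) L with h | h
  · obtain ⟨z, hz, hzr, hzn⟩ := exists_anchor hα hδ m r h1 hpack h
    have h6 := norm_sub_lt_of_shortSteps hz hδ (hpack z hz (hzn.trans h)) hzr
    have h7 := norm_sub_le_norm_sub_add_norm_sub (r (Fin.last m)) z (r 0)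
    exact (min_le_right _ _).trans (by linarith)
  · exact (min_le_left _ _).trans (by linarith)

end ShortSteps

/-! ### Positivity of the time constant. -/

section Positivity

variable {Ω : Type*} [MeasurableSpace Ω] {P : Measure Ω} {d : ℕ} [NeZero d] {α : ℝ}
  {Q : Ω → Set (EuclideanSpace ℝ (Fin d))}
  {q : Ω → EuclideanSpace ℝ (Fin d) → EuclideanSpace ℝ (Fin d)} {ψ h : ℝ → ℝ}
  {μ κ₁ κ₃ κ a A r₀ : ℝ}

lemma IsPoissonProcess.measure_exists_packed_le (hQ : IsPoissonProcess P Q) {δ n : ℝ} (hδ : 0 < δ)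
    (hδ1 : δ ≤ 1) (hn : 1 ≤ n) (K : ℕ) :
    P {ω | ∃ z ∈ Q ω, ‖z‖ ≤ 2 * n ∧ ¬ (Q ω ∩ Metric.ball z ((K + 1) * δ)).encard ≤ K} ≤
      ENNReal.ofReal (((2 + d) * (5 * (n / δ))) ^ (2 * d) *
        (((K + 2) * δ) ^ d * unitVolume d) ^ (K + 1) * latticeSum d) := by
  have hv := unitVolume_pos d
  have hd : (0 : ℝ) < d := by exact_mod_cast Nat.pos_of_ne_zero (NeZero.ne d)
  set p := (((K + 2) * δ) ^ d * unitVolume d) ^ (K + 1) with hp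
  have hp0 : 0 ≤ p := by positivity
  have hsub : {ω | ∃ z ∈ Q ω, ‖z‖ ≤ 2 * n ∧ ¬ (Q ω ∩ Metric.ball z ((K + 1) * δ)).encard ≤ K} ⊆
      {ω | ∃ v : Fin d → ℤ, ‖latticePoint δ v‖ ≤ δ * (3 * n / δ) ∧
        ((K + 1 : ℕ) : ℕ∞) ≤ (Q ω ∩ Metric.ball (latticePoint δ v) ((K + 2) * δ)).encard} := by
    rintro ω ⟨z, hz, hzn, hzK⟩
    obtain ⟨v, hv⟩ := exists_latticePoint_near hδ z
    refine ⟨v, ?_, ?_⟩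
    · have := norm_le_insert' (latticePoint δ v) z
      rw [norm_sub_rev] at this
      rw [mul_div_cancel₀ _ hδ.ne']
      linarith
    · have h1 : Q ω ∩ Metric.ball z ((K + 1) * δ) ⊆
          Q ω ∩ Metric.ball (latticePoint δ v) ((K + 2) * δ) := by
        refine Set.inter_subset_inter_right _ (Metric.ball_subset_ball' ?_)
        rw [dist_eq_norm]
        linarith
      refine le_trans ?_ (Set.encard_le_encard h1)
      push_cast
      exact Order.add_one_le_of_lt (not_le.1 hzK)
  refine (measure_mono hsub).trans ?_
  rw [latticeSum, ← tsum_mul_left]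
  refine measure_exists_le_tsum (fun v => by positivity) (summable_exp_neg_latticeWeight.mul_left _)
    fun v => ?_
  by_cases hvn : ‖latticePoint δ v‖ ≤ δ * (3 * n / δ)
  · simp only [hvn, true_and]
    refine (hQ.measure_count_ge_le Metric.isOpen_ball.measurableSet measure_ball_lt_top.ne
      (K + 1)).trans ?_
    rw [volume_ball_eq _ (by positivity), ← ENNReal.ofReal_pow (by positivity), ← hp]
    apply ENNReal.ofReal_le_ofReal
    have h1 := latticeWeight_le_log hδ (by positivity) hvn
    have h2 : 2 + 3 * n / δ ≤ 5 * (n / δ) := by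
      have : 1 ≤ n / δ := by rw [one_le_div hδ]; linarith
      rw [mul_div_assoc]
      linarith
    have h3 : latticeWeight v ≤ Real.log (((2 + d) * (5 * (n / δ))) ^ (2 * d)) := by
      rw [Real.log_pow, Real.log_mul (by positivity) (by positivity)]
      push_cast
      refine h1.trans ?_
      gcongr
    -- The number of relevant lattice points is not counted: the prefactor exceeds the inverse of
    -- every relevant weight, so each term is dominated by a summable one.
    have h4 : 1 ≤ ((2 + d) * (5 * (n / δ))) ^ (2 * d) * Real.exp (-latticeWeight v) := by
      rw [Real.exp_neg, ← div_eq_mul_inv, one_le_div (Real.exp_pos _)]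
      rwa [← Real.le_log_iff_exp_le (by positivity)]
    calc p = 1 * p := (one_mul _).symm
      _ ≤ (((2 + d) * (5 * (n / δ))) ^ (2 * d) * Real.exp (-latticeWeight v)) * p := by gcongr
      _ = _ := by ring
  · have : {ω | ‖latticePoint δ v‖ ≤ δ * (3 * n / δ) ∧ ((K + 1 : ℕ) : ℕ∞) ≤
        (Q ω ∩ Metric.ball (latticePoint δ v) ((K + 2) * δ)).encard} = ∅ := by
      ext ω
      simp only [Set.mem_ofPred_eq, Set.mem_empty_iff_false, iff_false]
      exact fun h2 => hvn h2.1
    rw [this, measure_empty]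
    exact zero_le

lemma IsPoissonProcess.eventually_measure_packed_le (hQ : IsPoissonProcess P Q) {η : ℝ} (hη : 0 < η) :
    ∃ K : ℕ, ∀ᶠ n : ℝ in atTop,
      P {ω | ∃ z ∈ Q ω, ‖z‖ ≤ 2 * n ∧ ¬ (Q ω ∩ Metric.ball z ((K + 1) * n ^ (-η))).encard ≤ K} ≤
        ENNReal.ofReal (1 / 2) := by
  have hv := unitVolume_pos d
  have hd : (0 : ℝ) < d := by exact_mod_cast Nat.pos_of_ne_zero (NeZero.ne d)
  -- Large `K` makes the probability of K + 1 points in one small ball beat the polynomial number of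
  -- balls, which is the negativity of the exponent in `hexp`.
  obtain ⟨K, hK⟩ := exists_nat_gt (2 * (1 + η) / η)
  refine ⟨K, ?_⟩
  set C := ((2 + d : ℝ) * 5) ^ (2 * d) * ((K + 2 : ℝ) ^ d * unitVolume d) ^ (K + 1) * latticeSum d
    with hC
  have hexp : 2 * d * (1 + η) - η * d * (K + 1) < 0 := by
    rw [div_lt_iff₀ hη] at hK
    nlinarith
  filter_upwards [eventually_mul_rpow_le hexp C (by norm_num : (0 : ℝ) < 1 / 2),
    eventually_ge_atTop 1] with n h1 hn
  have hn0 : 0 < n := by linarith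
  refine (hQ.measure_exists_packed_le (by positivity)
    (Real.rpow_le_one_of_one_le_of_nonpos hn (by linarith)) hn K).trans
    (ENNReal.ofReal_le_ofReal ?_)
  rw [Real.rpow_zero, mul_one] at h1
  refine le_trans (le_of_eq ?_) h1
  have e1 : n / n ^ (-η) = n ^ (1 + η) := by
    rw [Real.rpow_neg hn0.le, div_inv_eq_mul, Real.rpow_add hn0, Real.rpow_one]
  have e2 : (n ^ (1 + η)) ^ (2 * d) = n ^ (2 * d * (1 + η)) := by
    rw [← Real.rpow_natCast, ← Real.rpow_mul hn0.le]
    congr 1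
    push_cast
    ring
  have e3 : ((n ^ (-η)) ^ d) ^ (K + 1) = n ^ (-(η * d * (K + 1))) := by
    rw [← pow_mul, ← Real.rpow_natCast, ← Real.rpow_mul hn0.le]
    congr 1
    push_cast
    ring
  have e4 : n ^ (2 * d * (1 + η) - η * d * (K + 1)) =
      n ^ (2 * d * (1 + η)) * n ^ (-(η * d * (K + 1))) := by
    rw [← Real.rpow_add hn0]
    congr 1
  rw [e1, e4, ← e2, ← e3, hC, mul_pow _ (n ^ (-η)) d, ← mul_assoc (2 + d : ℝ),
    mul_pow _ (n ^ (1 + η)), mul_right_comm _ ((n ^ (-η)) ^ d), mul_pow _ ((n ^ (-η)) ^ d)]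
  ring

/-- If μ = 0, then the logarithmic bound makes h(2n) of order n^(1-κ₃/2), so a crossing point at
distance about n is reached at that cost. With δ = n^(-η) the packing bound requires a cost of order
n δ^(α-1) = n^(1-κ₃/4), a contradiction. -/
lemma IsConcentratedModel.μ_pos [IsProbabilityMeasure P] (hQ : IsPoissonProcess P Q)
    (M : IsConcentratedModel P α Q q ψ h μ κ₁ κ₃ κ a A r₀) : 0 < μ := by
  rcases M.μ_nonneg.lt_or_eq with hμ | hμ
  · exact hμ
  exfalso
  subst hμ
  obtain ⟨D, hD, h1⟩ := M.eventually_le_log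
  obtain ⟨C, hC, h2⟩ := M.eventually_exists_crossing
  have hα := M.one_lt_α
  have hκ₃ := M.κ₃_pos
  have hκ₃' := M.κ₃_lt
  have hA := M.one_le_A
  -- The exponent is chosen so that δ^(1-α) = n^(κ₃/4) for δ = n^(-η), half of the available gain
  -- κ₃/2.
  have hη : 0 < κ₃ / (4 * (α - 1)) := div_pos hκ₃ (by linarith)
  obtain ⟨K, h3⟩ := hQ.eventually_measure_packed_le hη
  set η := κ₃ / (4 * (α - 1)) with hηdef
  have hκ₁ := M.κ₁_pos
  have h1' : ∀ᶠ n : ℝ in atTop, h (2 * n) ≤ D * ψ (2 * n) * Real.log (2 * n) ^ (1 / κ₁) := by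
    filter_upwards [(tendsto_id.const_mul_atTop (by norm_num : (0 : ℝ) < 2)).eventually h1] with n hn
    simpa using hn
  have hlog : ∀ᶠ n : ℝ in atTop, D * 2 * A * Real.log (2 * n) ^ (1 / κ₁) ≤
      1 * (2 * n) ^ (κ₃ / 2) :=
    (tendsto_id.const_mul_atTop (by norm_num : (0 : ℝ) < 2)).eventually
      (eventually_mul_log_rpow_le (by positivity : 0 < κ₃ / 2) (1 / κ₁) (D * 2 * A) one_pos)
  obtain ⟨n, h1, h2, h3, hlog, hrad, hn, hn4, hbig, hlogn⟩ := (h1'.and (h2.and (h3.and (hlog.and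
    ((M.eventually_holeRadius 8).and ((eventually_ge_atTop r₀).and
      ((eventually_ge_atTop (8 * (K : ℝ) + 8)).and
        ((eventually_mul_rpow_le (by linarith : 1 - κ₃ / 4 < 1) ((K + 1) * (2 + C * A + 1))
          (by norm_num : (0 : ℝ) < 1 / 4)).and (eventually_ge_atTop 1))))))))).exists
  obtain ⟨hs1, hs2, -, -⟩ := hrad
  have hr₀ := M.one_le_r₀
  have hn0 : 0 < n := by linarith
  obtain ⟨ω, hωB, ⟨hω, hhole⟩, c, hc, c', hc', hcn, -, hle⟩ := h2 _ h3
  simp only [Set.mem_ofPred_eq, not_exists, not_and, not_not] at hωB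
  have hq0 := hhole 0 (by simp; linarith)
  rw [zero_sub, norm_neg] at hq0
  have hδ : 0 < n ^ (-η) := by positivity
  have hδ1 : n ^ (-η) ≤ 1 := Real.rpow_le_one_of_one_le_of_nonpos (by linarith) (by linarith)
  have hkey := le_pointTime_of_packing hα (L := n) hδ (hω 0).1 hc (fun z hz hzn => hωB z hz (by
    have := norm_le_insert' z (q ω 0)
    linarith))
  rw [sub_zero] at hcn
  have hdist : n / 2 ≤ ‖c - q ω 0‖ - K * n ^ (-η) := by
    have h4 := norm_sub_norm_le c (q ω 0)
    have h5 := (abs_le.1 hcn).1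
    have h6 : K * n ^ (-η) ≤ K := mul_le_of_le_one_right (by positivity) hδ1
    linarith
  have hmin : n / 2 ≤ min n (‖c - q ω 0‖ - K * n ^ (-η)) := le_min (by linarith) hdist
  have hT : pointTime α (Q ω) (q ω 0) c ≤ h (2 * n) + C * ψ n := by
    have h4 : 0 ≤ pointTime α (Q ω) c c' := pointTime_nonneg
    have h5 : 0 ≤ pointTime α (Q ω) c' (q ω ((2 * n) • axisVector d)) := pointTime_nonneg
    linarith
  have hh : h (2 * n) ≤ 2 * n ^ (1 - κ₃ / 2) := by
    have h4 := M.scale.upper (2 * n) (by linarith)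
    have h5 : 0 ≤ Real.log (2 * n) ^ (1 / κ₁) :=
      Real.rpow_nonneg (Real.log_nonneg (by linarith)) _
    have h6 : 0 ≤ (2 * n) ^ (1 - κ₃) := by positivity
    have h7 : D * ψ (2 * n) * Real.log (2 * n) ^ (1 / κ₁) ≤
        (2 * n) ^ (1 - κ₃) * (2 * n) ^ (κ₃ / 2) := by
      calc D * ψ (2 * n) * Real.log (2 * n) ^ (1 / κ₁)
          ≤ D * (A * (2 * n) ^ (1 - κ₃)) * Real.log (2 * n) ^ (1 / κ₁) := by gcongr
        _ = (2 * n) ^ (1 - κ₃) * (D * A * Real.log (2 * n) ^ (1 / κ₁)) := by ring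
        _ ≤ (2 * n) ^ (1 - κ₃) * (2 * n) ^ (κ₃ / 2) := by
          gcongr
          nlinarith [mul_nonneg (mul_nonneg hD.le (by linarith : 0 ≤ A)) h5]
    have h8 : (2 * n) ^ (1 - κ₃) * (2 * n) ^ (κ₃ / 2) = (2 * n) ^ (1 - κ₃ / 2) := by
      rw [← Real.rpow_add (by linarith)]
      congr 1
      ring
    have h9 : (2 * n) ^ (1 - κ₃ / 2) ≤ 2 * n ^ (1 - κ₃ / 2) := by
      rw [Real.mul_rpow (by norm_num) hn0.le]
      gcongr
      calc (2 : ℝ) ^ (1 - κ₃ / 2) ≤ 2 ^ (1 : ℝ) :=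
            Real.rpow_le_rpow_of_exponent_le (by norm_num) (by linarith)
        _ = 2 := Real.rpow_one 2
    linarith
  have hψ : ψ n ≤ A * n ^ (1 - κ₃ / 2) := by
    refine (M.scale.upper n hn).trans ?_
    gcongr
    linarith
  have h1n : 1 ≤ n ^ (1 - κ₃ / 2) := Real.one_le_rpow hlogn (by linarith)
  have hT1 : pointTime α (Q ω) (q ω 0) c + 1 ≤ (2 + C * A + 1) * n ^ (1 - κ₃ / 2) := by
    have h4 : C * ψ n ≤ C * (A * n ^ (1 - κ₃ / 2)) := by gcongr
    linarith
  have e1 : (n ^ (-η)) ^ (1 - α) = n ^ (κ₃ / 4) := by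
    rw [← Real.rpow_mul hn0.le]
    congr 1
    have : α - 1 ≠ 0 := by linarith
    rw [hηdef]
    field_simp
    ring
  have e2 : n ^ (κ₃ / 4) * n ^ (1 - κ₃ / 2) = n ^ (1 - κ₃ / 4) := by
    rw [← Real.rpow_add hn0]
    congr 1
    ring
  rw [e1] at hkey
  have h10 : (K + 1) * n ^ (κ₃ / 4) * (pointTime α (Q ω) (q ω 0) c + 1) ≤ 1 / 4 * n := by
    calc _ ≤ (K + 1) * n ^ (κ₃ / 4) * ((2 + C * A + 1) * n ^ (1 - κ₃ / 2)) := by gcongr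
      _ = (K + 1) * (2 + C * A + 1) * (n ^ (κ₃ / 4) * n ^ (1 - κ₃ / 2)) := by ring
      _ ≤ _ := by rw [e2]; simpa using hbig
  linarith

end Positivity

end EuclideanFPP

namespace EuclideanFPP

/-! ### Euclidean estimates for the links of the chains and for the crossing points. -/

section Geometry

variable {d : ℕ}

lemma norm_smul_sub_smul_sq_le (a b : EuclideanSpace ℝ (Fin d)) {A A' : ℝ} (hA : 0 ≤ A)
    (hA' : 0 ≤ A') :
    ‖A • a - A' • b‖ ^ 2 ≤ (‖A • a‖ - ‖A' • b‖) ^ 2 + A * A' * ‖a - b‖ ^ 2 := by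
  have h1 := norm_sub_sq_real (A • a) (A' • b)
  have h2 := norm_sub_sq_real a b
  rw [real_inner_smul_left, real_inner_smul_right] at h1
  rw [norm_smul, norm_smul, Real.norm_of_nonneg hA, Real.norm_of_nonneg hA'] at h1 ⊢
  rw [h1, h2]
  nlinarith [mul_nonneg (mul_nonneg hA hA') (sq_nonneg (‖a‖ - ‖b‖))]

/-- The link is mainly radial, of length of order `G`, with lateral displacement of order `l`. By
Pythagoras the displacement lengthens it only to second order, by O(l²/G). -/
lemma norm_link_bounds {a b : EuclideanSpace ℝ (Fin d)} {A A' n G l : ℝ} (hn : 0 < n)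
    (hG : 0 < G) (hA' : 1 ≤ A') (hA : A ≤ 2) (h1 : G / (2 * n) ≤ A - A') (h2 : A - A' ≤ G / n)
    (ha : n / 4 ≤ ‖a‖) (ha' : ‖a‖ ≤ 5 * n) (hab : ‖a - b‖ ≤ 2 * l) (hl : 128 * l ≤ G) :
    G / 16 ≤ ‖A • a - A' • b‖ ∧ ‖A • a - A' • b‖ ≤ 6 * G ∧
      ‖A • a - A' • b‖ ≤ ‖A • a‖ - ‖A' • b‖ + 128 * (l ^ 2 / G) := by
  have hAA' : A' ≤ A := by
    have : 0 < G / (2 * n) := by positivity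
    linarith
  have hA0 : 0 ≤ A := by linarith
  have hA'0 : 0 ≤ A' := by linarith
  have eA : ‖A • a‖ = A * ‖a‖ := by rw [norm_smul, Real.norm_of_nonneg hA0]
  have eA' : ‖A' • b‖ = A' * ‖b‖ := by rw [norm_smul, Real.norm_of_nonneg hA'0]
  have hl0 : 0 ≤ l := by linarith [norm_nonneg (a - b)]
  have h3 : ‖b‖ ≤ ‖a‖ + 2 * l := by
    have := norm_le_norm_add_norm_sub' b a
    rw [norm_sub_rev] at this
    linarith
  have h4 : G / 8 ≤ (A - A') * ‖a‖ := by
    calc G / 8 = G / (2 * n) * (n / 4) := by field_simp; norm_num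
      _ ≤ _ := by gcongr
  have h5 : (A - A') * ‖a‖ ≤ 5 * G := by
    calc (A - A') * ‖a‖ ≤ G / n * (5 * n) := by gcongr
      _ = _ := by field_simp
  have hΔ : G / 16 ≤ ‖A • a‖ - ‖A' • b‖ := by
    rw [eA, eA']
    nlinarith
  have hR := norm_sub_norm_le (A • a) (A' • b)
  refine ⟨hΔ.trans hR, ?_, ?_⟩
  · have e : A • a - A' • b = (A - A') • a + A' • (a - b) := by module
    rw [e]
    refine (norm_add_le _ _).trans ?_
    rw [norm_smul, norm_smul, Real.norm_of_nonneg (by linarith), Real.norm_of_nonneg hA'0]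
    nlinarith [norm_nonneg (a - b)]
  · have h6 := norm_smul_sub_smul_sq_le a b hA0 hA'0
    have h7 : A * A' * ‖a - b‖ ^ 2 ≤ 4 * (2 * l) ^ 2 := by
      have : A * A' ≤ 4 := by nlinarith
      gcongr
    set D := ‖A • a‖ - ‖A' • b‖ with hD
    have h8 : 0 ≤ l ^ 2 / G := by positivity
    have h9 : l ^ 2 ≤ 16 * D * (l ^ 2 / G) := by
      calc l ^ 2 = 16 * (G / 16) * (l ^ 2 / G) := by field_simp
        _ ≤ _ := by gcongr
    refine le_of_sq_le_sq ?_ (by linarith)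
    nlinarith [sq_nonneg (l ^ 2 / G)]

/-- By the parallelogram law, ‖c‖² + ‖c - 2u‖² = 2‖c - u‖² + 2n². With ‖c‖ close to n, this makes
the detour through c longer by a multiple of ‖c - u‖²/n. -/
lemma norm_add_norm_sub_ge {c u : EuclideanSpace ℝ (Fin d)} {n s : ℝ} (hn : 0 < n)
    (hs : 0 ≤ s) (hsn : s ≤ n) (hc : |‖c‖ - n| ≤ s) (hu : ‖u‖ = n) :
    2 * ‖c - u‖ ^ 2 / (5 * n) - 3 * s ≤ ‖c - (2 : ℝ) • u‖ - n := by
  have h1 := parallelogram_law_with_norm ℝ (c - u) u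
  have e1 : c - u + u = c := by abel
  have e2 : c - u - u = c - (2 : ℝ) • u := by module
  rw [e1, e2, hu] at h1
  set y := ‖c - (2 : ℝ) • u‖ with hy
  set w := ‖c - u‖ with hw
  obtain ⟨h2, h3⟩ := abs_le.1 hc
  have hy4 : y ≤ 4 * n := by
    have := norm_sub_le c ((2 : ℝ) • u)
    rw [norm_smul, hu, Real.norm_of_nonneg (by norm_num)] at this
    linarith
  have hy0 : 0 ≤ y := norm_nonneg _
  have hkey : 2 * w ^ 2 - 3 * n * s ≤ (y - n) * (y + n) := by nlinarith [norm_nonneg c]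
  have e : 2 * w ^ 2 / (5 * n) * (5 * n) = 2 * w ^ 2 := by field_simp
  rcases le_total n y with h | h
  · have h5 : (y - n) * (y + n) ≤ (y - n) * (5 * n) := by gcongr; linarith
    by_contra! hcon
    nlinarith
  · have h5 : (y - n) * (y + n) ≤ (y - n) * n := by nlinarith
    by_contra! hcon
    nlinarith [sq_nonneg w]

end Geometry

/-! ### Summability of the error terms along a chain. -/

section Summability

lemma summable_succ_rpow_mul_geometric {p θ : ℝ} (hθ : 0 < θ) (hθ1 : θ < 1) :
    Summable fun j : ℕ => (1 + j : ℝ) ^ p * θ ^ j := by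
  obtain ⟨k, hk⟩ := exists_nat_ge p
  have h1 : Summable fun j : ℕ => ((j : ℝ) ^ k * θ ^ j : ℝ) :=
    summable_pow_mul_geometric_of_norm_lt_one k (by rwa [Real.norm_of_nonneg hθ.le])
  have h2 := ((summable_nat_add_iff 1).2 h1).mul_left θ⁻¹
  refine Summable.of_nonneg_of_le (fun j => by positivity) (fun j => ?_) h2
  have e : θ⁻¹ * (((j + 1 : ℕ) : ℝ) ^ k * θ ^ (j + 1)) = (1 + j : ℝ) ^ k * θ ^ j := by
    push_cast
    field_simp
    ring
  rw [e]
  gcongr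
  rw [← Real.rpow_natCast]
  exact Real.rpow_le_rpow_of_exponent_le (by linarith [Nat.cast_nonneg (α := ℝ) j]) hk

end Summability

/-! ### Typical passage times for all links of all chains. -/

section Typical

variable {Ω : Type*} [MeasurableSpace Ω] {P : Measure Ω} {d : ℕ} [NeZero d] {α : ℝ}
  {Q : Ω → Set (EuclideanSpace ℝ (Fin d))}
  {q : Ω → EuclideanSpace ℝ (Fin d) → EuclideanSpace ℝ (Fin d)} {ψ h : ℝ → ℝ}
  {μ κ₁ κ₃ κ a A r₀ : ℝ}

/-- The passage time between `x` and `y` is within `deviation a κ₁ b` times the scale of `h`,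
provided that this deviation is in the range in which concentration is available. -/
def IsTypical (α : ℝ) (S : Set (EuclideanSpace ℝ (Fin d)))
    (q : EuclideanSpace ℝ (Fin d) → EuclideanSpace ℝ (Fin d)) (ψ h : ℝ → ℝ) (κ₁ κ a r₀ b : ℝ)
    (x y : EuclideanSpace ℝ (Fin d)) : Prop :=
  r₀ ≤ ‖x - y‖ → deviation a κ₁ b ≤ ‖x - y‖ ^ κ →
    |passageTime α S q x y - h ‖x - y‖| ≤ deviation a κ₁ b * ψ ‖x - y‖

omit [NeZero d] in
lemma IsConcentratedModel.measure_exists_not_isTypical_le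
    (M : IsConcentratedModel P α Q q ψ h μ κ₁ κ₃ κ a A r₀) {ι : Type*} [Countable ι]
    (x y : ι → EuclideanSpace ℝ (Fin d)) {Θ : ι → ℝ} (hΘ : ∀ i, 0 ≤ Θ i)
    (hsum : Summable fun i => Real.exp (-Θ i)) {β : ℝ} (hβ : 0 ≤ β) :
    P {ω | ∃ i, ¬ IsTypical α (Q ω) (q ω) ψ h κ₁ κ a r₀ (β + Θ i) (x i) (y i)} ≤
      ENNReal.ofReal (A * Real.exp (-β) * ∑' i, Real.exp (-Θ i)) := by
  refine le_trans (measure_mono ?_) (M.measure_exists_deviation_le x y hΘ hsum hβ)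
  rintro ω ⟨i, hi⟩
  unfold IsTypical at hi
  push Not at hi
  exact ⟨i, hi⟩

/-- The points at level `j` of the chains that connect a neighbourhood of `u` to the dilation of
this neighbourhood by the factor `1 + η` with centre `o`. -/
noncomputable def chainPoint (o u : EuclideanSpace ℝ (Fin d)) (η ℓ : ℝ) (j : ℕ) (v : Fin d → ℤ) :
    EuclideanSpace ℝ (Fin d) :=
  o + (1 + η / 2 ^ j) • (u + latticePoint (ℓ / 2 ^ j) v - o)

/-- The weights of the links of the chains. -/
noncomputable def chainWeight (i : ℕ × (Fin d → ℤ) × (Fin d → ℤ)) : ℝ :=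
  2 * Real.log (2 + i.1) + (latticeWeight i.2.1 + latticeWeight i.2.2)

omit [NeZero d] in
lemma chainWeight_nonneg (i : ℕ × (Fin d → ℤ) × (Fin d → ℤ)) : 0 ≤ chainWeight i := by
  have h1 : 0 ≤ Real.log (2 + i.1) := Real.log_nonneg (by linarith [Nat.cast_nonneg (α := ℝ) i.1])
  have h2 := latticeWeight_nonneg i.2.1
  have h3 := latticeWeight_nonneg i.2.2
  unfold chainWeight
  linarith

omit [NeZero d] in
lemma summable_exp_neg_add_latticeWeight : Summable fun i : (Fin d → ℤ) × (Fin d → ℤ) =>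
    Real.exp (-(latticeWeight i.1 + latticeWeight i.2)) := by
  simp_rw [neg_add, Real.exp_add]
  exact summable_exp_neg_latticeWeight.mul_of_nonneg summable_exp_neg_latticeWeight
    (fun _ => (Real.exp_pos _).le) fun _ => (Real.exp_pos _).le

omit [NeZero d] in
lemma summable_exp_neg_chainWeight : Summable fun i : ℕ × (Fin d → ℤ) × (Fin d → ℤ) =>
    Real.exp (-chainWeight i) := by
  have h1 : Summable fun j : ℕ => 1 / (j : ℝ) ^ 2 := Real.summable_one_div_nat_pow.2 (by norm_num)
  have h2 : Summable fun j : ℕ => 1 / ((j : ℝ) + 2) ^ 2 := by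
    have := (summable_nat_add_iff 2).2 h1
    push_cast at this
    exact this
  have h3 := h2.mul_of_nonneg (summable_exp_neg_add_latticeWeight (d := d))
    (fun _ => by positivity) fun _ => (Real.exp_pos _).le
  refine h3.congr fun i => ?_
  have h4 : (0 : ℝ) < i.1 + 2 := by positivity
  rw [chainWeight, neg_add (2 * _), Real.exp_add, Real.exp_neg (2 * _),
    show 2 * Real.log (2 + i.1) = Real.log ((i.1 + 2) ^ 2) by
      rw [Real.log_pow, add_comm]; norm_num, Real.exp_log (by positivity), one_div]

/-- All the passage times that occur in the chains from `o` to the neighbourhood of `u` are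
typical. -/
structure IsChainTypical (α : ℝ) (S : Set (EuclideanSpace ℝ (Fin d)))
    (q : EuclideanSpace ℝ (Fin d) → EuclideanSpace ℝ (Fin d)) (ψ h : ℝ → ℝ) (κ₁ κ a r₀ β : ℝ)
    (o u : EuclideanSpace ℝ (Fin d)) (η ℓ : ℝ) (J : ℕ) : Prop where
  start : ∀ v, IsTypical α S q ψ h κ₁ κ a r₀ (β + latticeWeight v) o (chainPoint o u η ℓ 0 v)
  link : ∀ j v v', IsTypical α S q ψ h κ₁ κ a r₀ (β + chainWeight (j, v, v'))
    (chainPoint o u η ℓ j v) (chainPoint o u η ℓ (j + 1) v')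
  last : ∀ v v', IsTypical α S q ψ h κ₁ κ a r₀ (β + (latticeWeight v + latticeWeight v'))
    (chainPoint o u η ℓ J v) (u + latticePoint 1 v')

/-- The three weighted sums do not depend on the centres, on `η`, `ℓ` or on the depth `J`, so a
single `β` serves for all chains. -/
lemma IsConcentratedModel.exists_measure_not_isChainTypical_le
    (M : IsConcentratedModel P α Q q ψ h μ κ₁ κ₃ κ a A r₀) : ∃ β : ℝ, 0 ≤ β ∧
      ∀ (o u : EuclideanSpace ℝ (Fin d)) (η ℓ : ℝ) (J : ℕ),
        P {ω | ¬ IsChainTypical α (Q ω) (q ω) ψ h κ₁ κ a r₀ β o u η ℓ J} ≤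
          ENNReal.ofReal (1 / 4) := by
  have hA := M.one_le_A
  obtain ⟨S₀, hS₀⟩ : ∃ S, S = ∑' i : Fin d → ℤ, Real.exp (-latticeWeight i) := ⟨_, rfl⟩
  obtain ⟨S₁, hS₁⟩ : ∃ S, S = ∑' i : ℕ × (Fin d → ℤ) × (Fin d → ℤ), Real.exp (-chainWeight i) :=
    ⟨_, rfl⟩
  obtain ⟨S₂, hS₂⟩ : ∃ S, S = ∑' i : (Fin d → ℤ) × (Fin d → ℤ),
    Real.exp (-(latticeWeight i.1 + latticeWeight i.2)) := ⟨_, rfl⟩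
  have h0 : 0 ≤ S₀ := hS₀ ▸ tsum_nonneg fun _ => (Real.exp_pos _).le
  have h1 : 0 ≤ S₁ := hS₁ ▸ tsum_nonneg fun _ => (Real.exp_pos _).le
  have h2 : 0 ≤ S₂ := hS₂ ▸ tsum_nonneg fun _ => (Real.exp_pos _).le
  obtain ⟨β, hβ0, hβ⟩ := exists_mul_exp_neg_mul_le A (S₀ + (S₁ + S₂))
    (by norm_num : (0 : ℝ) < 1 / 4)
  refine ⟨β, hβ0, fun o u η ℓ J => ?_⟩
  have b0 := M.measure_exists_not_isTypical_le (fun _ => o) (fun v => chainPoint o u η ℓ 0 v)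
    latticeWeight_nonneg summable_exp_neg_latticeWeight hβ0
  have b1 := M.measure_exists_not_isTypical_le (ι := ℕ × (Fin d → ℤ) × (Fin d → ℤ))
    (fun i => chainPoint o u η ℓ i.1 i.2.1)
    (fun i => chainPoint o u η ℓ (i.1 + 1) i.2.2) chainWeight_nonneg
    summable_exp_neg_chainWeight hβ0
  have b2 := M.measure_exists_not_isTypical_le (ι := (Fin d → ℤ) × (Fin d → ℤ))
    (fun i => chainPoint o u η ℓ J i.1)
    (fun i => u + latticePoint 1 i.2)
    (fun i => add_nonneg (latticeWeight_nonneg i.1) (latticeWeight_nonneg i.2))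
    summable_exp_neg_add_latticeWeight hβ0
  rw [← hS₀] at b0
  rw [← hS₁] at b1
  rw [← hS₂] at b2
  have hE := Real.exp_pos (-β)
  have hAE : 0 ≤ A * Real.exp (-β) := by positivity
  have hsum : ENNReal.ofReal (A * Real.exp (-β) * S₀) + (ENNReal.ofReal (A * Real.exp (-β) * S₁) +
      ENNReal.ofReal (A * Real.exp (-β) * S₂)) ≤ ENNReal.ofReal (1 / 4) := by
    rw [← ENNReal.ofReal_add (mul_nonneg hAE h1) (mul_nonneg hAE h2),
      ← ENNReal.ofReal_add (mul_nonneg hAE h0) (by positivity), ← mul_add, ← mul_add]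
    exact ENNReal.ofReal_le_ofReal hβ
  refine le_trans ?_ hsum
  refine le_trans ?_ ((measure_union_le _ _).trans (add_le_add b0
    ((measure_union_le _ _).trans (add_le_add b1 b2))))
  refine measure_mono fun ω hω => ?_
  by_contra hcon
  simp only [Set.mem_union, Set.mem_ofPred_eq, not_or, not_exists, not_not] at hcon
  exact hω ⟨hcon.1, fun j v v' => hcon.2.1 (j, v, v'), fun v v' => hcon.2.2 (v, v')⟩

end Typical

end EuclideanFPP

namespace EuclideanFPP

/-! ### Choice of the chain depth, and the estimate for one link. -/

section Depth

variable {Ω : Type*} [MeasurableSpace Ω] {P : Measure Ω} {d : ℕ} [NeZero d] {α : ℝ}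
  {Q : Ω → Set (EuclideanSpace ℝ (Fin d))}
  {q : Ω → EuclideanSpace ℝ (Fin d) → EuclideanSpace ℝ (Fin d)} {ψ h : ℝ → ℝ}
  {μ κ₁ κ₃ κ a A r₀ : ℝ}

/-- The distance `n` is large and `J` is a suitable number of links for chains at this distance. -/
structure IsDepth (ψ : ℝ → ℝ) (α μ κ₁ κ₃ κ r₀ K n : ℝ) (J : ℕ) : Prop where
  one_le_log : 1 ≤ Real.log n
  log_le : Real.log (2 + 6 * n) ≤ 2 * Real.log n
  add_le : 2 + 5 * n ≤ n ^ 2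
  r₀_le : r₀ ≤ n ^ (1 / 2 : ℝ)
  scale_le : 16384 * ψ n ≤ n ^ (1 - κ₃ / 4)
  one_le_scale : 1 ≤ ψ n
  rpow_le_scale : 2 ^ α ≤ ψ n
  le_scale : μ ≤ ψ n
  pow_le : ((2 : ℝ) ^ J) ^ 2 ≤ n ^ (1 - κ₃ / 4)
  sqrt_le : 16 * 2 ^ J * n ^ (1 / 2 : ℝ) ≤ n ^ (1 - κ₃ / 4)
  depth_le : 1 + (J : ℝ) ≤ 3 * Real.log n
  deviation_le : K * (Real.log n ^ 2) ^ (1 / κ₁) ≤ (n ^ (1 / 2 : ℝ)) ^ κ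
  last_le : (1 + K * (Real.log n ^ 2) ^ (1 / κ₁)) * ((2 : ℝ) ^ (-κ₃)) ^ J ≤ 1

omit [NeZero d] in
lemma IsConcentratedModel.eventually_exists_isDepth
    (M : IsConcentratedModel P α Q q ψ h μ κ₁ κ₃ κ a A r₀) (K : ℝ) :
    ∀ᶠ n : ℝ in atTop, ∃ J, IsDepth ψ α μ κ₁ κ₃ κ r₀ K n J := by
  have hκ₃ := M.κ₃_pos
  have hκ₃' := M.κ₃_lt
  have hκ := M.κ_pos
  have hψ : ∀ c : ℝ, ∀ᶠ n : ℝ in atTop, c ≤ ψ n := fun c => by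
    filter_upwards [eventually_const_le_rpow (by positivity : 0 < κ₃ / 2) c M.a_pos,
      eventually_ge_atTop r₀] with n h1 h2
    exact h1.trans (M.scale.lower n h2)
  filter_upwards [Real.tendsto_log_atTop.eventually_ge_atTop 1,
    eventually_log_add_mul_le 2 6 (by norm_num), eventually_ge_atTop 6,
    eventually_const_le_rpow (by norm_num : (0 : ℝ) < 1 / 2) r₀ one_pos,
    eventually_mul_rpow_le (by linarith : 1 - κ₃ < 1 - κ₃ / 4) (16384 * A) one_pos,
    (hψ 1).and ((hψ (2 ^ α)).and (hψ μ)),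
    eventually_mul_rpow_le (by linarith : (1 / 4 : ℝ) < 1 - κ₃ / 4) 4 one_pos,
    eventually_mul_rpow_le (by linarith : (5 / 8 : ℝ) < 1 - κ₃ / 4) 32 one_pos,
    eventually_mul_rpow_le (by norm_num : (1 / 8 : ℝ) < 1) 2 one_pos,
    eventually_mul_log_rpow_le (by positivity : 0 < κ / 2) (2 * (1 / κ₁)) K one_pos,
    eventually_mul_log_rpow_le (by positivity : 0 < κ₃ / 8) (2 * (1 / κ₁)) K
      (by norm_num : (0 : ℝ) < 1 / 2),
    eventually_const_le_rpow (by positivity : 0 < κ₃ / 8) 1 (by norm_num : (0 : ℝ) < 1 / 2),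
    eventually_ge_atTop r₀]
    with n h1 h2 h3 h4 h5 h6 h7 h8 h9 h10 h11 h12 h13
  have hn0 : 0 < n := by linarith
  -- The depth J = j + 1 makes 2^J comparable to n^(1/8): small enough for all links to stay longer
  -- than √n, large enough for 2^(-κ₃ J) to beat every power of log n.
  obtain ⟨j, hj1, hj2⟩ := exists_nat_pow_near
    (Real.one_le_rpow (by linarith : 1 ≤ n) (by norm_num : (0 : ℝ) ≤ 1 / 8)) one_lt_two
  have hJ2 : (2 : ℝ) ^ (j + 1) ≤ 2 * n ^ (1 / 8 : ℝ) := by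
    rw [pow_succ]
    linarith
  have elog : (Real.log n ^ 2) ^ (1 / κ₁) = Real.log n ^ (2 * (1 / κ₁)) := by
    rw [← Real.rpow_natCast, ← Real.rpow_mul (by linarith)]
    norm_num
  simp only [one_mul, Real.rpow_one] at h4 h5 h7 h8 h9 h10
  refine ⟨j + 1, h1, h2, by nlinarith, h4, ?_, h6.1, h6.2.1, h6.2.2, ?_, ?_, ?_, ?_, ?_⟩
  · have := M.scale.upper n h13
    nlinarith
  · calc ((2 : ℝ) ^ (j + 1)) ^ 2 ≤ (2 * n ^ (1 / 8 : ℝ)) ^ 2 := by gcongr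
      _ = 4 * n ^ (1 / 4 : ℝ) := by
        rw [mul_pow, ← Real.rpow_natCast (n ^ _), ← Real.rpow_mul hn0.le]
        norm_num
      _ ≤ _ := h7
  · calc 16 * 2 ^ (j + 1) * n ^ (1 / 2 : ℝ) ≤ 16 * (2 * n ^ (1 / 8 : ℝ)) * n ^ (1 / 2 : ℝ) := by
          gcongr
      _ = 32 * n ^ (5 / 8 : ℝ) := by
        rw [show (5 / 8 : ℝ) = 1 / 8 + 1 / 2 by norm_num, Real.rpow_add hn0]
        ring
      _ ≤ _ := h8
  · have h14 : (2 : ℝ) ^ (j + 1) ≤ n := hJ2.trans h9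
    have h15 := Real.log_le_log (by positivity) h14
    rw [Real.log_pow] at h15
    have h16 := Real.log_two_gt_d9
    have h17 : (0 : ℝ) ≤ ((j + 1 : ℕ) : ℝ) := Nat.cast_nonneg _
    nlinarith
  · rw [elog, ← Real.rpow_mul hn0.le]
    refine h10.trans (le_of_eq ?_)
    congr 1
    ring
  · have h18 : ((2 : ℝ) ^ (-κ₃)) ^ (j + 1) ≤ n ^ (-(κ₃ / 8)) := by
      rw [← Real.rpow_natCast, ← Real.rpow_mul (by norm_num), mul_comm, Real.rpow_mul (by norm_num),
        Real.rpow_natCast]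
      calc ((2 : ℝ) ^ (j + 1)) ^ (-κ₃) ≤ (n ^ (1 / 8 : ℝ)) ^ (-κ₃) :=
            Real.rpow_le_rpow_of_nonpos (by positivity) hj2.le (by linarith)
        _ = _ := by
          rw [← Real.rpow_mul hn0.le]
          congr 1
          ring
    rw [elog]
    have h19 : 0 ≤ Real.log n ^ (2 * (1 / κ₁)) := by positivity
    calc (1 + K * Real.log n ^ (2 * (1 / κ₁))) * ((2 : ℝ) ^ (-κ₃)) ^ (j + 1)
        ≤ (n ^ (κ₃ / 8)) * n ^ (-(κ₃ / 8)) := by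
          gcongr
          linarith
      _ = 1 := by rw [← Real.rpow_add hn0]; simp

/-- The constant in the bound for the weights of the points of the chains. -/
noncomputable def latticeConst (d : ℕ) : ℝ := 2 * d * (Real.log (2 + d) + 2)

omit [NeZero d] in
lemma latticeConst_nonneg : 0 ≤ latticeConst d := by
  have : 0 ≤ Real.log (2 + d) := Real.log_nonneg (by linarith [Nat.cast_nonneg (α := ℝ) d])
  unfold latticeConst
  positivity

/-- At level `j` the lattice index of a point at distance Xℓ from `u` has size O(2^j X + 1), so its
logarithmic weight grows linearly in `j` and logarithmically in `X`. -/
lemma latticeWeight_le_of_near {c u : EuclideanSpace ℝ (Fin d)} {ℓ X Y : ℝ} {j : ℕ} {v : Fin d → ℤ}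
    (hℓ : 0 < ℓ) (hX : ‖c - u‖ ≤ X * ℓ) (hX0 : 0 ≤ X) (hY : 1 ≤ Y) (hXY : Real.log (2 + X) ≤ Y)
    (hv : ‖c - (u + latticePoint (ℓ / 2 ^ j) v)‖ ≤ ℓ / 2 ^ j) :
    latticeWeight v ≤ latticeConst d * ((1 + j) * Y) := by
  have h2j : (1 : ℝ) ≤ 2 ^ j := one_le_pow₀ (by norm_num)
  have hℓj : 0 < ℓ / 2 ^ j := by positivity
  have h1 : ‖latticePoint (ℓ / 2 ^ j) v‖ ≤ ℓ / 2 ^ j * (2 ^ j * X + 1) := by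
    have e : latticePoint (ℓ / 2 ^ j) v = (c - u) - (c - (u + latticePoint (ℓ / 2 ^ j) v)) := by abel
    have e2 : ℓ / 2 ^ j * (2 ^ j * X + 1) = X * ℓ + ℓ / 2 ^ j := by field_simp
    rw [e2]
    calc _ = ‖(c - u) - (c - (u + latticePoint (ℓ / 2 ^ j) v))‖ := by rw [← e]
      _ ≤ _ := (norm_sub_le _ _).trans (add_le_add hX hv)
  refine (latticeWeight_le_log hℓj (by positivity) h1).trans ?_
  have h2 : Real.log (2 + (2 ^ j * X + 1)) ≤ 2 * ((1 + j) * Y) := by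
    have h3 : 2 + (2 ^ j * X + 1) ≤ 2 ^ (j + 1) * (2 + X) := by
      rw [pow_succ]
      nlinarith
    refine (Real.log_le_log (by positivity) h3).trans ?_
    rw [Real.log_mul (by positivity) (by positivity), Real.log_pow]
    push_cast
    have h4 := Real.log_two_lt_d9
    have h5 : (0 : ℝ) ≤ j := Nat.cast_nonneg j
    nlinarith
  have h6 : 0 ≤ Real.log (2 + d) := Real.log_nonneg (by linarith [Nat.cast_nonneg (α := ℝ) d])
  have h7 : 1 ≤ (1 + j) * Y := by
    have h5 : (0 : ℝ) ≤ j := Nat.cast_nonneg j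
    nlinarith
  calc 2 * (d : ℝ) * (Real.log (2 + d) + Real.log (2 + (2 ^ j * X + 1)))
      ≤ 2 * d * ((Real.log (2 + d) + 2) * ((1 + j) * Y)) := by
        gcongr
        nlinarith
    _ = _ := by
      unfold latticeConst
      ring

omit [NeZero d] in
-- A link of length of order G = ηn/2^j has nonrandom error at most η^(-κ₃) ψ(R) and random error at
-- most l ψ(R), where R is its length. Regular growth bounds ψ(R) by a multiple of (η/2^j)^κ₃ ψ(n),
-- which cancels the factor η^(-κ₃) and leaves a factor geometric in `j`.
lemma IsConcentratedModel.link_le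
    (M : IsConcentratedModel P α Q q ψ h μ κ₁ κ₃ κ a A r₀) {S : Set (EuclideanSpace ℝ (Fin d))}
    {q' : EuclideanSpace ℝ (Fin d) → EuclideanSpace ℝ (Fin d)} {n η l Δ : ℝ} {j : ℕ}
    (hr₀ : r₀ ≤ n ^ (1 / 2 : ℝ)) (hn : 1 ≤ n) (hη0 : 0 < η) (hη : η ≤ 1 / 4)
    (hG : 16 * n ^ (1 / 2 : ℝ) ≤ η * n / 2 ^ j)
    (hγ : ∀ r, n ^ (1 / 2 : ℝ) ≤ r → r ≤ 8 * n → h r - r * μ ≤ η ^ (-κ₃) * ψ r)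
    {x y : EuclideanSpace ℝ (Fin d)} (h1 : η * n / 2 ^ j / 16 ≤ ‖x - y‖)
    (h2 : ‖x - y‖ ≤ 6 * (η * n / 2 ^ j)) (h3 : ‖x - y‖ ≤ Δ + 128 * (ψ n / 2 ^ j)) (hl : 0 ≤ l)
    (hT : |passageTime α S q' x y - h ‖x - y‖| ≤ l * ψ ‖x - y‖) :
    passageTime α S q' x y ≤ μ * Δ + (128 * μ + 8 * A) * (1 + l) * (2 ^ (-κ₃)) ^ j * ψ n := by
  have hκ₃ := M.κ₃_pos
  have hμ := M.μ_nonneg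
  have hA := M.one_le_A
  have h2j : (1 : ℝ) ≤ 2 ^ j := one_le_pow₀ (by norm_num)
  have hn0 : 0 < n := by linarith
  have hsn : n ^ (1 / 2 : ℝ) ≤ n := by
    calc n ^ (1 / 2 : ℝ) ≤ n ^ (1 : ℝ) := Real.rpow_le_rpow_of_exponent_le hn (by norm_num)
      _ = n := Real.rpow_one n
  have hs0 : 0 < n ^ (1 / 2 : ℝ) := Real.rpow_pos_of_pos hn0 _
  set R := ‖x - y‖ with hR
  set G := η * n / 2 ^ j with hGdef
  have hGn : G ≤ n / 4 := by
    calc G ≤ η * n := div_le_self (by positivity) h2j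
      _ ≤ 1 / 4 * n := by gcongr
      _ = n / 4 := by ring
  have hG0 : 0 < G := by positivity
  have hψn := M.scale.pos n (hr₀.trans hsn)
  have hψG : ψ G ≤ A * (η ^ κ₃ * (2 ^ (-κ₃)) ^ j) * ψ n := by
    have h4 := M.scale.ratio G n (hr₀.trans hsn) (by linarith) (by linarith)
    have e : (G / n) ^ κ₃ = η ^ κ₃ * (2 ^ (-κ₃)) ^ j := by
      have e1 : G / n = η * ((2 : ℝ) ^ j)⁻¹ := by
        rw [hGdef]
        field_simp
      rw [e1, Real.mul_rpow hη0.le (by positivity), Real.inv_rpow (by positivity),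
        ← Real.rpow_neg (by positivity), ← Real.rpow_natCast, ← Real.rpow_natCast,
        ← Real.rpow_mul (by norm_num), ← Real.rpow_mul (by norm_num)]
      ring_nf
    rwa [e] at h4
  have hG1 : r₀ ≤ G := by linarith
  have hψR : ψ R ≤ 8 * ψ G := by
    have h4 := M.scale.mono R (2 * (2 * (2 * G))) (by linarith) (by linarith)
    have h5 := M.scale_two_mul_le (r := G) (s := 2 * G) hG1 (by linarith) le_rfl
    have h6 := M.scale_two_mul_le (r := 2 * G) (s := 2 * (2 * G)) (by linarith) (by linarith) le_rfl
    have h7 := M.scale_two_mul_le (r := 2 * (2 * G)) (s := 2 * (2 * (2 * G))) (by linarith)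
      (by linarith) le_rfl
    linarith
  have h8 := hγ R (by linarith) (by linarith)
  have h9 := (abs_le.1 hT).2
  have hη1 : η ^ (-κ₃) * η ^ κ₃ = 1 := by rw [← Real.rpow_add hη0]; simp
  have hη2 : 1 ≤ η ^ (-κ₃) := Real.one_le_rpow_of_pos_of_le_one_of_nonpos hη0 (by linarith)
    (by linarith)
  have hθ0 : 0 < ((2 : ℝ) ^ (-κ₃)) ^ j := by positivity
  have hθ : 1 / (2 : ℝ) ^ j ≤ ((2 : ℝ) ^ (-κ₃)) ^ j := by
    rw [← one_div_pow]
    gcongr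
    rw [one_div, ← Real.rpow_neg_one]
    exact Real.rpow_le_rpow_of_exponent_le (by norm_num) (by linarith [M.κ₃_lt])
  have hE : (η ^ (-κ₃) + l) * ψ R ≤ 8 * A * (1 + l) * ((2 : ℝ) ^ (-κ₃)) ^ j * ψ n := by
    calc (η ^ (-κ₃) + l) * ψ R ≤ (η ^ (-κ₃) + l) *
          (8 * (A * (η ^ κ₃ * (2 ^ (-κ₃)) ^ j) * ψ n)) := by
          gcongr
          linarith
      _ = 8 * A * (η ^ (-κ₃) * η ^ κ₃ + l * η ^ κ₃) * ((2 : ℝ) ^ (-κ₃)) ^ j * ψ n := by ring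
      _ ≤ _ := by
        rw [hη1]
        have h10 : l * η ^ κ₃ ≤ l := mul_le_of_le_one_right hl
          (Real.rpow_le_one hη0.le (by linarith) hκ₃.le)
        gcongr
  have hF : 128 * μ * (ψ n / 2 ^ j) ≤ 128 * μ * (1 + l) * ((2 : ℝ) ^ (-κ₃)) ^ j * ψ n := by
    calc 128 * μ * (ψ n / 2 ^ j) = 128 * μ * 1 * (1 / 2 ^ j) * ψ n := by ring
      _ ≤ _ := by
        gcongr
        linarith
  have h11 : μ * R ≤ μ * (Δ + 128 * (ψ n / 2 ^ j)) := by gcongr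
  linarith

end Depth

end EuclideanFPP

namespace EuclideanFPP

/-! ### Summing the links of a chain. -/

section Chain

variable {Ω : Type*} [MeasurableSpace Ω] {P : Measure Ω} {d : ℕ} [NeZero d] {α : ℝ}
  {Q : Ω → Set (EuclideanSpace ℝ (Fin d))}
  {q : Ω → EuclideanSpace ℝ (Fin d) → EuclideanSpace ℝ (Fin d)} {ψ h : ℝ → ℝ}
  {μ κ₁ κ₃ κ a A r₀ : ℝ} {S : Set (EuclideanSpace ℝ (Fin d))}
  {q' : EuclideanSpace ℝ (Fin d) → EuclideanSpace ℝ (Fin d)}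

/-- The constant that bounds the weights of the links of the chains. -/
noncomputable def weightConst (d : ℕ) (β : ℝ) : ℝ := β + 2 + 3 * latticeConst d

omit [NeZero d] in
lemma weightConst_nonneg {β : ℝ} (hβ : 0 ≤ β) : 0 ≤ weightConst d β := by
  have := latticeConst_nonneg (d := d)
  unfold weightConst
  linarith

omit [NeZero d] in
-- Every weight that occurs is O((log n)²), so for pairs at distance at least √n the deviation is
-- always in the range in which concentration is available.
lemma IsTypical.abs_le
    (M : IsConcentratedModel P α Q q ψ h μ κ₁ κ₃ κ a A r₀) {b β n : ℝ} {J : ℕ}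
    {x y : EuclideanSpace ℝ (Fin d)} (hβ : 0 ≤ β)
    (hJ : IsDepth ψ α μ κ₁ κ₃ κ r₀ (deviation a κ₁ (9 * weightConst d β)) n J)
    (ht : IsTypical α S q' ψ h κ₁ κ a r₀ b x y) (hb : 0 ≤ b)
    (hb' : b ≤ weightConst d β * (9 * Real.log n ^ 2)) (hn : 0 < n)
    (hxy : n ^ (1 / 2 : ℝ) ≤ ‖x - y‖) :
    |passageTime α S q' x y - h ‖x - y‖| ≤ deviation a κ₁ b * ψ ‖x - y‖ := by
  have hC := weightConst_nonneg (d := d) hβ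
  refine ht (hJ.r₀_le.trans hxy) ?_
  calc deviation a κ₁ b ≤ deviation a κ₁ (9 * weightConst d β * Real.log n ^ 2) :=
        deviation_le M.a_pos M.κ₁_pos hb (by linarith)
    _ = deviation a κ₁ (9 * weightConst d β) * (Real.log n ^ 2) ^ (1 / κ₁) :=
        deviation_mul M.a_pos (by positivity) (by positivity)
    _ ≤ (n ^ (1 / 2 : ℝ)) ^ κ := hJ.deviation_le
    _ ≤ _ := Real.rpow_le_rpow (by positivity) hxy M.κ_pos.le

omit [NeZero d] in
lemma chainWeight_le {β Y : ℝ} {j : ℕ} {v v' : Fin d → ℤ} (hβ : 0 ≤ β) (hY : 1 ≤ Y)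
    (hv : latticeWeight v ≤ latticeConst d * ((1 + j) * Y))
    (hv' : latticeWeight v' ≤ latticeConst d * ((1 + (j + 1 : ℕ)) * Y)) :
    β + chainWeight (j, v, v') ≤ weightConst d β * ((1 + j) * Y) := by
  have h1 := latticeConst_nonneg (d := d)
  have h2 : Real.log (2 + j) ≤ 1 + j := by
    have := Real.log_le_sub_one_of_pos (by positivity : (0 : ℝ) < 2 + j)
    linarith
  have h3 : (1 : ℝ) + j ≤ (1 + j) * Y := le_mul_of_one_le_right (by positivity) hY
  have h4 : (1 : ℝ) ≤ 1 + j := by simp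
  have h5 : latticeConst d * ((1 + (j + 1 : ℕ)) * Y) ≤ latticeConst d * (2 * ((1 + j) * Y)) := by
    push_cast
    exact mul_le_mul_of_nonneg_left (by nlinarith) h1
  have h6 : β ≤ β * ((1 + j) * Y) := le_mul_of_one_le_right hβ (h4.trans h3)
  unfold weightConst chainWeight
  simp only
  linarith

set_option maxHeartbeats 1000000 in
-- The lengths telescope to `μ` times the difference of the distances to `o`. The errors are a
-- series of terms (1 + j)^(1/κ₁) 2^(-κ₃ j), and they share the factor ψ(n) Y^(1/κ₁).
lemma IsConcentratedModel.chain_le (M : IsConcentratedModel P α Q q ψ h μ κ₁ κ₃ κ a A r₀)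
    (hq : IsClosestPointMap S q') {β n η ℓ Y : ℝ} {J : ℕ} (hβ : 0 ≤ β)
    (hJ : IsDepth ψ α μ κ₁ κ₃ κ r₀ (deviation a κ₁ (9 * weightConst d β)) n J)
    (hn : 1 ≤ n) (hη0 : 0 < η) (hη : η ≤ 1 / 4) (hG : 16 * 2 ^ J * n ^ (1 / 2 : ℝ) ≤ η * n)
    (hγ : ∀ r, n ^ (1 / 2 : ℝ) ≤ r → r ≤ 8 * n → h r - r * μ ≤ η ^ (-κ₃) * ψ r)
    (hℓ : ℓ ^ 2 = η * n * ψ n) (hℓ0 : 0 < ℓ) (hℓn : 128 * ℓ ≤ η * n) (hℓJ : 2 ^ J ≤ ℓ)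
    (hY : 1 ≤ Y) (hYn : Y ≤ 3 * Real.log n)
    {o u c : EuclideanSpace ℝ (Fin d)} (hu : ‖u - o‖ = n) (hc1 : n / 2 ≤ ‖c - o‖)
    (hc2 : ‖c - o‖ ≤ 4 * n) (hXY : Real.log (2 + ‖c - u‖ / ℓ) ≤ Y)
    (ht : IsChainTypical α S q' ψ h κ₁ κ a r₀ β o u η ℓ J) {v : ℕ → Fin d → ℤ}
    (hv : ∀ j, ‖c - (u + latticePoint (ℓ / 2 ^ j) (v j))‖ ≤ ℓ / 2 ^ j) {w : Fin d → ℤ}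
    (hw : ‖c - (u + latticePoint 1 w)‖ ≤ 1) :
    passageTime α S q' (chainPoint o u η ℓ 0 (v 0)) (u + latticePoint 1 w) ≤
      μ * (‖chainPoint o u η ℓ 0 (v 0) - o‖ - ‖u + latticePoint 1 w - o‖) +
      (128 * μ + 8 * A) * (1 + (1 + deviation a κ₁ (weightConst d β)) *
        ∑' j : ℕ, (1 + j : ℝ) ^ (1 / κ₁) * (2 ^ (-κ₃)) ^ j) * ψ n * Y ^ (1 / κ₁) := by
  have hκ₁ := M.κ₁_pos
  have hκ₃ := M.κ₃_pos
  have hμ := M.μ_nonneg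
  have hA := M.one_le_A
  have ha := M.a_pos
  have hn0 : 0 < n := by linarith
  have hlog := hJ.one_le_log
  have hψ := hJ.one_le_scale
  have hC := weightConst_nonneg (d := d) hβ
  have hD := deviation_nonneg (κ₁ := κ₁) ha hC
  set D := deviation a κ₁ (weightConst d β) with hDdef
  set E := 128 * μ + 8 * A with hEdef
  have hE : 0 ≤ E := by positivity
  have hX0 : 0 ≤ ‖c - u‖ / ℓ := by positivity
  have hXℓ : ‖c - u‖ ≤ ‖c - u‖ / ℓ * ℓ := by rw [div_mul_cancel₀ _ hℓ0.ne']
  have hWv : ∀ j, latticeWeight (v j) ≤ latticeConst d * ((1 + j) * Y) := fun j =>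
    latticeWeight_le_of_near hℓ0 hXℓ hX0 hY hXY (hv j)
  have h2j : ∀ j : ℕ, (1 : ℝ) ≤ 2 ^ j := fun j => one_le_pow₀ (by norm_num)
  have hℓj : ∀ j : ℕ, ℓ / 2 ^ j ≤ ℓ := fun j => div_le_self hℓ0.le (h2j j)
  have hj0 : ∀ j : ℕ, (0 : ℝ) ≤ j := fun j => Nat.cast_nonneg j
  have hYp : 1 ≤ Y ^ (1 / κ₁) := Real.one_le_rpow hY (by positivity)
  have hηn : η * n ≤ n / 4 := by nlinarith
  set b : ℕ → EuclideanSpace ℝ (Fin d) := fun j => u + latticePoint (ℓ / 2 ^ j) (v j) - o with hb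
  set b' : EuclideanSpace ℝ (Fin d) := u + latticePoint 1 w - o with hb'
  set z : ℕ → EuclideanSpace ℝ (Fin d) := fun j => chainPoint o u η ℓ j (v j) with hz
  have hzb : ∀ j, z j - o = (1 + η / 2 ^ j) • b j := fun j => by
    simp only [hz, chainPoint, hb]
    abel
  have hbc : ∀ j, ‖(c - o) - b j‖ ≤ ℓ / 2 ^ j := fun j => by
    have e : (c - o) - b j = c - (u + latticePoint (ℓ / 2 ^ j) (v j)) := by
      simp only [hb]
      abel
    rw [e]
    exact hv j
  have hbc' : ‖(c - o) - b'‖ ≤ 1 := by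
    have e : (c - o) - b' = c - (u + latticePoint 1 w) := by
      simp only [hb']
      abel
    rw [e]
    exact hw
  have hb1 : ∀ j, n / 4 ≤ ‖b j‖ := fun j => by
    have h1 := norm_le_norm_add_norm_sub' (c - o) (b j)
    linarith [hbc j, hℓj j]
  have hb2 : ∀ j, ‖b j‖ ≤ 5 * n := fun j => by
    have h1 := norm_le_norm_add_norm_sub' (b j) (c - o)
    rw [norm_sub_rev (b j) (c - o)] at h1
    linarith [hbc j, hℓj j]
  have hG' : ∀ j ≤ J, 16 * n ^ (1 / 2 : ℝ) ≤ η * n / 2 ^ j := fun j hj => by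
    rw [le_div_iff₀ (by positivity)]
    refine le_trans ?_ hG
    have : (2 : ℝ) ^ j ≤ 2 ^ J := pow_le_pow_right₀ (by norm_num) hj
    have h0 : 0 ≤ n ^ (1 / 2 : ℝ) := by positivity
    nlinarith
  have hG0 : ∀ j : ℕ, 0 < η * n / 2 ^ j := fun j => by positivity
  have hη2 : ∀ j : ℕ, η / 2 ^ j ≤ 1 / 4 := fun j => (div_le_self hη0.le (h2j j)).trans hη
  have hη3 : ∀ j : ℕ, 0 < η / 2 ^ j := fun j => by positivity
  have hsq : ∀ j : ℕ, (ℓ / 2 ^ j) ^ 2 / (η * n / 2 ^ j) = ψ n / 2 ^ j := fun j => by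
    rw [div_pow, hℓ]
    field_simp
  have hlℓ : ∀ j : ℕ, 128 * (ℓ / 2 ^ j) ≤ η * n / 2 ^ j := fun j => by
    rw [← mul_div_assoc]
    gcongr
  have hstep : ∀ k ≤ J, passageTime α S q' (z 0) (z k) ≤ μ * (‖z 0 - o‖ - ‖z k - o‖) +
      E * (1 + D) * (∑ j ∈ Finset.range k, (1 + j : ℝ) ^ (1 / κ₁) * (2 ^ (-κ₃)) ^ j) *
        ψ n * Y ^ (1 / κ₁) := by
    intro k
    induction k with
    | zero => simp [passageTime, pointTime_self_eq_zero (hq _).1]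
    | succ j ih =>
      intro hj
      have hjJ : j ≤ J := by omega
      have e : z j - z (j + 1) = (1 + η / 2 ^ j) • b j - (1 + η / 2 ^ (j + 1)) • b (j + 1) := by
        rw [← hzb, ← hzb]
        abel
      have hpow : η / 2 ^ j - η / 2 ^ (j + 1) = η / 2 ^ j / 2 := by
        rw [pow_succ]
        field_simp
        norm_num
      have hbb : ‖b j - b (j + 1)‖ ≤ 2 * (ℓ / 2 ^ j) := by
        have h1 := norm_sub_le_norm_sub_add_norm_sub (b j) (c - o) (b (j + 1))
        rw [norm_sub_rev (b j) (c - o)] at h1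
        have h2 : ℓ / 2 ^ (j + 1) ≤ ℓ / 2 ^ j := by
          gcongr
          · norm_num
          · omega
        linarith [hbc j, hbc (j + 1)]
      obtain ⟨g1, g2, g3⟩ := norm_link_bounds (a := b j) (b := b (j + 1)) (A := 1 + η / 2 ^ j)
        (A' := 1 + η / 2 ^ (j + 1)) hn0 (hG0 j) (by linarith [hη3 (j + 1)]) (by linarith [hη2 j])
        (by
          have : η * n / 2 ^ j / (2 * n) = η / 2 ^ j / 2 := by field_simp
          linarith)
        (by
          have : η * n / 2 ^ j / n = η / 2 ^ j := by field_simp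
          linarith [hη3 j]) (hb1 j) (hb2 j) hbb (hlℓ j)
      rw [← e] at g1 g2 g3
      rw [hsq, ← hzb, ← hzb] at g3
      have hW0 : 0 ≤ β + chainWeight (j, v j, v (j + 1)) := add_nonneg hβ (chainWeight_nonneg _)
      have hW := chainWeight_le hβ hY (hWv j) (hWv (j + 1))
      -- The factor 9 comes from 1 + j ≤ 3 log n and Y ≤ 3 log n.
      have hjlog : (1 + j : ℝ) * Y ≤ 9 * Real.log n ^ 2 := by
        have h1 : (1 + j : ℝ) ≤ 3 * Real.log n := by
          have : (j : ℝ) ≤ J := by exact_mod_cast hjJ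
          linarith [hJ.depth_le]
        calc (1 + j : ℝ) * Y ≤ (3 * Real.log n) * (3 * Real.log n) := by gcongr
          _ = _ := by ring
      have hT := IsTypical.abs_le M hβ hJ (ht.link j (v j) (v (j + 1))) hW0
        (hW.trans (by gcongr)) hn0 (by
          have := hG' j hjJ
          change _ ≤ ‖z j - z (j + 1)‖
          linarith)
      have hlink := M.link_le (hJ.r₀_le) hn hη0 hη (hG' j hjJ) hγ g1 g2 g3
        (deviation_nonneg ha hW0) hT
      have hdev : deviation a κ₁ (β + chainWeight (j, v j, v (j + 1))) ≤
          D * ((1 + j : ℝ) ^ (1 / κ₁) * Y ^ (1 / κ₁)) := by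
        refine (deviation_le ha hκ₁ hW0 hW).trans (le_of_eq ?_)
        rw [deviation_mul ha hC (by positivity), Real.mul_rpow (by positivity) (by positivity)]
      have hjp : 1 ≤ (1 + j : ℝ) ^ (1 / κ₁) :=
        Real.one_le_rpow (by linarith [hj0 j]) (by positivity)
      have h1D : 1 + deviation a κ₁ (β + chainWeight (j, v j, v (j + 1))) ≤
          (1 + D) * ((1 + j : ℝ) ^ (1 / κ₁) * Y ^ (1 / κ₁)) := by
        have := one_le_mul_of_one_le_of_one_le hjp hYp
        linarith
      have h1E : E * (1 + deviation a κ₁ (β + chainWeight (j, v j, v (j + 1)))) *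
          (2 ^ (-κ₃)) ^ j * ψ n ≤ E * ((1 + D) * ((1 + j : ℝ) ^ (1 / κ₁) * Y ^ (1 / κ₁))) *
          (2 ^ (-κ₃)) ^ j * ψ n := by gcongr
      have htri : passageTime α S q' (z 0) (z (j + 1)) ≤
          passageTime α S q' (z 0) (z j) + passageTime α S q' (z j) (z (j + 1)) :=
        pointTime_triangle (hq _).1 (hq _).1 (hq _).1
      rw [Finset.sum_range_succ]
      have := ih hjJ
      linarith
  have hθ1 : (2 : ℝ) ^ (-κ₃) < 1 := Real.rpow_lt_one_of_one_lt_of_neg (by norm_num) (by linarith)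
  have hpartial : ∑ j ∈ Finset.range J, (1 + j : ℝ) ^ (1 / κ₁) * (2 ^ (-κ₃)) ^ j ≤
      ∑' j : ℕ, (1 + j : ℝ) ^ (1 / κ₁) * (2 ^ (-κ₃)) ^ j :=
    (summable_succ_rpow_mul_geometric (by positivity) hθ1).sum_le_tsum _
      fun j _ => by positivity
  -- The last link ends at the unit lattice, whose index may be as large as n, so its weight is only
  -- O((log n)²). The factor 2^(-κ₃ J) outweighs this loss.
  have hlast : passageTime α S q' (z J) (u + latticePoint 1 w) ≤
      μ * (‖z J - o‖ - ‖b'‖) + E * ψ n := by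
    have e : z J - (u + latticePoint 1 w) = (1 + η / 2 ^ J) • b J - (1 : ℝ) • b' := by
      rw [← hzb, one_smul]
      simp only [hb']
      abel
    have hbb : ‖b J - b'‖ ≤ 2 * (ℓ / 2 ^ J) := by
      have h1 := norm_sub_le_norm_sub_add_norm_sub (b J) (c - o) b'
      rw [norm_sub_rev (b J) (c - o)] at h1
      have h2 : 1 ≤ ℓ / 2 ^ J := by rwa [one_le_div (by positivity)]
      linarith [hbc J]
    obtain ⟨g1, g2, g3⟩ := norm_link_bounds (a := b J) (b := b') (A := 1 + η / 2 ^ J)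
      (A' := 1) hn0 (hG0 J) le_rfl (by linarith [hη2 J])
      (by
        have : η * n / 2 ^ J / (2 * n) = η / 2 ^ J / 2 := by field_simp
        linarith [hη3 J])
      (by
        have : η * n / 2 ^ J / n = η / 2 ^ J := by field_simp
        linarith [hη3 J]) (hb1 J) (hb2 J) hbb (hlℓ J)
    rw [← e] at g1 g2 g3
    rw [hsq, ← hzb, one_smul] at g3
    have hW0 : 0 ≤ β + (latticeWeight (v J) + latticeWeight w) :=
      add_nonneg hβ (add_nonneg (latticeWeight_nonneg _) (latticeWeight_nonneg _))
    have hL := latticeConst_nonneg (d := d)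
    have hlog2 : Real.log n ≤ Real.log n ^ 2 := by nlinarith
    have hWJ : latticeWeight (v J) ≤ latticeConst d * (9 * Real.log n ^ 2) := by
      refine (hWv J).trans (mul_le_mul_of_nonneg_left ?_ hL)
      calc (1 + J : ℝ) * Y ≤ (3 * Real.log n) * (3 * Real.log n) := by
            have := hJ.depth_le
            gcongr
        _ = _ := by ring
    have hcu : ‖c - u‖ ≤ 5 * n := by
      have := norm_sub_le_norm_sub_add_norm_sub c o u
      rw [norm_sub_rev o u] at this
      linarith
    have hWw : latticeWeight w ≤ latticeConst d * (9 * Real.log n ^ 2) := by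
      have h1 : ‖latticePoint 1 w‖ ≤ 1 * (6 * n) := by
        have e : latticePoint 1 w = (c - u) - (c - (u + latticePoint 1 w)) := by abel
        calc ‖latticePoint 1 w‖ = ‖(c - u) - (c - (u + latticePoint 1 w))‖ := by rw [← e]
          _ ≤ 5 * n + 1 := (norm_sub_le _ _).trans (add_le_add hcu hw)
          _ ≤ _ := by linarith
      refine (latticeWeight_le_log one_pos (by linarith) h1).trans ?_
      have h2 : 0 ≤ Real.log (2 + d) := Real.log_nonneg (by linarith [hj0 d])
      have h3 := hJ.log_le
      calc 2 * (d : ℝ) * (Real.log (2 + d) + Real.log (2 + 6 * n))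
          ≤ 2 * d * ((Real.log (2 + d) + 2) * (9 * Real.log n ^ 2)) := by
            gcongr
            nlinarith
        _ = _ := by
          unfold latticeConst
          ring
    have hW : β + (latticeWeight (v J) + latticeWeight w) ≤
        weightConst d β * (9 * Real.log n ^ 2) := by
      have h1 : β ≤ β * (9 * Real.log n ^ 2) := le_mul_of_one_le_right hβ (by nlinarith)
      have h2 : 0 ≤ latticeConst d * (9 * Real.log n ^ 2) := by positivity
      unfold weightConst
      nlinarith [sq_nonneg (Real.log n)]
    have hT := IsTypical.abs_le M hβ hJ (ht.last (v J) w) hW0 hW hn0 (by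
        have := hG' J le_rfl
        change _ ≤ ‖z J - (u + latticePoint 1 w)‖
        linarith)
    have hlink := M.link_le (hJ.r₀_le) hn hη0 hη (hG' J le_rfl) hγ g1 g2 g3
      (deviation_nonneg ha hW0) hT
    refine hlink.trans ?_
    have hdev : deviation a κ₁ (β + (latticeWeight (v J) + latticeWeight w)) ≤
        deviation a κ₁ (9 * weightConst d β) * (Real.log n ^ 2) ^ (1 / κ₁) := by
      rw [← deviation_mul ha (by positivity) (by positivity)]
      exact deviation_le ha hκ₁ hW0 (by linarith)
    have h1 : (1 + deviation a κ₁ (β + (latticeWeight (v J) + latticeWeight w))) *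
        ((2 : ℝ) ^ (-κ₃)) ^ J ≤ 1 := by
      refine le_trans ?_ hJ.last_le
      gcongr
    have h2 := mul_le_mul_of_nonneg_left h1 (by positivity : 0 ≤ E * ψ n)
    linarith
  have htri : passageTime α S q' (z 0) (u + latticePoint 1 w) ≤
      passageTime α S q' (z 0) (z J) + passageTime α S q' (z J) (u + latticePoint 1 w) :=
    pointTime_triangle (hq _).1 (hq _).1 (hq _).1
  have h1 := hstep J le_rfl
  have h2 : E * (1 + D) * (∑ j ∈ Finset.range J, (1 + j : ℝ) ^ (1 / κ₁) * (2 ^ (-κ₃)) ^ j) *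
      ψ n * Y ^ (1 / κ₁) ≤ E * (1 + D) * (∑' j : ℕ, (1 + j : ℝ) ^ (1 / κ₁) * (2 ^ (-κ₃)) ^ j) *
      ψ n * Y ^ (1 / κ₁) := by gcongr
  have h3 : E * ψ n ≤ E * ψ n * Y ^ (1 / κ₁) := le_mul_of_one_le_right (by positivity) hYp
  linarith

end Chain

end EuclideanFPP

namespace EuclideanFPP

/-! ### Lower bounds for passage times from the chains. -/

section LowerBound

variable {Ω : Type*} [MeasurableSpace Ω] {P : Measure Ω} {d : ℕ} [NeZero d] {α : ℝ}
  {Q : Ω → Set (EuclideanSpace ℝ (Fin d))}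
  {q : Ω → EuclideanSpace ℝ (Fin d) → EuclideanSpace ℝ (Fin d)} {ψ h : ℝ → ℝ}
  {μ κ₁ κ₃ κ a A r₀ : ℝ} {S : Set (EuclideanSpace ℝ (Fin d))}
  {q' : EuclideanSpace ℝ (Fin d) → EuclideanSpace ℝ (Fin d)}

/-- The constant in the lower bound for passage times that the chains provide. -/
noncomputable def chainConst (d : ℕ) (μ κ₁ κ₃ a A β : ℝ) : ℝ :=
  16 * deviation a κ₁ (weightConst d β) + 2 +
    (128 * μ + 8 * A) * (1 + (1 + deviation a κ₁ (weightConst d β)) *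
      ∑' j : ℕ, (1 + j : ℝ) ^ (1 / κ₁) * (2 ^ (-κ₃)) ^ j)

omit [NeZero d] in
lemma IsConcentratedModel.chainConst_nonneg
    (M : IsConcentratedModel P α Q q ψ h μ κ₁ κ₃ κ a A r₀) {β : ℝ} (hβ : 0 ≤ β) :
    0 ≤ chainConst d μ κ₁ κ₃ a A β := by
  have h1 := deviation_nonneg (κ₁ := κ₁) M.a_pos (weightConst_nonneg (d := d) hβ)
  have h2 := M.μ_nonneg
  have h3 := M.one_le_A
  have h4 : 0 ≤ ∑' j : ℕ, (1 + j : ℝ) ^ (1 / κ₁) * ((2 : ℝ) ^ (-κ₃)) ^ j :=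
    tsum_nonneg fun j => by positivity
  unfold chainConst
  positivity

/-- The logarithmic correction at a point at distance `w` from the centre of the chains. -/
noncomputable def chainLog (ψ : ℝ → ℝ) (n η w : ℝ) : ℝ :=
  Real.log ((2 + w / √(η * n * ψ n)) / η)

set_option maxHeartbeats 1000000 in
-- The coarse point z₀ at distance `ρ` is typical, so T(o,z₀) is close to h(ρ). Subtracting the
-- upper bound for T(z₀,c) along the chain leaves the lower bound for T(o,c), with `ρ` slightly
-- larger than ‖c - o‖.
lemma IsConcentratedModel.le_pointTime_of_isChainTypical
    (M : IsConcentratedModel P α Q q ψ h μ κ₁ κ₃ κ a A r₀) (hq : IsClosestPointMap S q')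
    {β n η : ℝ} {J : ℕ} (hβ : 0 ≤ β)
    (hJ : IsDepth ψ α μ κ₁ κ₃ κ r₀ (deviation a κ₁ (9 * weightConst d β)) n J)
    (hn : 1 ≤ n) (hη : η ≤ 1 / 4) (hN : n ^ (1 - κ₃ / 4) ≤ η * n)
    (hγ : ∀ r, n ^ (1 / 2 : ℝ) ≤ r → r ≤ 8 * n → h r - r * μ ≤ η ^ (-κ₃) * ψ r)
    {o u c : EuclideanSpace ℝ (Fin d)} (hu : ‖u - o‖ = n) (hc : c ∈ S) (hc1 : n / 2 ≤ ‖c - o‖)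
    (hc2 : ‖c - o‖ ≤ 4 * n)
    (ht : IsChainTypical α S q' ψ h κ₁ κ a r₀ β o u η (√(η * n * ψ n)) J) :
    ∃ ρ, |ρ - (1 + η) * ‖c - o‖| ≤ η * n / 64 ∧
      h ρ - ρ * μ + μ * ‖c - o‖ -
        chainConst d μ κ₁ κ₃ a A β * ψ n * chainLog ψ n η ‖c - u‖ ^ (1 / κ₁) ≤
      pointTime α S (q' o) c := by
  have hκ₁ := M.κ₁_pos
  have hκ₃ := M.κ₃_pos
  have hμ := M.μ_nonneg
  have hA := M.one_le_A
  have ha := M.a_pos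
  have hn0 : 0 < n := by linarith
  have hlog := hJ.one_le_log
  have hψ := hJ.one_le_scale
  have hN1 : 1 ≤ n ^ (1 - κ₃ / 4) := Real.one_le_rpow hn (by linarith [M.κ₃_lt])
  have hηn0 : 0 < η * n := by linarith
  have hη0 : 0 < η := pos_of_mul_pos_left hηn0 hn0.le
  have hℓpos : 0 < η * n * ψ n := by positivity
  unfold chainLog
  set ℓ := √(η * n * ψ n) with hℓdef
  have hℓ : ℓ ^ 2 = η * n * ψ n := Real.sq_sqrt hℓpos.le
  have hℓ0 : 0 < ℓ := Real.sqrt_pos.2 hℓpos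
  -- Since ℓ² = η n ψ(n), this amounts to 128² ψ(n) = 16384 ψ(n) ≤ η n.
  have hℓn : 128 * ℓ ≤ η * n := by
    refine le_of_sq_le_sq ?_ hηn0.le
    have := hJ.scale_le
    nlinarith
  have hℓJ : 2 ^ J ≤ ℓ := by
    refine le_of_sq_le_sq ?_ hℓ0.le
    have := hJ.pow_le
    nlinarith
  have hℓ1 : 1 ≤ ℓ := le_trans (one_le_pow₀ (by norm_num)) hℓJ
  have hcu : ‖c - u‖ ≤ 5 * n := by
    have := norm_sub_le_norm_sub_add_norm_sub c o u
    rw [norm_sub_rev o u] at this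
    linarith
  have hX : ‖c - u‖ / ℓ ≤ 5 * n := (div_le_self (norm_nonneg _) hℓ1).trans hcu
  have hX0 : 0 ≤ ‖c - u‖ / ℓ := by positivity
  set X := ‖c - u‖ / ℓ with hXdef
  have hXη : 2 + X ≤ (2 + X) / η := le_div_self (by linarith) hη0 (by linarith)
  have h8 : 8 ≤ (2 + X) / η := by
    rw [le_div_iff₀ hη0]
    linarith
  set Y := Real.log ((2 + X) / η) with hYdef
  have hXY : Real.log (2 + X) ≤ Y := Real.log_le_log (by linarith) hXη
  have hY : 1 ≤ Y := by
    have h1 := Real.log_le_log (by norm_num) h8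
    rw [show (8 : ℝ) = 2 ^ 3 by norm_num, Real.log_pow] at h1
    have h2 := Real.log_two_gt_d9
    push_cast at h1
    linarith
  have hYn : Y ≤ 3 * Real.log n := by
    have h1 : (2 + X) / η ≤ n ^ 3 := by
      rw [div_le_iff₀ hη0]
      have h2 := hJ.add_le
      have h3 : n ^ 2 * 1 ≤ n ^ 2 * (η * n) := by
        gcongr
        linarith
      linarith
    have h4 := Real.log_le_log (by linarith) h1
    rw [Real.log_pow] at h4
    exact_mod_cast h4
  have hG : 16 * 2 ^ J * n ^ (1 / 2 : ℝ) ≤ η * n := hJ.sqrt_le.trans hN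
  have hvex : ∀ j : ℕ, ∃ v : Fin d → ℤ, ‖c - (u + latticePoint (ℓ / 2 ^ j) v)‖ ≤ ℓ / 2 ^ j := by
    intro j
    obtain ⟨v, hv⟩ := exists_latticePoint_near (by positivity : 0 < ℓ / 2 ^ j) (c - u)
    exact ⟨v, by rwa [← sub_sub]⟩
  choose v hv using hvex
  obtain ⟨w, hw⟩ := exists_latticePoint_near one_pos (c - u)
  rw [sub_sub] at hw
  have hchain := M.chain_le hq hβ hJ hn hη0 hη hG hγ hℓ hℓ0 hℓn hℓJ hY hYn hu hc1 hc2 hXY ht hv hw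
  have hYp : 1 ≤ Y ^ (1 / κ₁) := Real.one_le_rpow hY (by positivity)
  have hC := weightConst_nonneg (d := d) hβ
  have hD := deviation_nonneg (κ₁ := κ₁) ha hC
  have hv0 := hv 0
  simp only [pow_zero, div_one] at hv0
  have hz0 : chainPoint o u η ℓ 0 (v 0) - o = (1 + η) • (u + latticePoint ℓ (v 0) - o) := by
    simp only [chainPoint, pow_zero, div_one]
    abel
  set b := u + latticePoint ℓ (v 0) - o with hb
  have hbn : |‖b‖ - ‖c - o‖| ≤ ℓ := by
    refine (abs_norm_sub_norm_le _ _).trans ?_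
    rw [norm_sub_rev]
    have e : c - o - b = c - (u + latticePoint ℓ (v 0)) := by
      simp only [hb]
      abel
    rwa [e]
  have hz0n : ‖chainPoint o u η ℓ 0 (v 0) - o‖ = (1 + η) * ‖b‖ := by
    rw [hz0, norm_smul, Real.norm_of_nonneg (by linarith)]
  set ρ := ‖chainPoint o u η ℓ 0 (v 0) - o‖ with hρ
  obtain ⟨hbn1, hbn2⟩ := abs_le.1 hbn
  have hηn : η * n ≤ 1 / 4 * n := mul_le_mul_of_nonneg_right hη hn0.le
  have hρ1 : n / 4 ≤ ρ := by
    rw [hz0n]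
    have := le_mul_of_one_le_left (norm_nonneg b) (by linarith : 1 ≤ 1 + η)
    linarith
  have hρ2 : ρ ≤ 16 * n := by
    rw [hz0n]
    have := mul_le_mul_of_nonneg_right (by linarith : 1 + η ≤ 2) (norm_nonneg b)
    linarith
  refine ⟨ρ, ?_, ?_⟩
  · rw [hz0n, ← mul_sub, abs_mul, abs_of_nonneg (by linarith : 0 ≤ 1 + η)]
    calc (1 + η) * |‖b‖ - ‖c - o‖| ≤ 2 * ℓ := by
          gcongr
          linarith
      _ ≤ _ := by linarith
  have hW := latticeWeight_le_of_near hℓ0 (by rw [hXdef, div_mul_cancel₀ _ hℓ0.ne'])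
    hX0 hY hXY (hv 0)
  have hbound : β + latticeWeight (v 0) ≤ weightConst d β * Y := by
    have h1 : β ≤ β * Y := le_mul_of_one_le_right hβ hY
    have h2 : 0 ≤ latticeConst d * Y := mul_nonneg latticeConst_nonneg (by linarith)
    simp only [Nat.cast_zero, add_zero, one_mul] at hW
    unfold weightConst
    nlinarith
  have hW0 : 0 ≤ β + latticeWeight (v 0) := add_nonneg hβ (latticeWeight_nonneg _)
  have hsq : 16 * n ^ (1 / 2 : ℝ) ≤ η * n := by
    refine le_trans ?_ hG
    have h0 : 0 ≤ n ^ (1 / 2 : ℝ) := by positivity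
    have h1 := mul_le_mul_of_nonneg_right (one_le_pow₀ (by norm_num) : (1 : ℝ) ≤ 2 ^ J) h0
    linarith
  have hs0 : 0 ≤ n ^ (1 / 2 : ℝ) := by positivity
  have hT := IsTypical.abs_le M hβ hJ (ht.start (v 0)) hW0 (hbound.trans (by
      gcongr
      nlinarith)) hn0 (by
    rw [norm_sub_rev, ← hρ]
    linarith)
  rw [norm_sub_rev, ← hρ] at hT
  have hr₀n : r₀ ≤ n := by linarith [hJ.r₀_le]
  -- Four doublings; this is the 16 in `chainConst`. The 2 there pays for the step from `c` to the
  -- nearby lattice point and for the change of its distance to `o`.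
  have hψρ : ψ ρ ≤ 16 * ψ n := by
    have h4 := M.scale.mono ρ (2 * (2 * (2 * (2 * n)))) (by linarith [hJ.r₀_le]) (by linarith)
    have h5 := M.scale_two_mul_le (r := n) (s := 2 * n) hr₀n (by linarith) le_rfl
    have h6 := M.scale_two_mul_le (r := 2 * n) (s := 2 * (2 * n)) (by linarith) (by linarith) le_rfl
    have h7 := M.scale_two_mul_le (r := 2 * (2 * n)) (s := 2 * (2 * (2 * n))) (by linarith)
      (by linarith) le_rfl
    have h8 := M.scale_two_mul_le (r := 2 * (2 * (2 * n))) (s := 2 * (2 * (2 * (2 * n))))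
      (by linarith) (by linarith) le_rfl
    linarith
  have hdev : deviation a κ₁ (β + latticeWeight (v 0)) ≤
      deviation a κ₁ (weightConst d β) * Y ^ (1 / κ₁) := by
    rw [← deviation_mul ha hC (by linarith)]
    exact deviation_le ha hκ₁ hW0 hbound
  have hdevψ : deviation a κ₁ (β + latticeWeight (v 0)) * ψ ρ ≤
      deviation a κ₁ (weightConst d β) * Y ^ (1 / κ₁) * (16 * ψ n) := by
    have := (M.scale.pos ρ (by linarith [hJ.r₀_le])).le
    gcongr
  have h1 := (abs_le.1 hT).1
  have h2 : passageTime α S q' o (chainPoint o u η ℓ 0 (v 0)) ≤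
      pointTime α S (q' o) c + pointTime α S c (q' (chainPoint o u η ℓ 0 (v 0))) :=
    pointTime_triangle (hq _).1 hc (hq _).1
  have h3 : pointTime α S (q' (chainPoint o u η ℓ 0 (v 0))) c ≤
      passageTime α S q' (chainPoint o u η ℓ 0 (v 0)) (u + latticePoint 1 w) +
        pointTime α S (q' (u + latticePoint 1 w)) c :=
    pointTime_triangle (hq _).1 (hq _).1 hc
  rw [pointTime_comm hc (hq _).1] at h2
  have h4 := pointTime_le_add_of_near (α := α) (by linarith [M.one_lt_α]) hq hc hw
  rw [pointTime_comm hc (hq _).1] at h4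
  have h5 := hJ.rpow_le_scale
  have h6 : ‖c - o‖ - 1 ≤ ‖u + latticePoint 1 w - o‖ := by
    have h7 := norm_sub_le_norm_sub_add_norm_sub c (u + latticePoint 1 w) o
    linarith
  have h7 := mul_le_mul_of_nonneg_left h6 hμ
  have h8 := hJ.le_scale
  have h9 : ψ n ≤ ψ n * Y ^ (1 / κ₁) := le_mul_of_one_le_right (by linarith) hYp
  unfold chainConst
  linarith

/-- The lower bound for passage times from a neighbourhood of `o` that the chains provide. -/
def HasChainBound (α : ℝ) (S : Set (EuclideanSpace ℝ (Fin d)))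
    (q : EuclideanSpace ℝ (Fin d) → EuclideanSpace ℝ (Fin d)) (ψ h : ℝ → ℝ) (μ κ₁ C n η : ℝ)
    (o u : EuclideanSpace ℝ (Fin d)) : Prop :=
  ∀ c ∈ S, n / 2 ≤ ‖c - o‖ → ‖c - o‖ ≤ 4 * n →
    ∃ ρ, |ρ - (1 + η) * ‖c - o‖| ≤ η * n / 64 ∧
      h ρ - ρ * μ + μ * ‖c - o‖ - C * ψ n * chainLog ψ n η ‖c - u‖ ^ (1 / κ₁) ≤
        pointTime α S (q o) c

lemma IsConcentratedModel.exists_chain_lower_bound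
    (M : IsConcentratedModel P α Q q ψ h μ κ₁ κ₃ κ a A r₀) : ∃ C : ℝ, 0 ≤ C ∧
      ∀ᶠ n : ℝ in atTop, ∀ η, η ≤ 1 / 4 → n ^ (1 - κ₃ / 4) ≤ η * n →
        (∀ r, n ^ (1 / 2 : ℝ) ≤ r → r ≤ 8 * n → h r - r * μ ≤ η ^ (-κ₃) * ψ r) →
        ∀ o u : EuclideanSpace ℝ (Fin d), ‖u - o‖ = n →
          P {ω | ¬ (IsClosestPointMap (Q ω) (q ω) →
            HasChainBound α (Q ω) (q ω) ψ h μ κ₁ C n η o u)} ≤ ENNReal.ofReal (1 / 4) := by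
  obtain ⟨β, hβ, hP⟩ := M.exists_measure_not_isChainTypical_le
  refine ⟨chainConst d μ κ₁ κ₃ a A β, M.chainConst_nonneg hβ, ?_⟩
  filter_upwards [M.eventually_exists_isDepth (deviation a κ₁ (9 * weightConst d β)), eventually_ge_atTop 1]
    with n ⟨J, hJ⟩ hn η hη hN hγ o u hu
  refine le_trans (measure_mono ?_) (hP o u η (√(η * n * ψ n)) J)
  intro ω hω ht
  exact hω fun hq c hc hc1 hc2 =>
    M.le_pointTime_of_isChainTypical hq hβ hJ hn hη hN hγ hu hc hc1 hc2 ht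

end LowerBound

end EuclideanFPP

namespace EuclideanFPP

/-! ### Confinement of the crossing points and the improved halving inequality. -/

section Step

/-- The logarithmic term grows at most linearly in (2 + X)/η, so the hypothesis bounds X by a
multiple of η^(-2). Then (2 + X)/η is polynomial in 1/η, and its logarithm is comparable to
log(1/η). -/
lemma exists_rpow_log_le {κ K : ℝ} (hκ : 0 < κ) (hK : 0 ≤ K) : ∃ C : ℝ, 0 ≤ C ∧
    ∀ η X : ℝ, 0 < η → η ≤ 1 / 4 → 0 ≤ X →
      X ^ 2 * η ≤ K * (η⁻¹ + Real.log ((2 + X) / η) ^ (1 / κ)) →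
      Real.log ((2 + X) / η) ^ (1 / κ) ≤ C * Real.log (1 / η) ^ (1 / κ) := by
  set c := κ⁻¹ ^ (1 / κ) with hc
  have hc0 : 0 ≤ c := by positivity
  set K' := K * (1 + c) with hK'
  have hK'0 : 0 ≤ K' := by positivity
  have hlogK : 0 ≤ Real.log (K' + 4) := Real.log_nonneg (by linarith)
  refine ⟨(Real.log (K' + 4) + 3) ^ (1 / κ), by positivity, fun η X hη0 hη hX h => ?_⟩
  have hη1 : 1 ≤ η⁻¹ := (one_le_inv₀ hη0).2 (by linarith)
  have ht : 1 ≤ (2 + X) / η := by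
    rw [le_div_iff₀ hη0]
    linarith
  have hlog0 : 0 ≤ Real.log ((2 + X) / η) := Real.log_nonneg ht
  have h1 : Real.log ((2 + X) / η) ^ (1 / κ) ≤ c * ((2 + X) / η) := by
    calc Real.log ((2 + X) / η) ^ (1 / κ) ≤ (((2 + X) / η) ^ κ / κ) ^ (1 / κ) := by
          gcongr
          exact Real.log_le_rpow_div (by linarith) hκ
      _ = c * ((2 + X) / η) := by
        rw [div_eq_inv_mul, Real.mul_rpow (by positivity) (by positivity),
          ← Real.rpow_mul (by linarith), mul_one_div_cancel hκ.ne', Real.rpow_one]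
  have h2 : X ^ 2 * η ≤ K' * (2 + X) * η⁻¹ := by
    refine h.trans ?_
    calc K * (η⁻¹ + Real.log ((2 + X) / η) ^ (1 / κ))
        ≤ K * ((2 + X) * η⁻¹ + c * ((2 + X) * η⁻¹)) := by
          rw [div_eq_mul_inv] at h1 ⊢
          gcongr
          exact le_mul_of_one_le_left (by positivity) (by linarith)
      _ = _ := by ring
  set e := η⁻¹ ^ 2 with he
  have he1 : 1 ≤ e := one_le_pow₀ hη1
  have h3 : X ^ 2 ≤ K' * e * (2 + X) := by
    calc X ^ 2 = (X ^ 2 * η) * η⁻¹ := by field_simp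
      _ ≤ K' * (2 + X) * η⁻¹ * η⁻¹ := by gcongr
      _ = _ := by rw [he]; ring
  have h4 : X ≤ K' * e + 2 := by
    by_contra! hcon
    nlinarith [mul_nonneg hK'0 (by linarith : 0 ≤ e)]
  have h5 : (2 + X) / η ≤ (K' + 4) * (1 / η) ^ 3 := by
    calc (2 + X) / η = (2 + X) * η⁻¹ := div_eq_mul_inv _ _
      _ ≤ ((K' + 4) * e) * η⁻¹ := by
        gcongr
        nlinarith
      _ = _ := by rw [he]; ring
  have hL : 1 ≤ Real.log (1 / η) := by
    have h6 : 4 ≤ 1 / η := by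
      rw [le_div_iff₀ hη0]
      linarith
    have h7 := Real.log_le_log (by norm_num) h6
    rw [show (4 : ℝ) = 2 ^ 2 by norm_num, Real.log_pow] at h7
    have h8 := Real.log_two_gt_d9
    push_cast at h7
    linarith
  rw [← Real.mul_rpow (by positivity) (by linarith)]
  apply Real.rpow_le_rpow hlog0 _ (by positivity)
  refine (Real.log_le_log (by linarith) h5).trans ?_
  rw [Real.log_mul (by positivity) (by positivity), Real.log_pow]
  push_cast
  nlinarith

variable {Ω : Type*} [MeasurableSpace Ω] {P : Measure Ω} {d : ℕ} [NeZero d] {α : ℝ}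
  {Q : Ω → Set (EuclideanSpace ℝ (Fin d))}
  {q : Ω → EuclideanSpace ℝ (Fin d) → EuclideanSpace ℝ (Fin d)} {ψ h : ℝ → ℝ}
  {μ κ₁ κ₃ κ a A r₀ : ℝ} {S : Set (EuclideanSpace ℝ (Fin d))}
  {q' : EuclideanSpace ℝ (Fin d) → EuclideanSpace ℝ (Fin d)}

omit [NeZero d] in
lemma chainLog_nonneg {n η w : ℝ} (hη0 : 0 < η) (hη : η ≤ 1) (hw : 0 ≤ w) :
    0 ≤ chainLog ψ n η w := by
  have h1 : 0 ≤ w / √(η * n * ψ n) := by positivity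
  refine Real.log_nonneg ?_
  rw [le_div_iff₀ hη0]
  linarith

omit [NeZero d] in
-- Adding the two lower bounds and discarding γ(ρ), γ(ρ') ≥ 0 bounds μ times the excess length of
-- the detour through `c` by γ(2n) and errors of order ψ(n). The excess length is at least of order
-- ‖c - u‖²/n, whence the division by `μ`.
lemma IsConcentratedModel.sq_mul_le_of_hasChainBound
    (M : IsConcentratedModel P α Q q ψ h μ κ₁ κ₃ κ a A r₀) (hμ : 0 < μ) {C₁ C₂ n η s : ℝ}
    (hC₁ : 0 ≤ C₁) (hC₂ : 0 ≤ C₂) (hn : 0 < n) (hr₀ : r₀ ≤ n) (hη0 : 0 < η) (hη : η ≤ 1 / 4)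
    (hs : 0 ≤ s) (hsn : 2 * s ≤ n) (hsψ : μ * s ≤ ψ n)
    (hγ : h (2 * n) - 2 * n * μ ≤ η ^ (-κ₃) * ψ (2 * n))
    {o o' u c : EuclideanSpace ℝ (Fin d)} (hu : ‖u - o‖ = n)
    (ho' : o' - o = (2 : ℝ) • (u - o)) (hcS : c ∈ S) (hc : |‖c - o‖ - n| ≤ s)
    (hb : HasChainBound α S q' ψ h μ κ₁ C₁ n η o u)
    (hb' : HasChainBound α S q' ψ h μ κ₁ C₁ n η o' u)
    (hle : pointTime α S (q' o) c + pointTime α S (q' o') c ≤ h (2 * n) + C₂ * ψ n) :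
    (‖c - u‖ / √(η * n * ψ n)) ^ 2 * η ≤
      5 * (6 + C₂ + 2 * C₁) / (2 * μ) * (η⁻¹ + chainLog ψ n η ‖c - u‖ ^ (1 / κ₁)) := by
  have hκ₃ := M.κ₃_pos
  have hψ := M.scale.pos n hr₀
  obtain ⟨hc1, hc2⟩ := abs_le.1 hc
  have hoo : ‖o' - o‖ = 2 * n := by
    rw [ho', norm_smul, hu, Real.norm_of_nonneg (by norm_num)]
  have hco1 : 2 * n ≤ ‖c - o'‖ + ‖c - o‖ := by
    have h1 := norm_sub_le_norm_sub_add_norm_sub o' c o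
    rwa [hoo, norm_sub_rev o' c] at h1
  have hco2 : ‖c - o'‖ ≤ ‖c - o‖ + 2 * n := by
    have h1 := norm_sub_le_norm_sub_add_norm_sub c o o'
    rwa [norm_sub_rev o o', hoo] at h1
  have hgeo := norm_add_norm_sub_ge (c := c - o) (u := u - o) hn hs (by linarith) hc hu
  rw [← ho', sub_sub_sub_cancel_right, sub_sub_sub_cancel_right] at hgeo
  obtain ⟨ρ, hρ1, hρ2⟩ := hb c hcS (by linarith) (by linarith)
  obtain ⟨ρ', hρ1', hρ2'⟩ := hb' c hcS (by linarith) (by linarith)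
  have hηn : η * n ≤ 1 / 4 * n := mul_le_mul_of_nonneg_right hη hn.le
  have hρ0 : 0 ≤ ρ := by
    have h1 := (abs_le.1 hρ1).1
    have h2 := mul_nonneg hη0.le (norm_nonneg (c - o))
    linarith
  have hρ0' : 0 ≤ ρ' := by
    have h1 := (abs_le.1 hρ1').1
    have h2 := mul_nonneg hη0.le (norm_nonneg (c - o'))
    linarith
  have h1 := M.h_ge ρ hρ0
  have h2 := M.h_ge ρ' hρ0'
  have hη1 : η ^ (-κ₃) ≤ η⁻¹ := by
    rw [← Real.rpow_neg_one]
    exact Real.rpow_le_rpow_of_exponent_ge hη0 (by linarith) (by linarith [M.κ₃_lt])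
  have hψ2 : ψ (2 * n) ≤ 2 * ψ n := M.scale_two_mul_le hr₀ (by linarith) le_rfl
  have h3 : η ^ (-κ₃) * ψ (2 * n) ≤ η⁻¹ * (2 * ψ n) := by
    have := (M.scale.pos (2 * n) (by linarith)).le
    gcongr
  have hηi : 1 ≤ η⁻¹ := (one_le_inv₀ hη0).2 (by linarith)
  have hL := chainLog_nonneg (ψ := ψ) (n := n) hη0 (by linarith) (norm_nonneg (c - u))
  set L := chainLog ψ n η ‖c - u‖ ^ (1 / κ₁) with hLdef
  have hL0 : 0 ≤ L := by positivity
  have hkey : μ * (2 * ‖c - u‖ ^ 2 / (5 * n)) ≤ (6 + C₂ + 2 * C₁) * (η⁻¹ + L) * ψ n := by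
    have h4 : μ * (2 * ‖c - u‖ ^ 2 / (5 * n) - 4 * s) ≤ μ * (‖c - o‖ + ‖c - o'‖ - 2 * n) :=
      mul_le_mul_of_nonneg_left (by linarith) hμ.le
    have h5 : (4 + C₂) * ψ n ≤ (4 + C₂) * ψ n * η⁻¹ := le_mul_of_one_le_right (by positivity) hηi
    have h6 : 0 ≤ (6 + C₂) * L * ψ n := by positivity
    have h7 : 0 ≤ 2 * C₁ * η⁻¹ * ψ n := by positivity
    linarith
  have hpos : 0 < η * n * ψ n := by positivity
  rw [div_pow, Real.sq_sqrt hpos.le]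
  calc ‖c - u‖ ^ 2 / (η * n * ψ n) * η
      = μ * (2 * ‖c - u‖ ^ 2 / (5 * n)) * (5 / (2 * μ * ψ n)) := by field_simp
    _ ≤ (6 + C₂ + 2 * C₁) * (η⁻¹ + L) * ψ n * (5 / (2 * μ * ψ n)) := by gcongr
    _ = _ := by field_simp

/-- Once both crossing points are confined near the midpoint, the chain bounds hold with error of
order ψ(n) log(1/η)^(1/κ₁). Adding them gives h(2n) ≥ 2nμ + γ(ρ) + γ(ρ') up to that error, with ρ
and ρ' close to (1 + η)n. -/
lemma IsConcentratedModel.eventually_step [IsProbabilityMeasure P]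
    (M : IsConcentratedModel P α Q q ψ h μ κ₁ κ₃ κ a A r₀) (hμ : 0 < μ) : ∃ C : ℝ, 0 ≤ C ∧
      ∀ᶠ n : ℝ in atTop, ∀ η, η ≤ 1 / 4 → n ^ (1 - κ₃ / 4) ≤ η * n →
        (∀ r, n ^ (1 / 2 : ℝ) ≤ r → r ≤ 8 * n → h r - r * μ ≤ η ^ (-κ₃) * ψ r) →
        h ((1 + 4 * η) * n) - (1 + 4 * η) * n * μ ≤
          (h (2 * n) - 2 * n * μ) / 2 + C * ψ n * Real.log (1 / η) ^ (1 / κ₁) := by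
  obtain ⟨C₁, hC₁, hlower⟩ := M.exists_chain_lower_bound
  obtain ⟨C₂, hC₂, hcross⟩ := M.eventually_exists_crossing
  obtain ⟨C₃, hC₃, hlog⟩ := exists_rpow_log_le (K := 5 * (6 + C₂ + 2 * C₁) / (2 * μ))
    M.κ₁_pos (by positivity)
  have hA := M.one_le_A
  have hκ₁ := M.κ₁_pos
  have hκ₃ := M.κ₃_pos
  refine ⟨(2 + C₂ + 8 * A + 2 * C₁ * C₃) / 2, by positivity, ?_⟩
  filter_upwards [hlower, hcross, M.eventually_exists_isDepth 0, M.eventually_holeRadius (2 + μ),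
    eventually_ge_atTop 1] with n hlower hcross ⟨J, hJ⟩ hrad hn η hη hN hγ
  obtain ⟨hs1, hs2, hs3, -⟩ := hrad
  have hn0 : 0 < n := by linarith
  set u := n • axisVector d with hu
  set o' := (2 * n) • axisVector d with ho'
  have huo : ‖u - 0‖ = n := by rw [sub_zero, hu, norm_smul_axisVector hn0.le]
  have e1 : o' - 0 = (2 : ℝ) • (u - 0) := by
    rw [hu, ho']
    module
  have e2 : 0 - o' = (2 : ℝ) • (u - o') := by
    rw [hu, ho']
    module
  have huo' : ‖u - o'‖ = n := by
    rw [show u - o' = -u by rw [hu, ho']; module, norm_neg, hu, norm_smul_axisVector hn0.le]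
  obtain ⟨ω, hωB, ⟨hω, -⟩, c, hc, c', hc', hcn, hcn', hle⟩ := hcross _
    ((measure_union_le _ _).trans ((add_le_add (hlower η hη hN hγ 0 u huo)
      (hlower η hη hN hγ o' u huo')).trans (by
        rw [← ENNReal.ofReal_add (by norm_num) (by norm_num)]
        norm_num)))
  simp only [Set.mem_union, not_or, Set.mem_ofPred_eq, not_not] at hωB
  have hb := hωB.1 hω
  have hb' := hωB.2 hω
  set s := holeRadius κ₃ α n with hs
  have hN1 : 1 ≤ n ^ (1 - κ₃ / 4) := Real.one_le_rpow hn (by linarith [M.κ₃_lt])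
  have hηn0 : 0 < η * n := by linarith
  have hη0 : 0 < η := pos_of_mul_pos_left hηn0 hn0.le
  have hηn : η * n ≤ 1 / 4 * n := mul_le_mul_of_nonneg_right hη hn0.le
  have hsqrt : n ^ (1 / 2 : ℝ) ≤ η * n :=
    (Real.rpow_le_rpow_of_exponent_le hn (by linarith [M.κ₃_lt])).trans hN
  have hr₀ : r₀ ≤ η * n := hJ.r₀_le.trans hsqrt
  have hψ := hJ.one_le_scale
  have hψη := hJ.scale_le.trans hN
  have hμs : 0 ≤ μ * s := by positivity
  rw [pointTime_comm hc' (hω _).1] at hle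
  have hcc : 0 ≤ pointTime α (Q ω) c c' := pointTime_nonneg
  have h2n : h (2 * n) - 2 * n * μ ≤ η ^ (-κ₃) * ψ (2 * n) := hγ (2 * n) (by linarith) (by linarith)
  have hX := M.sq_mul_le_of_hasChainBound hμ hC₁ hC₂ hn0 (by linarith) hη0 hη (by linarith)
    (by linarith) (by linarith) h2n huo e1 hc hcn hb hb' (by
      have h1 := pointTime_triangle (α := α) (hω o').1 hc' hc
      rw [pointTime_comm hc' hc] at h1
      linarith)
  have hX' := M.sq_mul_le_of_hasChainBound hμ hC₁ hC₂ hn0 (by linarith) hη0 hη (by linarith)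
    (by linarith) (by linarith) h2n huo' e2 hc' hcn' hb' hb (by
      have h1 := pointTime_triangle (α := α) (hω 0).1 hc hc'
      linarith)
  have hlc := hlog η _ hη0 hη (by positivity) hX
  have hlc' := hlog η _ hη0 hη (by positivity) hX'
  obtain ⟨hc1, hc2⟩ := abs_le.1 hcn
  obtain ⟨hc1', hc2'⟩ := abs_le.1 hcn'
  obtain ⟨ρ, hρ, hρle⟩ := hb c hc (by linarith) (by linarith)
  obtain ⟨ρ', hρ', hρle'⟩ := hb' c' hc' (by linarith) (by linarith)
  set L := Real.log (1 / η) ^ (1 / κ₁) with hL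
  have hL1 : 1 ≤ L := by
    refine Real.one_le_rpow ?_ (by positivity)
    have h6 : 4 ≤ 1 / η := by
      rw [le_div_iff₀ hη0]
      linarith
    have h7 := Real.log_le_log (by norm_num) h6
    rw [show (4 : ℝ) = 2 ^ 2 by norm_num, Real.log_pow] at h7
    have h8 := Real.log_two_gt_d9
    push_cast at h7
    linarith
  -- The random radii are replaced by the fixed radius (1 + 4η)n. The gap δ lies between ηn and 4ηn,
  -- so subadditivity costs γ(δ) ≤ η^(-κ₃) ψ(δ) = O(ψ(n)).
  have hcomp : ∀ ρ x : ℝ, |x - n| ≤ s → |ρ - (1 + η) * x| ≤ η * n / 64 →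
      h ((1 + 4 * η) * n) - (1 + 4 * η) * n * μ ≤ h ρ - ρ * μ + 4 * A * ψ n := by
    intro ρ x hx hρ
    obtain ⟨h1, h2⟩ := abs_le.1 hx
    obtain ⟨h3, h4⟩ := abs_le.1 hρ
    have h5 : s ≤ η * n / 64 := by linarith
    have h6 : (1 + η) * x ≤ (1 + η) * (n + s) := by gcongr; linarith
    have h7 : (1 + η) * (n - s) ≤ (1 + η) * x := by gcongr; linarith
    have h8 : η * s ≤ s := mul_le_of_le_one_left (by linarith) (by linarith)
    set δ := (1 + 4 * η) * n - ρ with hδ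
    have hδ1 : η * n ≤ δ := by linarith
    have hδ2 : δ ≤ 2 * (2 * (η * n)) := by linarith
    have h9 := M.h_add_le ρ δ (by linarith) (by linarith)
    have h10 := hγ δ (by linarith) (by linarith)
    have h11 : ψ δ ≤ 4 * ψ (η * n) := by
      have h12 := M.scale.mono δ (2 * (2 * (η * n))) (by linarith) hδ2
      have h13 := M.scale_two_mul_le (r := η * n) (s := 2 * (η * n)) hr₀ (by linarith) le_rfl
      have h14 := M.scale_two_mul_le (r := 2 * (η * n)) (s := 2 * (2 * (η * n))) (by linarith)
        (by linarith) le_rfl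
      linarith
    have h12 := M.scale.ratio (η * n) n (by linarith) hsqrt (by linarith)
    rw [mul_div_cancel_right₀ _ hn0.ne'] at h12
    have h13 : η ^ (-κ₃) * ψ δ ≤ 4 * A * ψ n := by
      calc η ^ (-κ₃) * ψ δ ≤ η ^ (-κ₃) * (4 * (A * η ^ κ₃ * ψ n)) := by
            gcongr
            linarith
        _ = 4 * A * ψ n * (η ^ (-κ₃) * η ^ κ₃) := by ring
        _ = _ := by rw [← Real.rpow_add hη0]; simp
    have e : ρ + δ = (1 + 4 * η) * n := by rw [hδ]; ring
    rw [e] at h9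
    have e3 : δ * μ = (1 + 4 * η) * n * μ - ρ * μ := by rw [hδ]; ring
    linarith
  have g1 := hcomp ρ _ hcn hρ
  have g2 := hcomp ρ' _ hcn' hρ'
  have k1 : C₁ * ψ n * chainLog ψ n η ‖c - u‖ ^ (1 / κ₁) ≤ C₁ * ψ n * (C₃ * L) := by
    gcongr
    exact hlc
  have k2 : C₁ * ψ n * chainLog ψ n η ‖c' - u‖ ^ (1 / κ₁) ≤ C₁ * ψ n * (C₃ * L) := by
    gcongr
    exact hlc'
  have k3 : μ * (n - s) ≤ μ * ‖c - 0‖ := by gcongr; linarith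
  have k4 : μ * (n - s) ≤ μ * ‖c' - o'‖ := by gcongr; linarith
  have k5 : (2 + C₂ + 8 * A) * ψ n ≤ (2 + C₂ + 8 * A) * ψ n * L :=
    le_mul_of_one_le_right (by positivity) hL1
  have k6 : 2 * (μ * s) ≤ 2 * ψ n := by linarith
  linarith

end Step

end EuclideanFPP

namespace EuclideanFPP

/-! ### Induction on the number of iterated logarithms. -/

section Induction

lemma eventually_iterate_log_mono (k : ℕ) : ∀ᶠ r : ℝ in atTop, ∀ r', r ≤ r' →
    Real.log^[k] r ≤ Real.log^[k] r' := by
  induction k with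
  | zero => exact Eventually.of_forall fun r r' h => h
  | succ k ih =>
    filter_upwards [ih, (tendsto_iterate_log k).eventually_gt_atTop 0] with r h1 h2 r' h3
    simp only [Function.iterate_succ_apply']
    exact Real.log_le_log h2 (h1 r' h3)

lemma eventually_iterate_log_le_log {k : ℕ} (hk : 1 ≤ k) :
    ∀ᶠ r : ℝ in atTop, Real.log^[k] r ≤ Real.log r := by
  induction k, hk using Nat.le_induction with
  | base => exact Eventually.of_forall fun r => le_rfl
  | succ k _ ih =>
    filter_upwards [ih, (tendsto_iterate_log k).eventually_gt_atTop 0] with r h1 h2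
    simp only [Function.iterate_succ_apply']
    have := Real.log_le_sub_one_of_pos h2
    linarith

lemma eventually_iterate_log_mul_eight_le (k : ℕ) : ∀ᶠ m : ℝ in atTop,
    Real.log^[k] (8 * m) ≤ 8 * Real.log^[k] m := by
  obtain ⟨R, hR⟩ := eventually_atTop.1 (eventually_iterate_log_two k)
  filter_upwards [eventually_ge_atTop R, eventually_ge_atTop 0] with m h1 h2
  have h3 := (hR m h1 (2 * m) (by linarith) le_rfl).2
  have h4 := (hR (2 * m) (by linarith) (2 * (2 * m)) (by linarith) le_rfl).2
  have h5 := (hR (2 * (2 * m)) (by linarith) (2 * (2 * (2 * m))) (by linarith) le_rfl).2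
  rw [show 8 * m = 2 * (2 * (2 * m)) by ring]
  linarith

variable {Ω : Type*} [MeasurableSpace Ω] {P : Measure Ω} {d : ℕ} [NeZero d] {α : ℝ}
  {Q : Ω → Set (EuclideanSpace ℝ (Fin d))}
  {q : Ω → EuclideanSpace ℝ (Fin d) → EuclideanSpace ℝ (Fin d)} {ψ h : ℝ → ℝ}
  {μ κ₁ κ₃ κ a A r₀ : ℝ}

/-- The bound already known says γ ≤ Wψ on the relevant range, with W a power of log^(k) m. Taking η
= W^(-1/κ₃) turns it into the hypothesis of the improved halving inequality, whose error involves
log(1/η), of order log^(k+1) m. -/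
lemma IsConcentratedModel.eventually_le_iterate_log_succ [IsProbabilityMeasure P]
    (M : IsConcentratedModel P α Q q ψ h μ κ₁ κ₃ κ a A r₀) (hμ : 0 < μ) {k : ℕ} (hk : 1 ≤ k)
    {D : ℝ} (hD : 0 < D)
    (hle : ∀ᶠ m : ℝ in atTop, h m - m * μ ≤ D * ψ m * Real.log^[k] m ^ (1 / κ₁)) :
    ∃ D : ℝ, 0 < D ∧ ∀ᶠ m : ℝ in atTop,
      h m - m * μ ≤ D * ψ m * Real.log^[k + 1] m ^ (1 / κ₁) := by
  obtain ⟨C, hC, hstep⟩ := M.eventually_step hμ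
  have hκ₁ := M.κ₁_pos
  have hκ₃ := M.κ₃_pos
  set p := 1 / κ₁ with hp
  have hp0 : 0 < p := by positivity
  set E := (|Real.log D| + p * Real.log 8 + p) / κ₃ with hE
  have hlog8 : 0 < Real.log 8 := Real.log_pos (by norm_num)
  have hE0 : 0 ≤ E := by positivity
  refine M.eventually_le_of_halving (by omega) (C := C * E ^ p) (by positivity) ?_
  obtain ⟨R, hR⟩ := eventually_atTop.1 (hle.and ((eventually_iterate_log_mono k).and
    (((tendsto_iterate_log k).eventually_ge_atTop 0).and ((eventually_ge_atTop r₀).and hstep))))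
  have hW : Tendsto (fun m : ℝ => (D * (8 * Real.log^[k] m) ^ p) ^ (1 / κ₃)) atTop atTop :=
    (tendsto_rpow_atTop (by positivity)).comp
      (((tendsto_rpow_atTop hp0).comp ((tendsto_iterate_log k).const_mul_atTop
        (by norm_num : (0 : ℝ) < 8))).const_mul_atTop hD)
  filter_upwards [eventually_iterate_log_mul_eight_le k, eventually_iterate_log_le_log hk,
    hW.eventually_ge_atTop 12, (tendsto_iterate_log k).eventually_gt_atTop 0,
    (tendsto_iterate_log (k + 1)).eventually_ge_atTop 1, eventually_ge_atTop (2 * (max R 1) ^ 2),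
    eventually_mul_log_rpow_le (by positivity : 0 < κ₃ / 4) (p * (1 / κ₃))
      ((D * 8 ^ p) ^ (1 / κ₃)) (by positivity : (0 : ℝ) < (1 / 2) ^ (κ₃ / 4)),
    eventually_ge_atTop r₀]
    with m h8 hlog hW12 hΛ hΛ1 hm hpow hr₀
  have hr₀1 := M.one_le_r₀
  set Λ := Real.log^[k] m with hΛdef
  rw [Function.iterate_succ_apply', ← hΛdef] at hΛ1 ⊢
  -- The factor 8 allows for radii up to 8n ≤ 8m, where the iterated logarithm is at most 8Λ.
  set W := D * (8 * Λ) ^ p with hWdef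
  have hW0 : 0 < W := by positivity
  set η := W ^ (-(1 / κ₃)) with hηdef
  have hη0 : 0 < η := by positivity
  have hηi : η⁻¹ = W ^ (1 / κ₃) := by rw [hηdef, Real.rpow_neg hW0.le, inv_inv]
  -- Then 1 + 4η ≤ 4/3, so m' = 2n is at least 3m/2, as the halving argument requires.
  have hη12 : η ≤ 1 / 12 := by
    have g1 := inv_anti₀ (by norm_num : (0 : ℝ) < 12) hW12
    rw [← hηi, inv_inv] at g1
    linarith
  have hηW : η ^ (-κ₃) = W := by
    rw [hηdef, ← Real.rpow_mul hW0.le]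
    have : -(1 / κ₃) * -κ₃ = 1 := by field_simp
    rw [this, Real.rpow_one]
  set n := m / (1 + 4 * η) with hn
  have h1η : 0 < 1 + 4 * η := by linarith
  have hnm : (1 + 4 * η) * n = m := by
    rw [hn]
    field_simp
  have hm0 : 0 < m := by linarith
  have hn0 : 0 < n := by positivity
  have hn1 : 3 / 4 * m ≤ n := by
    rw [hn, le_div_iff₀ h1η]
    nlinarith
  have hn2 : n ≤ m := by nlinarith
  have hmax1 : 1 ≤ max R 1 := le_max_right _ _
  have hnR2 : (max R 1) ^ 2 ≤ n := by linarith
  have hnR : R ≤ n := by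
    have := le_max_left R 1
    nlinarith
  have hsqrt : R ≤ n ^ (1 / 2 : ℝ) := by
    rw [← Real.sqrt_eq_rpow]
    exact (le_max_left _ _).trans (Real.le_sqrt_of_sq_le hnR2)
  -- The inverse of η is at most a power of log m, hence at most n^(κ₃/4).
  have hN : n ^ (1 - κ₃ / 4) ≤ η * n := by
    have h1 : η⁻¹ ≤ n ^ (κ₃ / 4) := by
      calc η⁻¹ = (D * 8 ^ p) ^ (1 / κ₃) * Λ ^ (p * (1 / κ₃)) := by
            rw [hηi, hWdef, Real.mul_rpow (by norm_num) hΛ.le, ← mul_assoc,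
              Real.mul_rpow (by positivity) (by positivity), ← Real.rpow_mul hΛ.le]
        _ ≤ (D * 8 ^ p) ^ (1 / κ₃) * Real.log m ^ (p * (1 / κ₃)) := by gcongr
        _ ≤ (1 / 2) ^ (κ₃ / 4) * m ^ (κ₃ / 4) := hpow
        _ = (1 / 2 * m) ^ (κ₃ / 4) := by rw [Real.mul_rpow (by norm_num) hm0.le]
        _ ≤ _ := Real.rpow_le_rpow (by positivity) (by linarith) (by positivity)
    calc n ^ (1 - κ₃ / 4) = η * η⁻¹ * n ^ (1 - κ₃ / 4) := by
          rw [mul_inv_cancel₀ hη0.ne', one_mul]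
      _ ≤ η * n ^ (κ₃ / 4) * n ^ (1 - κ₃ / 4) := by gcongr
      _ = η * n := by
        rw [mul_assoc, ← Real.rpow_add hn0]
        simp
  have hγ : ∀ r, n ^ (1 / 2 : ℝ) ≤ r → r ≤ 8 * n → h r - r * μ ≤ η ^ (-κ₃) * ψ r := by
    intro r hr1 hr2
    obtain ⟨g1, g2, g3, g6, -⟩ := hR r (hsqrt.trans hr1)
    refine g1.trans ?_
    rw [hηW, hWdef]
    have g4 : Real.log^[k] r ≤ 8 * Λ := (g2 (8 * m) (by linarith)).trans h8
    have g5 : Real.log^[k] r ^ p ≤ (8 * Λ) ^ p := Real.rpow_le_rpow g3 g4 hp0.le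
    have g7 := (M.scale.pos r g6).le
    calc D * ψ r * Real.log^[k] r ^ p ≤ D * ψ r * (8 * Λ) ^ p := by gcongr
      _ = _ := by ring
  have hfin := (hR n hnR).2.2.2.2 η (by linarith) hN hγ
  rw [hnm] at hfin
  refine ⟨2 * n, by linarith, by linarith, hfin.trans ?_⟩
  have hlogη : Real.log (1 / η) ≤ E * Real.log Λ := by
    rw [one_div, hηi, Real.log_rpow hW0, hWdef, Real.log_mul hD.ne' (by positivity),
      Real.log_rpow (by positivity), Real.log_mul (by norm_num) hΛ.ne', hE]
    have g1 := le_abs_self (Real.log D)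
    have g2 : |Real.log D| ≤ |Real.log D| * Real.log Λ := le_mul_of_one_le_right (abs_nonneg _) hΛ1
    have g3 : p * Real.log 8 ≤ p * Real.log 8 * Real.log Λ :=
      le_mul_of_one_le_right (by positivity) hΛ1
    calc 1 / κ₃ * (Real.log D + p * (Real.log 8 + Real.log Λ))
        ≤ 1 / κ₃ * ((|Real.log D| + p * Real.log 8 + p) * Real.log Λ) := by
          gcongr
          linarith
      _ = _ := by ring
  have hlogη0 : 0 ≤ Real.log (1 / η) := Real.log_nonneg (by
    rw [le_div_iff₀ hη0]
    linarith)
  have hψn : ψ n ≤ ψ m := M.scale.mono n m (hR n hnR).2.2.2.1 hn2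
  have hψm := (M.scale.pos m hr₀).le
  have hfinal : C * ψ n * Real.log (1 / η) ^ p ≤ C * E ^ p * ψ m * Real.log Λ ^ p := by
    calc C * ψ n * Real.log (1 / η) ^ p ≤ C * ψ m * (E * Real.log Λ) ^ p := by
          gcongr
      _ = _ := by
        rw [Real.mul_rpow hE0 (by linarith)]
        ring
  linarith

lemma IsConcentratedModel.eventually_le_iterate_log [IsProbabilityMeasure P]
    (M : IsConcentratedModel P α Q q ψ h μ κ₁ κ₃ κ a A r₀) (hμ : 0 < μ) {k : ℕ} (hk : 1 ≤ k) :
    ∃ D : ℝ, 0 < D ∧ ∀ᶠ m : ℝ in atTop,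
      h m - m * μ ≤ D * ψ m * Real.log^[k] m ^ (1 / κ₁) := by
  induction k, hk using Nat.le_induction with
  | base => exact M.eventually_le_log
  | succ k hk ih =>
    obtain ⟨D, hD, h⟩ := ih
    exact M.eventually_le_iterate_log_succ hμ hk hD h

end Induction

end EuclideanFPP

theorem mainTheorem1 {Ω : Type*} [MeasurableSpace Ω] (P : Measure Ω) [IsProbabilityMeasure P]
    (d : ℕ) [NeZero d] (α : ℝ) (hα : 1 < α)
    (Q : Ω → Set (EuclideanSpace ℝ (Fin d))) (hQ : EuclideanFPP.IsPoissonProcess P Q)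
    (q : Ω → EuclideanSpace ℝ (Fin d) → EuclideanSpace ℝ (Fin d))
    (hq : ∀ᵐ ω ∂P, EuclideanFPP.IsClosestPointMap (Q ω) (q ω))
    (ψ : ℝ → ℝ) (hψ : ∀ x : ℝ, 0 < x → 0 < ψ x)
    (C₀ C₁ κ₁ κ₂ κ₃ : ℝ) (hC₀ : 0 < C₀) (hC₁ : 0 < C₁) (hκ₁ : 0 < κ₁) (hκ₂ : 0 < κ₂)
    (hκ₃ : 0 < κ₃) (hκ₃' : κ₃ < 1 / 2)
    (hconc : EuclideanFPP.Concentration P (EuclideanFPP.axisTime α Q q) ψ C₀ C₁ κ₁ κ₂)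
    (hgrowth : EuclideanFPP.RegularGrowth ψ κ₃) :
    (∀ n : ℝ, 0 ≤ n → Integrable (EuclideanFPP.axisTime α Q q n) P) ∧
    ∃ μ : ℝ,
      Tendsto (fun n : ℝ => (∫ ω, EuclideanFPP.axisTime α Q q n ω ∂P) / n) atTop (𝓝 μ) ∧
      ∀ k : ℕ, 1 ≤ k → ∃ D : ℝ, 0 < D ∧ ∀ᶠ n : ℝ in atTop,
        n * μ ≤ ∫ ω, EuclideanFPP.axisTime α Q q n ω ∂P ∧
        ∫ ω, EuclideanFPP.axisTime α Q q n ω ∂P ≤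
          n * μ + D * ψ n * (Real.log^[k] n) ^ (1 / κ₁) := by
  refine ⟨fun n _ => hQ.integrable_passageTime hα hq _ _, ?_⟩
  obtain ⟨μ, κ, a, A, r₀, M⟩ := hQ.exists_isConcentratedModel hα hq hψ hC₀ hC₁ hκ₁ hκ₂ hκ₃ hκ₃'
    hconc hgrowth
  refine ⟨μ, M.h_tendsto, fun k hk => ?_⟩
  obtain ⟨D, hD, hle⟩ := M.eventually_le_iterate_log (M.μ_pos hQ) hk
  refine ⟨D, hD, ?_⟩
  filter_upwards [hle, eventually_ge_atTop 0] with n hn hn0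
  exact ⟨M.h_ge n hn0, by linarith [show EuclideanFPP.meanTime P α Q q n =
    ∫ ω, EuclideanFPP.axisTime α Q q n ω ∂P from rfl]⟩
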